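/- **Setting.** Let $(\mathcal X,\mathfrak A,\sigma)$ be a $\sigma$-finite measure space with an atomic filtration: an increasing family of $\sigma$-algebras $\mathfrak A_n\subset\mathfrak A$, $n\in\mathbb Z$, such that for each $n$ there is a countable collection $\mathcal D_n\subset\mathfrak A_n$ of nonempty disjoint sets of finite measure (the atoms of generation $n$) such that every set in $\mathfrak A_n$ is a union of sets in $\mathcal D_n$. An atom is formally a pair $(I,n)$ with $I\in\mathcal D_n$, and $\operatorname{rk}(I,n)=n$. Let $\mathcal D$ be the collection of all atoms. For atoms, $I\subset J$ means inclusion of the sets together with $\operatorname{rk} I\ge \operatorname{rk} J$. The children of $I$, $\operatorname{ch} I$, are the atoms $I'\subset I$ with $\operatorname{rk} I'=\operatorname{rk} I+1$. Write $\langle f\rangle_I=\sigma(I)^{-1}\int_I f\,d\sigma$ (and $\langle f\rangle_I=0$ if $\sigma(I)=0$), $\mathbf E_I f=\langle f\rangle_I\mathbf 1_I$, and $\Delta_I=\sum_{I'\in\operatorname{ch} I}\mathbf E_{I'}-\mathbf E_I$. No homogeneity (doubling) of the filtration is assumed. Let $\mathbb F=\mathbb R$ or $\mathbb C$. A matrix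 weight is a function on $\mathcal X$ whose values are positive semidefinite $d\times d$ matrices over $\mathbb F$ and which is integrable on every atom. In what follows $|\cdot|$ is the Euclidean norm of vectors and the operator norm of matrices. For matrix weights $U,V$ put $$[U,V]_{\mathbf A_2}=\sup_{I\in\mathcal D}\bigl|\langle U\rangle_I^{1/2}\langle V\rangle_I^{1/2}\bigr|^2 .$$ For a scalar weight $w\ge 0$ let $[w]_{A_\infty}$ be the best constant $C$ such that $\langle M_Iw\rangle_I\le C\langle w\rangle_I$ for all $I\in\mathcal D$, where $M_Iw(x)=\sup\{|\langle w\rangle_{I'}|: I'\in\mathcal D,\ I'\subset I,\ x\in I'\}$ for $x\in I$ and $M_Iw(x)=0$ for $x\notin I$ ($[w]_{A_\infty}=\infty$ if there is no such finite $C$). For a matrix weight $U$ put $[U]_{\mathbf A_\infty}=\sup_{e\in\mathbb F^d}[w_e]_{A_\infty}$, where $w_e(x)=(U(x)e,e)$. The weighted square function is $$S^Vf(x)=\Bigl(\sum_{I\in\mathcal D}\bigl|V(x)^{1/2}\Delta_If(x)\bigr|^2\Bigr)^{1/2}.$$ **Theorem 1.1.** For every $d$ there is a constant $C_d<\infty$,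 depending only on $d$, such that for every atomic filtered space as above and all $d\times d$ matrix weights $U,V$ with $[U,V]_{\mathbf A_2}<\infty$ and $[U]_{\mathbf A_\infty}<\infty$, and for every $f\in L^2(\mathcal X;\mathbb F^d)$, $$\bigl\|S^V(U^{1/2}f)\bigr\|_{L^2}\le C_d\,[U,V]_{\mathbf A_2}^{1/2}\,[U]_{\mathbf A_\infty}^{1/2}\,\|f\|_{L^2}.$$ -/

import Mathlib

open MeasureTheory
open scoped ENNReal NNReal MatrixOrder ComplexOrder

/-- An atomic filtration of the measure space `(X, σ)`: an increasing sequence of sub-sigma-algebras,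
indexed by the integers, such that every member of the `n`-th one is a union of sets from a countable
collection of disjoint sets of finite measure (the atoms of generation `n`), which themselves belong
to the `n`-th sigma-algebra. -/
structure AtomicFiltration {X : Type*} [m : MeasurableSpace X] (σ : Measure X) where
  algebras : Filtration ℤ m
  atoms : ℤ → Set (Set X)
  countable_atoms : ∀ n, (atoms n).Countable
  disjoint_atoms : ∀ n, (atoms n).PairwiseDisjoint id
  nonempty_of_mem : ∀ n, ∀ I ∈ atoms n, I.Nonempty
  measurableSet_of_mem : ∀ n, ∀ I ∈ atoms n, MeasurableSet[algebras n] I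
  measure_lt_top : ∀ n, ∀ I ∈ atoms n, σ I < ∞
  eq_sUnion : ∀ n, ∀ A, MeasurableSet[algebras n] A → ∃ T ⊆ atoms n, A = ⋃₀ T

namespace AtomicFiltration

variable {X : Type*} [MeasurableSpace X] {σ : Measure X} (F : AtomicFiltration σ)

/-- An atom together with its generation: the same set may occur in several generations, and is then
counted once for each of them. -/
structure Atom where
  rk : ℤ
  carrier : Set X
  mem_atoms : carrier ∈ F.atoms rk

/-- Inclusion of atoms: inclusion of the sets, together with the inequality of the generations. -/
instance : LE F.Atom := ⟨fun I J => I.carrier ⊆ J.carrier ∧ J.rk ≤ I.rk⟩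

variable {F}

/-- The children of an atom `I` of generation `n`: the atoms of generation `n + 1` inside `I`. -/
def children (I : F.Atom) : Set F.Atom := {J | J ≤ I ∧ J.rk = I.rk + 1}

/-- The average `⟨f⟩_I`; it is `0` if `σ I = 0`. -/
noncomputable def avg {E : Type*} [NormedAddCommGroup E] [NormedSpace ℝ E]
    (I : F.Atom) (f : X → E) : E :=
  ⨍ x in I.carrier, f x ∂σ

/-- The averaging operator `E_I f = ⟨f⟩_I 1_I`. -/
noncomputable def averaging {E : Type*} [NormedAddCommGroup E] [NormedSpace ℝ E]
    (I : F.Atom) (f : X → E) : X → E :=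
  I.carrier.indicator fun _ => avg I f

/-- The martingale difference `Δ_I f`. The sum has at most one non-zero term at each point, since
the children of an atom are disjoint. -/
noncomputable def martingaleDiff {E : Type*} [NormedAddCommGroup E] [NormedSpace ℝ E]
    (I : F.Atom) (f : X → E) (x : X) : E :=
  (∑' J : children I, averaging (J : F.Atom) f x) - averaging I f x

/-- The maximal function localized to the atom `I`; it vanishes outside `I`. -/
noncomputable def localMaximal (I : F.Atom) (w : X → ℝ) (x : X) : ℝ≥0∞ :=
  ⨆ (J : F.Atom) (_ : J ≤ I) (_ : x ∈ J.carrier), ‖avg J w‖ₑ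

variable (F)

/-- The martingale `A_∞` characteristic of a scalar weight: the best constant `C` in
`⟨M_I w⟩_I ≤ C ⟨w⟩_I`, for all atoms `I`; it is `∞` if there is no finite one. -/
noncomputable def scalarAinfty (w : X → ℝ) : ℝ≥0∞ :=
  sInf {C : ℝ≥0∞ | ∀ I : F.Atom,
    ⨍⁻ x in I.carrier, localMaximal I w x ∂σ ≤ C * ENNReal.ofReal (avg I w)}

variable {𝕜 : Type*} [RCLike 𝕜] {d : ℕ}

/-- A matrix weight: a positive semidefinite matrix valued function, integrable on every atom. -/
structure IsMatrixWeight (W : X → Matrix (Fin d) (Fin d) 𝕜) : Prop where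
  posSemidef : ∀ x, (W x).PosSemidef
  integrableOn : ∀ (I : F.Atom) (i j : Fin d), IntegrableOn (fun x => W x i j) I.carrier σ

variable {F}

/-- The average `⟨W⟩_I` of a matrix valued function. -/
noncomputable def matAvg (I : F.Atom) (W : X → Matrix (Fin d) (Fin d) 𝕜) :
    Matrix (Fin d) (Fin d) 𝕜 :=
  Matrix.of fun i j => avg I fun x => W x i j

variable (F)

/-- The two-weight martingale matrix `A_2` characteristic
`[U, V] = sup_I ‖⟨U⟩_I^{1/2} ⟨V⟩_I^{1/2}‖²`, with the operator norm on the Euclidean space. -/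
noncomputable def jointA2 (U V : X → Matrix (Fin d) (Fin d) 𝕜) : ℝ≥0∞ :=
  ⨆ I : F.Atom,
    ‖Matrix.toEuclideanCLM (n := Fin d) (𝕜 := 𝕜)
      (CFC.sqrt (matAvg I U) * CFC.sqrt (matAvg I V))‖ₑ ^ 2

/-- The scalar martingale `A_∞` characteristic of a matrix weight: the supremum over the vectors `e`
of the characteristics of the scalar weights `x ↦ (W(x) e, e)`. -/
noncomputable def matrixAinfty (W : X → Matrix (Fin d) (Fin d) 𝕜) : ℝ≥0∞ :=
  ⨆ e : EuclideanSpace 𝕜 (Fin d),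
    F.scalarAinfty fun x => RCLike.re (inner 𝕜 e (Matrix.toEuclideanCLM (n := Fin d) (𝕜 := 𝕜) (W x) e))

/-- The weighted square function `S^V f(x) = (∑_I |V(x)^{1/2} Δ_I f(x)|²)^{1/2}`, over all atoms. -/
noncomputable def squareFunction (V : X → Matrix (Fin d) (Fin d) 𝕜)
    (f : X → EuclideanSpace 𝕜 (Fin d)) (x : X) : ℝ≥0∞ :=
  (∑' I : F.Atom,
    ‖Matrix.toEuclideanCLM (n := Fin d) (𝕜 := 𝕜) (CFC.sqrt (V x)) (martingaleDiff I f x)‖ₑ ^ 2)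
    ^ (1 / 2 : ℝ)

end AtomicFiltration

/-!
The proof works with operator valued functions `H` and `L`, which stand for the square roots of the
weights `U = H* H` and `V = L* L`. Write `U_J` for the average of `U` over the atom `J`, and `g_J`
for that of `g = H* f`. On each atom `J` let `h_J` be the weighted average of `f`, a solution of
`U_J h_J = g_J`. For a child `J'` of `J`,
`g_{J'} - g_J = U_{J'} (h_{J'} - h_J) + (U_{J'} - U_J) h_J`,
which splits the square function in two.

The vector `h_J` is the least squares coefficient of `f` on `J` with respect to the columns of `H`,
so Pythagoras, telescoped along the generations (`sum_least_squares_le`), bounds the sum of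
`‖H (h_{J'} - h_J)‖²` by `‖f‖²`. The `A₂` condition turns this into a bound for the first part.

The second part is a matrix Carleson embedding (`exists_weighted_average`) for the operators
`T_k = L (U_{J'} - U_J)`. The packing condition asks that, on every atom, the sum of `‖T_k v‖²` is
controlled by `‖H v‖²` for each fixed vector `v`. To prove the embedding, add to the least squares
functional the penalty `s ∑ ‖T_k p‖²` over the generations still to come, for `s = 0, …, d + 1`. For
`s ≥ 1` the telescoped Pythagoras identity bounds the sum of `‖T_k h_J^{(s)}‖²`, where `h_J^{(s)}` is
the penalized minimizer. The unpenalized minimizer `h_J = h_J^{(0)}` is a combination of the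
penalized ones, with coefficients that depend on the dimension only (`exists_shifted_solutions`):
the resolvents `(1 + s T)⁻¹` of a positive contraction `T` in dimension `d` are, up to a scalar
factor, polynomials in `s` of degree less than `d + 1`, which finite differences annihilate.

The packing condition (`testing_bound`) is where `A_∞` enters. Fix `v` and an atom `Q`, let
`r` be the square root of `U_Q`, and write the averages of `U v` over the atoms inside `Q` as `r`
applied to those of a vector function `a` (`exists_normalization`). The average of `‖a‖` over `Q` is
at most `c = (d ⟨U_Q v, v⟩)^{1/2}`. On a set of at least half the measure of `Q`, the averages and the square
function of `a` stay below multiples of `c` (`two_mul_measure_diff_goodSet_le`; no regularity of the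
filtration is used, since the jump at the exit time is estimated with the `A₂` condition on the atom
where the exit takes place). On this set the localized maximal function of the scalar weight
`‖H v‖²` is at least its average over `Q`, which pays for the sum up to the exit time; after the exit
time one iterates on the smaller atoms. The sum is thus at most a multiple of the integral of the
maximal function, to which the `A_∞` condition applies.
-/

/-! ### Positive operators: square roots and resolvents -/

section LinearAlgebra

variable {𝕜 : Type*} [RCLike 𝕜] {E : Type*} [NormedAddCommGroup E] [InnerProductSpace 𝕜 E]

section DiagonalOperator

variable {ι : Type*} [Fintype ι]

/-- The operator with the real eigenvalues `c i` along the orthonormal basis `b`. -/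
noncomputable def diagonalOperator (b : OrthonormalBasis ι 𝕜 E) (c : ι → ℝ) : E →L[𝕜] E :=
  ∑ i, (c i : 𝕜) • (innerSL 𝕜 (b i)).smulRight (b i)

theorem diagonalOperator_apply (b : OrthonormalBasis ι 𝕜 E) (c : ι → ℝ) (v : E) :
    diagonalOperator b c v = ∑ i, ((c i : 𝕜) * inner 𝕜 (b i) v) • b i := by
  simp [diagonalOperator, mul_smul]

theorem inner_basis_diagonalOperator (b : OrthonormalBasis ι 𝕜 E) (c : ι → ℝ) (v : E) (i : ι) :
    inner 𝕜 (b i) (diagonalOperator b c v) = (c i : 𝕜) * inner 𝕜 (b i) v := by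
  classical
  simp [diagonalOperator_apply, inner_sum, inner_smul_right, b.inner_eq_ite]

theorem OrthonormalBasis.ext_inner_basis (b : OrthonormalBasis ι 𝕜 E) {v w : E}
    (h : ∀ i, inner 𝕜 (b i) v = inner 𝕜 (b i) w) : v = w := by
  rw [← b.sum_repr' v, ← b.sum_repr' w]
  simp [h]

theorem diagonalOperator_comp (b : OrthonormalBasis ι 𝕜 E) (c c' : ι → ℝ) (v : E) :
    diagonalOperator b c (diagonalOperator b c' v) = diagonalOperator b (c * c') v :=
  b.ext_inner_basis fun i => by simp [inner_basis_diagonalOperator, mul_assoc]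

theorem diagonalOperator_inner (b : OrthonormalBasis ι 𝕜 E) (c : ι → ℝ) (v w : E) :
    inner 𝕜 (diagonalOperator b c v) w = inner 𝕜 v (diagonalOperator b c w) := by
  rw [diagonalOperator_apply, diagonalOperator_apply, sum_inner, inner_sum]
  refine Finset.sum_congr rfl fun i _ => ?_
  rw [inner_smul_left, inner_smul_right, map_mul, inner_conj_symm, RCLike.conj_ofReal]
  ring

theorem ContinuousLinearMap.IsPositive.exists_eq_diagonalOperator [FiniteDimensional 𝕜 E]
    {u : E →L[𝕜] E} (hu : u.IsPositive) :
    ∃ (b : OrthonormalBasis (Fin (Module.finrank 𝕜 E)) 𝕜 E) (c : Fin (Module.finrank 𝕜 E) → ℝ),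
      (∀ i, 0 ≤ c i) ∧ u = diagonalOperator b c := by
  have hs : (u : E →ₗ[𝕜] E).IsSymmetric := hu.isSymmetric
  refine ⟨hs.eigenvectorBasis rfl, hs.eigenvalues rfl, fun i => ?_, ?_⟩
  · have h := hu.re_inner_nonneg_right (hs.eigenvectorBasis rfl i)
    have h2 : u (hs.eigenvectorBasis rfl i) = _ := hs.apply_eigenvectorBasis rfl i
    rw [h2, inner_smul_right] at h
    simpa using h
  · ext1 v
    refine (hs.eigenvectorBasis rfl).ext_inner_basis fun i => ?_
    rw [inner_basis_diagonalOperator]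
    simpa [OrthonormalBasis.repr_apply_apply] using hs.eigenvectorBasis_apply_self_apply rfl v i

end DiagonalOperator

/-- A positive operator `u` has a square root `r`, and `r` has a pseudo-inverse `r'`: both are
symmetric and `r' r = r r'` is the projection on the range of `u`. -/
theorem ContinuousLinearMap.IsPositive.exists_sqrt_pseudoinverse [FiniteDimensional 𝕜 E]
    {u : E →L[𝕜] E} (hu : u.IsPositive) :
    ∃ r r' : E →L[𝕜] E, (∀ v w, inner 𝕜 (r v) w = inner 𝕜 v (r w)) ∧
      (∀ v w, inner 𝕜 (r' v) w = inner 𝕜 v (r' w)) ∧ (∀ v, r (r v) = u v) ∧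
      (∀ v, r (r' v) = r' (r v)) ∧ (∀ v, r (r' (r v)) = r v) ∧ ∀ v, ‖r' (r v)‖ ≤ ‖v‖ := by
  obtain ⟨b, c, hc, rfl⟩ := hu.exists_eq_diagonalOperator
  refine ⟨diagonalOperator b fun i => √(c i), diagonalOperator b fun i => (√(c i))⁻¹,
    diagonalOperator_inner _ _, diagonalOperator_inner _ _, fun v => ?_, fun v => ?_, fun v => ?_,
    fun v => ?_⟩
  · rw [diagonalOperator_comp]
    congr 2
    ext i
    simp [Real.mul_self_sqrt (hc i)]
  · rw [diagonalOperator_comp, diagonalOperator_comp, mul_comm]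
  · rw [diagonalOperator_comp, diagonalOperator_comp]
    congr 2
    ext i
    simp
  · rw [diagonalOperator_comp, ← sq_le_sq₀ (norm_nonneg _) (norm_nonneg _),
      ← b.sum_sq_norm_inner_right, ← b.sum_sq_norm_inner_right v]
    refine Finset.sum_le_sum fun i _ => ?_
    rw [inner_basis_diagonalOperator, norm_mul, mul_pow]
    refine mul_le_of_le_one_left (sq_nonneg _) ?_
    by_cases h : √(c i) = 0 <;> simp [h]

/-- The coefficients bound of `exists_shifted_solutions`. -/
def shiftConst (d : ℕ) : ℝ := 2 ^ (d + 1) * (d + 2) ^ d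

/-- For a positive contraction `T`, the vector `x` is a combination of the resolvents
`(1 + s T)⁻¹ x`, `s = 1, …, d + 1`, with coefficients controlled by the dimension: the vector
`∏ (1 + s λ_j) • (1 + s T)⁻¹ x` is a polynomial in `s` of degree less than `d + 1`, hence is
annihilated by the forward difference of order `d + 1`. -/
theorem exists_resolvent_combination {d : ℕ} (b : OrthonormalBasis (Fin d) 𝕜 E) (c : Fin d → ℝ)
    (hc : ∀ i, 0 ≤ c i) (hc1 : ∀ i, c i ≤ 1) (x : E) :
    ∃ (y : ℕ → E) (a : ℕ → ℝ), (∀ s, y s + (s : 𝕜) • diagonalOperator b c (y s) = x) ∧ y 0 = x ∧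
      (∀ s ∈ Finset.range (d + 1), |a s| ≤ shiftConst d) ∧
      x = ∑ s ∈ Finset.range (d + 1), (a s : 𝕜) • y (s + 1) := by
  have hpos : ∀ (s : ℕ) i, 0 < 1 + s * c i := fun s i => by have := hc i; positivity
  set n := d + 1 with hn
  let a : ℕ → ℝ := fun s => (-1) ^ s * (n.choose (s + 1)) * ∏ j, (1 + ((s + 1 : ℕ) : ℝ) * c j)
  refine ⟨fun s => diagonalOperator b (fun i => (1 + s * c i)⁻¹) x, a, fun s => ?_, ?_, ?_, ?_⟩
  · refine b.ext_inner_basis fun i => ?_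
    have := (hpos s i).ne'
    simp only [inner_add_right, inner_smul_right, inner_basis_diagonalOperator]
    have h2 : ((1 + s * c i)⁻¹ : ℝ) + s * c i * (1 + s * c i)⁻¹ = 1 := by field_simp
    have h3 := congrArg (fun t : ℝ => (t : 𝕜)) h2
    push_cast at h3 ⊢
    linear_combination (inner 𝕜 (b i) x) * h3
  · refine b.ext_inner_basis fun i => ?_
    simp [inner_basis_diagonalOperator]
  · intro s hs
    have hs' : s + 1 ≤ d + 1 := Finset.mem_range.1 hs
    rw [abs_mul, abs_mul, abs_pow, abs_neg, abs_one, one_pow, one_mul, shiftConst]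
    refine mul_le_mul ?_ ?_ (abs_nonneg _) (by positivity)
    · rw [Nat.abs_cast]
      exact_mod_cast Nat.choose_le_two_pow _ _
    · rw [Finset.abs_prod]
      refine (Finset.prod_le_prod (fun _ _ => abs_nonneg _) (g := fun _ => (d + 2 : ℝ))
        fun j _ => ?_).trans (by simp)
      rw [abs_of_pos (hpos _ _)]
      have : ((s + 1 : ℕ) : ℝ) ≤ d + 1 := by exact_mod_cast hs'
      nlinarith [hc j, hc1 j]
  · refine b.ext_inner_basis fun i => ?_
    simp only [inner_sum, inner_smul_right, inner_basis_diagonalOperator]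
    let p : Polynomial ℝ := ∏ j ∈ Finset.univ.erase i, (1 + Polynomial.X * Polynomial.C (c j))
    have hp : p.natDegree < n := by
      refine Nat.lt_succ_of_le ((Polynomial.natDegree_prod_le _ _).trans ?_)
      refine (Finset.sum_le_card_nsmul _ _ 1 fun j _ => ?_).trans ?_
      · compute_degree
      · simp only [smul_eq_mul, mul_one]
        exact (Finset.card_erase_le).trans (by simp)
    have h0 := congrFun (Polynomial.fwdDiff_iter_eq_zero_of_degree_lt hp) 0
    rw [fwdDiff_iter_eq_sum_shift, Finset.sum_range_succ'] at h0
    have hp0 : p.eval 0 = 1 := by simp [p, Polynomial.eval_prod]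
    have hps : ∀ s : ℕ, p.eval ((s : ℝ)) =
        (∏ j, (1 + (s : ℝ) * c j)) * (1 + (s : ℝ) * c i)⁻¹ := fun s => by
      rw [← Finset.mul_prod_erase _ _ (Finset.mem_univ i)]
      have := (hpos s i).ne'
      simp only [p, Polynomial.eval_prod, Polynomial.eval_add, Polynomial.eval_one,
        Polynomial.eval_mul, Polynomial.eval_X, Polynomial.eval_C]
      field_simp
    have h1 : ∑ s ∈ Finset.range n, a s * (1 + ((s + 1 : ℕ) : ℝ) * c i)⁻¹ = 1 := by
      have hsgn : ((-1 : ℝ) ^ n) * (-1) ^ n = 1 := by rw [← mul_pow]; simp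
      have h2 : ∑ s ∈ Finset.range n, a s * (1 + ((s + 1 : ℕ) : ℝ) * c i)⁻¹ =
          - (-1) ^ n * ∑ s ∈ Finset.range n, ((-1 : ℤ) ^ (n - (s + 1)) * (n.choose (s + 1) : ℤ)) •
            p.eval (0 + (s + 1) • (1 : ℝ)) := by
        rw [Finset.mul_sum]
        refine Finset.sum_congr rfl fun s hs => ?_
        have hs' : s + 1 ≤ n := Finset.mem_range.1 hs
        have e : (0 : ℝ) + (s + 1) • (1 : ℝ) = ((s + 1 : ℕ) : ℝ) := by simp
        rw [e, hps]
        obtain ⟨m, hm⟩ := Nat.exists_eq_add_of_le hs'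
        have e2 : n - (s + 1) = m := by omega
        have e3 : (-1 : ℝ) ^ n = - (-1) ^ s * (-1) ^ m := by rw [hm]; ring
        have e4 : ((-1 : ℝ) ^ m) * (-1) ^ m = 1 := by rw [← mul_pow]; simp
        rw [e2, e3, zsmul_eq_mul]
        push_cast
        simp only [a]
        push_cast
        linear_combination (-(-1) ^ s * (n.choose (s + 1) : ℝ) *
          ((∏ j, (1 + ((s : ℝ) + 1) * c j)) * (1 + ((s : ℝ) + 1) * c i)⁻¹)) * e4
      rw [h2]
      simp only [zsmul_eq_mul, zero_smul, add_zero, hp0, Nat.sub_zero, Nat.choose_zero_right,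
        Pi.zero_apply] at h0 ⊢
      push_cast at h0 ⊢
      linear_combination (-(-1) ^ n) * h0 + hsgn
    have h3 := congrArg (fun t : ℝ => (t : 𝕜) * inner 𝕜 (b i) x) h1
    simp only [RCLike.ofReal_sum, Finset.sum_mul, RCLike.ofReal_one, one_mul] at h3
    refine h3.symm.trans ?_
    refine Finset.sum_congr rfl fun s _ => ?_
    push_cast
    ring

/-- If `0 ≤ m ≤ u`, the equations `(u + s m) y = u z`, `s = 0, …, d + 1`, have solutions `y_s` such
that `y_0` is a combination of the others with coefficients controlled by the dimension `d`. -/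
theorem exists_shifted_solutions [FiniteDimensional 𝕜 E] {d : ℕ} (hd : Module.finrank 𝕜 E = d)
    {u m : E →L[𝕜] E} (hu : u.IsPositive) (hm : m.IsPositive)
    (hmu : ∀ v, RCLike.re (inner 𝕜 v (m v)) ≤ RCLike.re (inner 𝕜 v (u v))) (z : E) :
    ∃ (y : ℕ → E) (a : ℕ → ℝ), (∀ s : ℕ, u (y s) + (s : 𝕜) • m (y s) = u z) ∧
      (∀ s ∈ Finset.range (d + 1), |a s| ≤ shiftConst d) ∧
      y 0 = ∑ s ∈ Finset.range (d + 1), (a s : 𝕜) • y (s + 1) := by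
  subst hd
  obtain ⟨r, r', hr, hr', hru, hc, hrr, hle⟩ := hu.exists_sqrt_pseudoinverse
  have hmsymm : ∀ v w, inner 𝕜 (m v) w = inner 𝕜 v (m w) := hm.isSymmetric
  -- the form of `m` vanishes on the kernel of `u`
  have hker : ∀ v, u v = 0 → m v = 0 := fun v hv => by
    obtain ⟨q, q', hq, -, hqm, -⟩ := hm.exists_sqrt_pseudoinverse
    have h := hmu v
    rw [hv, inner_zero_right, ← hqm, ← hq, inner_self_eq_norm_sq] at h
    have : q v = 0 := by
      rw [← norm_eq_zero]
      have h0 : ‖q v‖ ^ 2 ≤ 0 := by simpa using h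
      exact pow_eq_zero_iff (two_ne_zero) |>.1 (le_antisymm h0 (sq_nonneg _))
    rw [← hqm, this, map_zero]
  have hmp : ∀ v, m (r' (r v)) = m v := fun v => by
    have h : m (r' (r v) - v) = 0 := hker _ (by rw [map_sub, ← hru, hrr, hru, sub_self])
    rwa [map_sub, sub_eq_zero] at h
  have hpm : ∀ v, r (r' (m v)) = m v := fun v => by
    refine ext_inner_right 𝕜 fun w => ?_
    rw [hr, hr', hmsymm, hmp, hmsymm]
  -- the contraction `r' m r'`, conjugate to `m` relative to `u`
  have hT : (r'.comp (m.comp r')).IsPositive := by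
    refine ContinuousLinearMap.isPositive_def.2 ⟨fun v w => by simp [hr', hmsymm], fun v => ?_⟩
    have := hm.re_inner_nonneg_left (r' v)
    simpa [hr', ContinuousLinearMap.reApplyInnerSelf_apply] using this
  obtain ⟨b, c, hc0, hbc⟩ := hT.exists_eq_diagonalOperator
  have hc1 : ∀ i, c i ≤ 1 := fun i => by
    have h1 : inner 𝕜 (b i) ((r'.comp (m.comp r')) (b i)) = (c i : 𝕜) := by
      rw [hbc, inner_basis_diagonalOperator]; simp
    have h2 := hmu (r' (b i))
    rw [← hru, ← hr, inner_self_eq_norm_sq, hc] at h2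
    simp only [ContinuousLinearMap.comp_apply] at h1
    rw [← hr'] at h1
    rw [h1, RCLike.ofReal_re] at h2
    refine h2.trans ?_
    have := hle (b i)
    simp only [OrthonormalBasis.norm_eq_one] at this
    nlinarith [norm_nonneg (r' (r (b i)))]
  obtain ⟨y, a, hy, hy0, ha, hx⟩ := exists_resolvent_combination b c hc0 hc1 (r z)
  refine ⟨fun s => r' (y s), a, fun s => ?_, ha, ?_⟩
  · have h := congrArg r (hy s)
    rw [← hbc, map_add, map_smul] at h
    simp only [ContinuousLinearMap.comp_apply, hpm] at h
    rw [← hru, ← hru z, ← h, hc (y s), hrr]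
  · simp only
    rw [hy0]
    conv_lhs => rw [hx]
    simp

end LinearAlgebra

/-! ### Atoms of an atomic filtration -/

namespace AtomicFiltration

section Atoms

variable {X : Type*} [mX : MeasurableSpace X] {σ : Measure X} {F : AtomicFiltration σ}

theorem Atom.ext_carrier {I J : F.Atom} (h : I.rk = J.rk) (h' : I.carrier = J.carrier) :
    I = J := by
  cases I; cases J; simp_all

theorem Atom.measurableSet_algebras (I : F.Atom) : MeasurableSet[F.algebras I.rk] I.carrier :=
  F.measurableSet_of_mem _ _ I.mem_atoms

theorem Atom.measurableSet (I : F.Atom) : MeasurableSet I.carrier :=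
  F.algebras.le _ _ I.measurableSet_algebras

theorem Atom.measure_ne_top (I : F.Atom) : σ I.carrier ≠ ∞ :=
  (F.measure_lt_top _ _ I.mem_atoms).ne

instance (I : F.Atom) : IsFiniteMeasure (σ.restrict I.carrier) :=
  ⟨by simpa using F.measure_lt_top _ _ I.mem_atoms⟩

theorem Atom.eq_of_mem {I J : F.Atom} (h : I.rk = J.rk) {x : X} (hI : x ∈ I.carrier)
    (hJ : x ∈ J.carrier) : I = J := by
  refine Atom.ext_carrier h ((F.disjoint_atoms J.rk).elim (h ▸ I.mem_atoms) J.mem_atoms ?_)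
  exact Set.not_disjoint_iff.2 ⟨x, hI, hJ⟩

theorem exists_atom_subset {k : ℤ} {A : Set X} (hA : MeasurableSet[F.algebras k] A) {x : X}
    (hx : x ∈ A) : ∃ I : F.Atom, I.rk = k ∧ x ∈ I.carrier ∧ I.carrier ⊆ A := by
  obtain ⟨T, hT, rfl⟩ := F.eq_sUnion k A hA
  obtain ⟨t, ht, hxt⟩ := hx
  exact ⟨⟨k, t, hT ht⟩, rfl, hxt, Set.subset_sUnion_of_mem ht⟩

variable (F) in
theorem exists_atom (k : ℤ) (x : X) : ∃ I : F.Atom, I.rk = k ∧ x ∈ I.carrier := by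
  obtain ⟨I, h, hx, -⟩ := exists_atom_subset (F := F) (k := k) MeasurableSet.univ (Set.mem_univ x)
  exact ⟨I, h, hx⟩

variable (F) in
/-- The atom of generation `k` containing `x`. -/
noncomputable def atomAt (k : ℤ) (x : X) : F.Atom := (F.exists_atom k x).choose

@[simp] theorem rk_atomAt (k : ℤ) (x : X) : (F.atomAt k x).rk = k :=
  (F.exists_atom k x).choose_spec.1

theorem mem_atomAt (k : ℤ) (x : X) : x ∈ (F.atomAt k x).carrier :=
  (F.exists_atom k x).choose_spec.2

theorem atomAt_eq {I : F.Atom} {x : X} (hx : x ∈ I.carrier) : F.atomAt I.rk x = I :=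
  Atom.eq_of_mem (rk_atomAt _ _) (mem_atomAt _ _) hx

theorem Atom.le_of_mem {I J : F.Atom} {x : X} (hI : x ∈ I.carrier) (hJ : x ∈ J.carrier)
    (h : I.rk ≤ J.rk) : J ≤ I := by
  obtain ⟨K, hK, hxK, hKI⟩ :=
    exists_atom_subset (F.algebras.mono h _ I.measurableSet_algebras) hI
  obtain rfl := Atom.eq_of_mem hK hxK hJ
  exact ⟨hKI, h⟩

theorem Atom.le_refl (I : F.Atom) : I ≤ I := ⟨subset_rfl, _root_.le_refl _⟩

theorem Atom.le_trans {I J K : F.Atom} (h : I ≤ J) (h' : J ≤ K) : I ≤ K :=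
  ⟨h.1.trans h'.1, h'.2.trans h.2⟩

theorem atomAt_le {I : F.Atom} {x : X} (hx : x ∈ I.carrier) {k : ℤ} (hk : I.rk ≤ k) :
    F.atomAt k x ≤ I :=
  Atom.le_of_mem hx (mem_atomAt _ _) (by simpa using hk)

theorem atomAt_eq_atomAt {I : F.Atom} {x y : X} (hx : x ∈ I.carrier) (hy : y ∈ I.carrier) {k : ℤ}
    (hk : k ≤ I.rk) : F.atomAt k x = F.atomAt k y := by
  have h : I ≤ F.atomAt k x := Atom.le_of_mem (mem_atomAt _ _) hx (by simpa using hk)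
  exact Atom.eq_of_mem (by simp) (h.1 hy) (mem_atomAt _ _)

/-! ### Measurability and integration level by level -/

theorem preimage_atoms_eq {β : Type*} {k : ℤ} {φ : X → β}
    (hφ : ∀ x y, F.atomAt k x = F.atomAt k y → φ x = φ y) (s : Set β) :
    φ ⁻¹' s = ⋃ A ∈ {A ∈ F.atoms k | A ⊆ φ ⁻¹' s}, A := by
  ext x
  simp only [Set.mem_iUnion, Set.mem_ofPred_eq, exists_prop]
  refine ⟨fun hx => ⟨(F.atomAt k x).carrier, ⟨?_, fun y hy => ?_⟩, mem_atomAt _ _⟩,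
    fun ⟨A, hA, hx⟩ => hA.2 hx⟩
  · have := (F.atomAt k x).mem_atoms
    rwa [rk_atomAt] at this
  · have : F.atomAt k x = F.atomAt k y :=
      atomAt_eq_atomAt (I := F.atomAt k x) (mem_atomAt _ _) hy (by simp)
    simpa [hφ x y this] using hx

/-- A function that is constant on the atoms of one generation is measurable. -/
theorem measurable_of_atomAt {β : Type*} [MeasurableSpace β] {k : ℤ} {φ : X → β}
    (hφ : ∀ x y, F.atomAt k x = F.atomAt k y → φ x = φ y) : Measurable φ := by
  intro s _
  rw [preimage_atoms_eq hφ]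
  refine MeasurableSet.biUnion ((F.countable_atoms k).mono fun A hA => hA.1) fun A hA => ?_
  exact F.algebras.le _ _ (F.measurableSet_of_mem k A hA.1)

theorem countable_range_of_atomAt {β : Type*} {k : ℤ} {φ : X → β}
    (hφ : ∀ x y, F.atomAt k x = F.atomAt k y → φ x = φ y) : (Set.range φ).Countable := by
  have hc : (Set.range fun x => F.atomAt k x).Countable := by
    refine Set.MapsTo.countable_of_injOn (f := Atom.carrier) (t := F.atoms k) ?_ ?_
      (F.countable_atoms k)
    · rintro _ ⟨x, rfl⟩
      have := (F.atomAt k x).mem_atoms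
      rwa [rk_atomAt] at this
    · rintro _ ⟨x, rfl⟩ _ ⟨y, rfl⟩ h
      exact Atom.ext_carrier (by simp) h
  have hne : ∀ I : F.Atom, I.carrier.Nonempty := fun I => F.nonempty_of_mem _ _ I.mem_atoms
  refine (hc.image fun I => φ (hne I).some).mono ?_
  rintro _ ⟨x, rfl⟩
  refine ⟨F.atomAt k x, ⟨x, rfl⟩, hφ _ _ ?_⟩
  exact atomAt_eq_atomAt (hne _).some_mem (mem_atomAt _ _) (by simp)

theorem stronglyMeasurable_of_atomAt {β : Type*} [TopologicalSpace β]
    [TopologicalSpace.PseudoMetrizableSpace β] {k : ℤ} {φ : X → β}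
    (hφ : ∀ x y, F.atomAt k x = F.atomAt k y → φ x = φ y) : StronglyMeasurable φ := by
  let : MeasurableSpace β := borel β
  have : BorelSpace β := ⟨rfl⟩
  exact stronglyMeasurable_iff_measurable_separable.2
    ⟨measurable_of_atomAt hφ, (countable_range_of_atomAt hφ).isSeparable⟩

theorem setLIntegral_eq_tsum {A : Set X} {k : ℤ} (hA : MeasurableSet[F.algebras k] A)
    (φ : X → ℝ≥0∞) :
    ∫⁻ x in A, φ x ∂σ = ∑' B : {B ∈ F.atoms k | B ⊆ A}, ∫⁻ x in (B : Set X), φ x ∂σ := by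
  have hU : A = ⋃ B ∈ {B ∈ F.atoms k | B ⊆ A}, B := by
    ext x
    simp only [Set.mem_iUnion, Set.mem_ofPred_eq, exists_prop]
    refine ⟨fun hx => ?_, fun ⟨B, hB, hx⟩ => hB.2 hx⟩
    obtain ⟨I, rfl, hxI, hIA⟩ := exists_atom_subset hA hx
    exact ⟨I.carrier, ⟨I.mem_atoms, hIA⟩, hxI⟩
  conv_lhs => rw [hU]
  exact lintegral_biUnion ((F.countable_atoms k).mono fun B hB => hB.1)
    (fun B hB => F.algebras.le _ _ (F.measurableSet_of_mem k B hB.1))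
    ((F.disjoint_atoms k).subset fun B hB => hB.1) φ

/-- To compare two integrals over a set of generation `k`, it suffices to compare them over the
atoms of generation `k` inside it that have positive measure. -/
theorem setLIntegral_le_of_atoms {A : Set X} {k : ℤ} (hA : MeasurableSet[F.algebras k] A)
    {φ ψ : X → ℝ≥0∞}
    (h : ∀ J : F.Atom, J.rk = k → J.carrier ⊆ A → σ J.carrier ≠ 0 →
      ∫⁻ x in J.carrier, φ x ∂σ ≤ ∫⁻ x in J.carrier, ψ x ∂σ) :
    ∫⁻ x in A, φ x ∂σ ≤ ∫⁻ x in A, ψ x ∂σ := by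
  rw [setLIntegral_eq_tsum hA, setLIntegral_eq_tsum hA]
  refine ENNReal.tsum_le_tsum fun B => ?_
  by_cases h0 : σ (B : Set X) = 0
  · simp [Measure.restrict_eq_zero.2 h0]
  · exact h ⟨k, B, B.2.1⟩ rfl B.2.2 h0

theorem Atom.setLIntegral_le_of_atoms (I : F.Atom) {k : ℤ} (hk : I.rk ≤ k) {φ ψ : X → ℝ≥0∞}
    (h : ∀ J : F.Atom, J.rk = k → J ≤ I → σ J.carrier ≠ 0 →
      ∫⁻ x in J.carrier, φ x ∂σ ≤ ∫⁻ x in J.carrier, ψ x ∂σ) :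
    ∫⁻ x in I.carrier, φ x ∂σ ≤ ∫⁻ x in I.carrier, ψ x ∂σ :=
  AtomicFiltration.setLIntegral_le_of_atoms (F.algebras.mono hk _ I.measurableSet_algebras)
    fun J hJ hJI => h J hJ ⟨hJI, hJ ▸ hk⟩

theorem lintegral_le_of_atoms (k : ℤ) {φ ψ : X → ℝ≥0∞}
    (h : ∀ J : F.Atom, J.rk = k →
      ∫⁻ x in J.carrier, φ x ∂σ ≤ ∫⁻ x in J.carrier, ψ x ∂σ) :
    ∫⁻ x, φ x ∂σ ≤ ∫⁻ x, ψ x ∂σ := by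
  simpa using setLIntegral_le_of_atoms (F := F) (k := k) MeasurableSet.univ
    (φ := φ) (ψ := ψ) fun J hJ _ _ => h J hJ

theorem aestronglyMeasurable_of_atoms {β : Type*} [TopologicalSpace β]
    [TopologicalSpace.PseudoMetrizableSpace β] {φ : X → β}
    (h : ∀ J : F.Atom, AEStronglyMeasurable φ (σ.restrict J.carrier)) :
    AEStronglyMeasurable φ σ := by
  have : Countable (F.atoms 0) := F.countable_atoms 0
  have hU : (⋃ B : F.atoms 0, (B : Set X)) = Set.univ := by
    refine Set.eq_univ_of_forall fun x => ?_
    have := (F.atomAt 0 x).mem_atoms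
    rw [rk_atomAt] at this
    exact Set.mem_iUnion.2 ⟨⟨_, this⟩, mem_atomAt _ _⟩
  rw [← Measure.restrict_univ (μ := σ), ← hU]
  exact AEStronglyMeasurable.iUnion fun B => h ⟨0, B, B.2⟩

/-! ### Averages -/

variable {E : Type*} [NormedAddCommGroup E] [NormedSpace ℝ E]

variable (F) in
/-- The average of `f` over the atoms of generation `k`: the conditional expectation of `f`. -/
noncomputable def levelAvg (k : ℤ) (f : X → E) (x : X) : E := avg (F.atomAt k x) f

theorem levelAvg_of_mem {J : F.Atom} (f : X → E) {x : X} (hx : x ∈ J.carrier) :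
    F.levelAvg J.rk f x = avg J f := by
  rw [levelAvg, atomAt_eq hx]

theorem martingaleDiff_eq (I : F.Atom) (f : X → E) {x : X} (hx : x ∈ I.carrier) :
    martingaleDiff I f x = F.levelAvg (I.rk + 1) f x - F.levelAvg I.rk f x := by
  rw [martingaleDiff, averaging, Set.indicator_of_mem hx, levelAvg_of_mem f hx,
    tsum_eq_single ⟨F.atomAt (I.rk + 1) x, atomAt_le hx (by simp), by simp⟩]
  · rw [averaging, Set.indicator_of_mem (mem_atomAt _ _)]
    rfl
  · rintro ⟨J, hJ⟩ hne
    refine Set.indicator_of_notMem (fun hxJ => hne ?_) _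
    have := atomAt_eq hxJ
    rw [hJ.2] at this
    simp [this]

theorem martingaleDiff_of_notMem (I : F.Atom) (f : X → E) {x : X} (hx : x ∉ I.carrier) :
    martingaleDiff I f x = 0 := by
  rw [martingaleDiff, averaging, Set.indicator_of_notMem hx, sub_zero]
  convert tsum_zero with J
  exact Set.indicator_of_notMem (fun h => hx (J.2.1.1 h)) _

/-- Summing over all atoms amounts, at each point, to summing over the generations. -/
theorem tsum_martingaleDiff (f : X → E) (ψ : E → ℝ≥0∞) (hψ : ψ 0 = 0) (x : X) :
    ∑' I : F.Atom, ψ (martingaleDiff I f x) =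
      ∑' k : ℤ, ψ (F.levelAvg (k + 1) f x - F.levelAvg k f x) := by
  have hinj : Function.Injective fun k => F.atomAt k x := fun k l h => by
    simpa using congrArg Atom.rk h
  rw [← hinj.tsum_eq (f := fun I => ψ (martingaleDiff I f x))]
  · refine tsum_congr fun k => ?_
    rw [martingaleDiff_eq _ _ (mem_atomAt _ _), rk_atomAt]
  · intro I hI
    by_contra hIx
    refine hI ?_
    simp only
    rw [martingaleDiff_of_notMem, hψ]
    exact fun hx => hIx ⟨I.rk, atomAt_eq hx⟩

theorem measure_real_smul_avg (I : F.Atom) (f : X → E) :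
    σ.real I.carrier • avg I f = ∫ x in I.carrier, f x ∂σ := by
  rw [avg]
  exact measure_smul_setAverage f I.measure_ne_top

theorem avg_eq (I : F.Atom) (f : X → E) :
    avg I f = (σ.real I.carrier)⁻¹ • ∫ x in I.carrier, f x ∂σ := by
  rw [avg, setAverage_eq]

end Atoms

end AtomicFiltration

/-! ### Gram operators and least squares -/

section LeastSquares

variable {X : Type*} [MeasurableSpace X] {μ : Measure X} {𝕜 : Type*} [RCLike 𝕜]
  {E : Type*} [NormedAddCommGroup E] [InnerProductSpace 𝕜 E]

theorem MeasureTheory.MemLp.integrable_sq_norm {G : Type*} [NormedAddCommGroup G] {f : X → G}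
    (hf : MemLp f 2 μ) : Integrable (fun x => ‖f x‖ ^ 2) μ :=
  (memLp_two_iff_integrable_sq_norm hf.1).1 hf

theorem lintegral_enorm_sq_eq {G : Type*} [NormedAddCommGroup G] {f : X → G} (hf : MemLp f 2 μ) :
    ∫⁻ x, ‖f x‖ₑ ^ 2 ∂μ = ENNReal.ofReal (∫ x, ‖f x‖ ^ 2 ∂μ) := by
  rw [ofReal_integral_eq_lintegral_ofReal hf.integrable_sq_norm
    (Filter.Eventually.of_forall fun x => by positivity)]
  refine lintegral_congr fun x => ?_
  rw [← ofReal_norm, ENNReal.ofReal_pow (norm_nonneg _)]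

theorem MeasureTheory.MemLp.clm_apply_const {T : X → E →L[𝕜] E} (hT : MemLp T 2 μ) (v : E) :
    MemLp (fun x => T x v) 2 μ := by
  refine MemLp.of_le_mul (c := ‖v‖) hT ?_ (Filter.Eventually.of_forall fun x => ?_)
  · exact (ContinuousLinearMap.apply 𝕜 E v).continuous.comp_aestronglyMeasurable hT.1
  · rw [mul_comm]
    exact (T x).le_opNorm v

variable [CompleteSpace E]

theorem integrable_adjoint_comp_self {T : X → E →L[𝕜] E} (hT : MemLp T 2 μ) :
    Integrable (fun x => (ContinuousLinearMap.adjoint (T x)).comp (T x)) μ := by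
  have hc : Continuous fun S : E →L[𝕜] E => (ContinuousLinearMap.adjoint S).comp S :=
    (ContinuousLinearMap.adjoint (𝕜 := 𝕜) (E := E) (F := E)).continuous.clm_comp continuous_id
  refine Integrable.mono' hT.integrable_sq_norm
    (hc.comp_aestronglyMeasurable hT.1) (Filter.Eventually.of_forall fun x => ?_)
  refine (ContinuousLinearMap.opNorm_comp_le _ _).trans ?_
  rw [LinearIsometryEquiv.norm_map]
  simp [sq]

theorem integrable_adjoint_apply {H : X → E →L[𝕜] E} (hH : MemLp H 2 μ) {f : X → E}
    (hf : MemLp f 2 μ) : Integrable (fun x => ContinuousLinearMap.adjoint (H x) (f x)) μ := by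
  have hm : AEStronglyMeasurable (fun x => ContinuousLinearMap.adjoint (H x) (f x)) μ := by
    have hc : AEStronglyMeasurable (fun x => ContinuousLinearMap.adjoint (H x)) μ :=
      (ContinuousLinearMap.adjoint (𝕜 := 𝕜) (E := E) (F := E)).continuous.comp_aestronglyMeasurable
        hH.1
    exact isBoundedBilinearMap_apply.continuous.comp_aestronglyMeasurable (hc.prodMk hf.1)
  refine Integrable.mono' (hH.norm.integrable_mul hf.norm) hm
    (Filter.Eventually.of_forall fun x => ?_)
  refine (ContinuousLinearMap.le_opNorm _ _).trans ?_
  simp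

variable [NormedSpace ℝ E] [IsScalarTower ℝ 𝕜 E]

variable (μ) in
/-- The Gram operator `∫ T* T`, which represents the quadratic form `v ↦ ∫ ‖T v‖²`. -/
noncomputable def gramOperator (T : X → E →L[𝕜] E) : E →L[𝕜] E :=
  ∫ x, (ContinuousLinearMap.adjoint (T x)).comp (T x) ∂μ

theorem inner_gramOperator {T : X → E →L[𝕜] E} (hT : MemLp T 2 μ) (v w : E) :
    inner 𝕜 v (gramOperator μ T w) = ∫ x, inner 𝕜 (T x v) (T x w) ∂μ := by
  have hi := integrable_adjoint_comp_self hT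
  rw [gramOperator, ContinuousLinearMap.integral_apply hi, ← integral_inner]
  · refine integral_congr_ae (Filter.Eventually.of_forall fun x => ?_)
    simp [ContinuousLinearMap.adjoint_inner_right]
  · exact (ContinuousLinearMap.apply 𝕜 E w).integrable_comp hi

theorem re_inner_gramOperator {T : X → E →L[𝕜] E} (hT : MemLp T 2 μ) (v : E) :
    RCLike.re (inner 𝕜 v (gramOperator μ T v)) = ∫ x, ‖T x v‖ ^ 2 ∂μ := by
  rw [inner_gramOperator hT]
  simp_rw [inner_self_eq_norm_sq_to_K]
  have : ∫ x, ((‖T x v‖ : 𝕜)) ^ 2 ∂μ = ((∫ x, ‖T x v‖ ^ 2 ∂μ : ℝ) : 𝕜) := by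
    rw [← integral_ofReal]
    simp
  rw [this, RCLike.ofReal_re]

theorem gramOperator_isPositive {T : X → E →L[𝕜] E} (hT : MemLp T 2 μ) :
    (gramOperator μ T).IsPositive := by
  refine ContinuousLinearMap.isPositive_def.2 ⟨fun v w => ?_, fun v => ?_⟩
  · change inner 𝕜 (gramOperator μ T v) w = inner 𝕜 v (gramOperator μ T w)
    rw [← inner_conj_symm, inner_gramOperator hT, inner_gramOperator hT, ← integral_conj]
    simp_rw [inner_conj_symm]
  · rw [ContinuousLinearMap.reApplyInnerSelf_apply, inner_re_symm, re_inner_gramOperator hT]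
    positivity

theorem lintegral_enorm_apply_sq {T : X → E →L[𝕜] E} (hT : MemLp T 2 μ) (v : E) :
    ∫⁻ x, ‖T x v‖ₑ ^ 2 ∂μ = ENNReal.ofReal (RCLike.re (inner 𝕜 v (gramOperator μ T v))) := by
  rw [lintegral_enorm_sq_eq (hT.clm_apply_const v), re_inner_gramOperator hT]

theorem integral_norm_sub_apply_sq {H : X → E →L[𝕜] E} (hH : MemLp H 2 μ) {f : X → E}
    (hf : MemLp f 2 μ) (p : E) :
    ∫ x, ‖f x - H x p‖ ^ 2 ∂μ = ∫ x, ‖f x‖ ^ 2 ∂μ -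
      2 * RCLike.re (inner 𝕜 p (∫ x, ContinuousLinearMap.adjoint (H x) (f x) ∂μ)) +
      RCLike.re (inner 𝕜 p (gramOperator μ H p)) := by
  have hi := integrable_adjoint_apply hH hf
  have hp := hH.clm_apply_const p
  have hin : Integrable (fun x => inner 𝕜 p (ContinuousLinearMap.adjoint (H x) (f x))) μ :=
    hi.const_inner p
  have hsub : Integrable (fun x => ‖f x‖ ^ 2 -
      2 * RCLike.re (inner 𝕜 p (ContinuousLinearMap.adjoint (H x) (f x)))) μ :=
    hf.integrable_sq_norm.sub (hin.re.const_mul 2)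
  rw [re_inner_gramOperator hH, ← integral_inner hi, ← integral_re hin, ← integral_const_mul,
    ← integral_sub hf.integrable_sq_norm (hin.re.const_mul 2),
    ← integral_add hsub hp.integrable_sq_norm]
  refine integral_congr_ae (Filter.Eventually.of_forall fun x => ?_)
  simp only [ContinuousLinearMap.adjoint_inner_right]
  rw [@norm_sub_sq 𝕜, inner_re_symm]

/-- Pythagoras for the least squares problem `‖f - H p‖² + s ∑ ‖T_j p‖² → min` in `L²`, over the
vectors `p`, whose normal equation is `(H*H + s ∑ T_j* T_j) q = H* f`. -/
theorem least_squares_pythagoras {ι : Type*} (S : Finset ι) {H : X → E →L[𝕜] E}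
    (hH : MemLp H 2 μ) {T : ι → X → E →L[𝕜] E} (hT : ∀ j ∈ S, MemLp (T j) 2 μ) {f : X → E}
    (hf : MemLp f 2 μ) (s : ℕ) {q : E}
    (hq : gramOperator μ H q + (s : 𝕜) • (∑ j ∈ S, gramOperator μ (T j)) q =
      ∫ x, ContinuousLinearMap.adjoint (H x) (f x) ∂μ) (p : E) :
    (∫⁻ x, ‖f x - H x p‖ₑ ^ 2 ∂μ) + s * ∑ j ∈ S, ∫⁻ x, ‖T j x p‖ₑ ^ 2 ∂μ =
      (∫⁻ x, ‖f x - H x q‖ₑ ^ 2 ∂μ) + s * ∑ j ∈ S, (∫⁻ x, ‖T j x q‖ₑ ^ 2 ∂μ) +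
      ((∫⁻ x, ‖H x (p - q)‖ₑ ^ 2 ∂μ) + s * ∑ j ∈ S, ∫⁻ x, ‖T j x (p - q)‖ₑ ^ 2 ∂μ) := by
  have hpos := gramOperator_isPositive hH
  have hposT : ∀ j ∈ S, (gramOperator μ (T j)).IsPositive := fun j hj =>
    gramOperator_isPositive (hT j hj)
  have hform : ∀ v, (s : ℝ≥0∞) * ∑ j ∈ S, ∫⁻ x, ‖T j x v‖ₑ ^ 2 ∂μ =
      ENNReal.ofReal (s * RCLike.re (inner 𝕜 v ((∑ j ∈ S, gramOperator μ (T j)) v))) := fun v => by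
    rw [ENNReal.ofReal_mul (by positivity), ENNReal.ofReal_natCast,
      sum_apply, inner_sum, map_sum,
      ENNReal.ofReal_sum_of_nonneg fun j hj => (hposT j hj).re_inner_nonneg_right v]
    congr 1
    exact Finset.sum_congr rfl fun j hj => lintegral_enorm_apply_sq (hT j hj) v
  have hM : (∑ j ∈ S, gramOperator μ (T j)).IsPositive := by
    classical
    exact ContinuousLinearMap.isPositive_sum S hposT
  set u := gramOperator μ H with hu
  set m := ∑ j ∈ S, gramOperator μ (T j) with hm
  set G := ∫ x, ContinuousLinearMap.adjoint (H x) (f x) ∂μ with hG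
  have hres : ∀ v, MemLp (fun x => f x - H x v) 2 μ := fun v => hf.sub (hH.clm_apply_const v)
  have hsm : ∀ v, 0 ≤ (s : ℝ) * RCLike.re (inner 𝕜 v (m v)) := fun v =>
    mul_nonneg (by positivity) (hM.re_inner_nonneg_right v)
  have hint : ∀ v, 0 ≤ ∫ x, ‖f x - H x v‖ ^ 2 ∂μ := fun v => by positivity
  have huv : ∀ v, 0 ≤ RCLike.re (inner 𝕜 v (u v)) := hpos.re_inner_nonneg_right
  rw [hform, hform, hform, lintegral_enorm_sq_eq (hres p), lintegral_enorm_sq_eq (hres q),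
    lintegral_enorm_apply_sq hH, ← ENNReal.ofReal_add (hint _) (hsm _),
    ← ENNReal.ofReal_add (hint _) (hsm _), ← ENNReal.ofReal_add (huv _) (hsm _),
    ← ENNReal.ofReal_add (add_nonneg (hint _) (hsm _)) (add_nonneg (huv _) (hsm _))]
  congr 1
  rw [integral_norm_sub_apply_sq hH hf, integral_norm_sub_apply_sq hH hf, ← hu, ← hG, ← hq]
  have h1 : RCLike.re (inner 𝕜 q (u p)) = RCLike.re (inner 𝕜 p (u q)) := by
    rw [← hpos.isSymmetric.apply_clm, inner_re_symm]
  have h2 : RCLike.re (inner 𝕜 q (m p)) = RCLike.re (inner 𝕜 p (m q)) := by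
    rw [← hM.isSymmetric.apply_clm, inner_re_symm]
  have hsre : ∀ v w : E, RCLike.re (inner 𝕜 v ((s : 𝕜) • w)) = s * RCLike.re (inner 𝕜 v w) :=
    fun v w => by rw [inner_smul_right, ← RCLike.ofReal_natCast, RCLike.re_ofReal_mul]
  simp only [map_sub, inner_sub_left, inner_sub_right, inner_add_right, map_add, hsre, h1, h2]
  ring

end LeastSquares

/-! ### Carleson embedding by least squares -/

theorem sum_Ico_add_le_of_step {D ρ : ℤ → ℝ≥0∞} {n N : ℤ} (hnN : n ≤ N)
    (h : ∀ k, n ≤ k → k < N → D k + ρ (k + 1) ≤ ρ k) : ∑ k ∈ Finset.Ico n N, D k + ρ N ≤ ρ n := by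
  induction N, hnN using Int.leInduction with
  | base => simp
  | succ N hN ih =>
    rw [← Finset.insert_Ico_right_eq_Ico_add_one hN, Finset.sum_insert (by simp)]
    calc D N + ∑ k ∈ Finset.Ico n N, D k + ρ (N + 1)
        = ∑ k ∈ Finset.Ico n N, D k + (D N + ρ (N + 1)) := by ring
      _ ≤ ∑ k ∈ Finset.Ico n N, D k + ρ N := by gcongr; exact h N hN (by lia)
      _ ≤ ρ n := ih fun k hk hkN => h k hk (by lia)

section GramEquation

variable {X : Type*} [MeasurableSpace X] {μ : Measure X} {𝕜 : Type*} [RCLike 𝕜]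
  {E : Type*} [NormedAddCommGroup E] [InnerProductSpace 𝕜 E] [NormedSpace ℝ E]
  [IsScalarTower ℝ 𝕜 E] [CompleteSpace E]

theorem apply_ae_eq_zero_of_gramOperator {H : X → E →L[𝕜] E} (hH : MemLp H 2 μ) {v : E}
    (hv : gramOperator μ H v = 0) : ∀ᵐ x ∂μ, H x v = 0 := by
  have h := lintegral_enorm_apply_sq hH v
  rw [hv, inner_zero_right, map_zero, ENNReal.ofReal_zero,
    lintegral_eq_zero_iff' ((hH.clm_apply_const v).1.enorm.pow_const 2)] at h
  filter_upwards [h] with x hx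
  simpa using hx

/-- The normal equation of a least squares problem is solvable. -/
theorem exists_gramOperator_apply_eq [FiniteDimensional 𝕜 E] {H : X → E →L[𝕜] E}
    (hH : MemLp H 2 μ) {f : X → E} (hf : MemLp f 2 μ) :
    ∃ z, gramOperator μ H z = ∫ x, ContinuousLinearMap.adjoint (H x) (f x) ∂μ := by
  obtain ⟨r, r', hr, hr', hru, hc, hrr, -⟩ := (gramOperator_isPositive hH).exists_sqrt_pseudoinverse
  set G := ∫ x, ContinuousLinearMap.adjoint (H x) (f x) ∂μ with hG
  refine ⟨r' (r' G), ?_⟩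
  rw [← hru, hc (r' G), hrr]
  refine ext_inner_left 𝕜 fun v => ?_
  rw [← hr, ← hr', ← sub_eq_zero, ← inner_sub_left, hG,
    ← integral_inner (integrable_adjoint_apply hH hf)]
  have h0 := apply_ae_eq_zero_of_gramOperator hH (v := r' (r v) - v)
    (by rw [map_sub, ← hru, hrr, hru, sub_self])
  refine integral_eq_zero_of_ae ?_
  filter_upwards [h0] with x hx
  rw [ContinuousLinearMap.adjoint_inner_right, hx, inner_zero_left, Pi.zero_apply]

end GramEquation

namespace AtomicFiltration

variable {X : Type*} [mX : MeasurableSpace X] {σ : Measure X} {F : AtomicFiltration σ}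
  {𝕜 : Type*} [RCLike 𝕜]
  {E : Type*} [NormedAddCommGroup E] [InnerProductSpace 𝕜 E]

theorem restrict_le_restrict {J Q : F.Atom} (h : J ≤ Q) :
    σ.restrict J.carrier ≤ σ.restrict Q.carrier := Measure.restrict_mono_set _ h.1

/-- The constant of the matrix Carleson embedding in dimension `d`. -/
def carlesonConst (d : ℕ) : ℝ≥0 := (d + 1) ^ 2 * (2 ^ (d + 1) * (d + 2) ^ d) ^ 2

theorem enorm_sum_smul_sq_le {d : ℕ} {a : ℕ → ℝ}
    (ha : ∀ s ∈ Finset.range (d + 1), |a s| ≤ shiftConst d)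
    (v : ℕ → E) : ‖∑ s ∈ Finset.range (d + 1), (a s : 𝕜) • v s‖ₑ ^ 2 ≤
      ∑ s ∈ Finset.range (d + 1),
        ((d + 1) * (2 ^ (d + 1) * (d + 2) ^ d) ^ 2 : ℝ≥0) * ‖v s‖ₑ ^ 2 := by
  have h : ‖∑ s ∈ Finset.range (d + 1), (a s : 𝕜) • v s‖ ^ 2 ≤
      ∑ s ∈ Finset.range (d + 1), ((d + 1) * shiftConst d ^ 2) * ‖v s‖ ^ 2 := by
    calc _ ≤ (∑ s ∈ Finset.range (d + 1), ‖(a s : 𝕜) • v s‖) ^ 2 := by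
          gcongr; exact norm_sum_le _ _
      _ ≤ (Finset.range (d + 1)).card * ∑ s ∈ Finset.range (d + 1), ‖(a s : 𝕜) • v s‖ ^ 2 :=
          sq_sum_le_card_mul_sum_sq
      _ ≤ _ := by
          rw [Finset.mul_sum]
          refine Finset.sum_le_sum fun s hs => ?_
          rw [norm_smul, mul_pow, ← mul_assoc, RCLike.norm_ofReal, Finset.card_range]
          push_cast
          gcongr
          exact ha s hs
  have e : ∀ w : E, ‖w‖ₑ ^ 2 = ENNReal.ofReal (‖w‖ ^ 2) := fun w => by
    rw [← ofReal_norm, ENNReal.ofReal_pow (norm_nonneg _)]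
  have hc : (((d + 1) * (2 ^ (d + 1) * (d + 2) ^ d) ^ 2 : ℝ≥0) : ℝ≥0∞) =
      ENNReal.ofReal ((d + 1) * shiftConst d ^ 2) := by
    rw [ENNReal.ofReal, ENNReal.coe_inj]
    refine NNReal.eq ?_
    rw [Real.coe_toNNReal _ (by positivity)]
    simp [shiftConst]
  rw [e]
  refine (ENNReal.ofReal_le_ofReal h).trans ?_
  rw [ENNReal.ofReal_sum_of_nonneg fun s _ => by positivity]
  refine Finset.sum_le_sum fun s _ => ?_
  rw [hc, e, ENNReal.ofReal_mul (by positivity)]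

theorem aestronglyMeasurable_apply_level {μ : Measure X} {T : X → E →L[𝕜] E}
    (hT : AEStronglyMeasurable T μ) (k : ℤ) (y : F.Atom → E) :
    AEStronglyMeasurable (fun x => T x (y (F.atomAt k x))) μ := by
  have hs : StronglyMeasurable fun x => y (F.atomAt k x) :=
    stronglyMeasurable_of_atomAt (F := F) (k := k) fun x x' h => by rw [h]
  exact isBoundedBilinearMap_apply.continuous.comp_aestronglyMeasurable
    (hT.prodMk hs.aestronglyMeasurable)

variable [NormedSpace ℝ E] [IsScalarTower ℝ 𝕜 E] [CompleteSpace E]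

/-- Telescoping of the least squares residuals along the generations: by Pythagoras, the residual on
an atom exceeds the sum of the residuals on its children by the terms on the left. -/
theorem sum_least_squares_le {Q : F.Atom} {N : ℤ} (hN : Q.rk ≤ N) {H : X → E →L[𝕜] E}
    (hH : MemLp H 2 (σ.restrict Q.carrier)) {T : ℤ → X → E →L[𝕜] E}
    (hT : ∀ j ∈ Finset.Ico Q.rk N, MemLp (T j) 2 (σ.restrict Q.carrier)) {f : X → E}
    (hf : MemLp f 2 (σ.restrict Q.carrier)) (s : ℕ) {y : F.Atom → E}
    (hy : ∀ J ≤ Q, gramOperator (σ.restrict J.carrier) H (y J) +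
      (s : 𝕜) • (∑ j ∈ Finset.Ico J.rk N, gramOperator (σ.restrict J.carrier) (T j)) (y J) =
      ∫ x in J.carrier, ContinuousLinearMap.adjoint (H x) (f x) ∂σ) :
    ∑ k ∈ Finset.Ico Q.rk N,
      ((∫⁻ x in Q.carrier, ‖H x (y (F.atomAt k x) - y (F.atomAt (k + 1) x))‖ₑ ^ 2 ∂σ) +
        s * ∫⁻ x in Q.carrier, ‖T k x (y (F.atomAt k x))‖ₑ ^ 2 ∂σ) ≤
      ∫⁻ x in Q.carrier, ‖f x‖ₑ ^ 2 ∂σ := by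
  let ρ : ℤ → ℝ≥0∞ := fun k => ∫⁻ x in Q.carrier, (‖f x - H x (y (F.atomAt k x))‖ₑ ^ 2 +
    s * ∑ j ∈ Finset.Ico k N, ‖T j x (y (F.atomAt k x))‖ₑ ^ 2) ∂σ
  have hsub : ∀ J : F.Atom, J ≤ Q → ∀ j ∈ Finset.Ico J.rk N, j ∈ Finset.Ico Q.rk N :=
    fun J hJ j hj => by
      have := hJ.2
      simp only [Finset.mem_Ico] at hj ⊢
      lia
  have hmT : ∀ J : F.Atom, J ≤ Q → ∀ j ∈ Finset.Ico J.rk N, MemLp (T j) 2 (σ.restrict J.carrier) :=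
    fun J hJ j hj => (hT j (hsub J hJ j hj)).mono_measure (restrict_le_restrict hJ)
  have hmTv : ∀ J : F.Atom, J ≤ Q → ∀ j ∈ Finset.Ico J.rk N, ∀ v,
      AEMeasurable (fun x => ‖T j x v‖ₑ ^ 2) (σ.restrict J.carrier) :=
    fun J hJ j hj v => ((hmT J hJ j hj).clm_apply_const v).1.enorm.pow_const 2
  have hsplit : ∀ J : F.Atom, J ≤ Q → ∀ (v : E) (φ : X → ℝ≥0∞),
      ∫⁻ x in J.carrier, (φ x + s * ∑ j ∈ Finset.Ico J.rk N, ‖T j x v‖ₑ ^ 2) ∂σ =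
      (∫⁻ x in J.carrier, φ x ∂σ) +
        s * ∑ j ∈ Finset.Ico J.rk N, ∫⁻ x in J.carrier, ‖T j x v‖ₑ ^ 2 ∂σ := by
    intro J hJ v φ
    have hm : AEMeasurable (fun x => ∑ j ∈ Finset.Ico J.rk N, ‖T j x v‖ₑ ^ 2)
        (σ.restrict J.carrier) :=
      Finset.aemeasurable_fun_sum _ fun j hj => hmTv J hJ j hj v
    rw [lintegral_add_right' _ (hm.const_mul _), lintegral_const_mul'' _ hm,
      lintegral_finsetSum' _ fun j hj => hmTv J hJ j hj v]
  have hpyth := fun (J : F.Atom) (hJ : J ≤ Q) => least_squares_pythagoras (Finset.Ico J.rk N)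
    (hH.mono_measure (restrict_le_restrict hJ)) (hmT J hJ)
    (hf.mono_measure (restrict_le_restrict hJ)) s (hy J hJ)
  have hstep : ∀ k, Q.rk ≤ k → k < N →
      ((∫⁻ x in Q.carrier, ‖H x (y (F.atomAt k x) - y (F.atomAt (k + 1) x))‖ₑ ^ 2 ∂σ) +
        s * ∫⁻ x in Q.carrier, ‖T k x (y (F.atomAt k x))‖ₑ ^ 2 ∂σ) + ρ (k + 1) ≤ ρ k := by
    intro k hk hkN
    have h1 : (∫⁻ x in Q.carrier, ‖H x (y (F.atomAt k x) - y (F.atomAt (k + 1) x))‖ₑ ^ 2 ∂σ) +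
        ρ (k + 1) ≤ ∫⁻ x in Q.carrier, (‖f x - H x (y (F.atomAt k x))‖ₑ ^ 2 +
          s * ∑ j ∈ Finset.Ico (k + 1) N, ‖T j x (y (F.atomAt k x))‖ₑ ^ 2) ∂σ := by
      refine (le_lintegral_add _ _).trans (Q.setLIntegral_le_of_atoms (k := k + 1) (by lia) ?_)
      intro J hJk hJ _
      obtain ⟨x₀, hx₀⟩ := F.nonempty_of_mem _ _ J.mem_atoms
      have e1 : ∀ x ∈ J.carrier, F.atomAt (k + 1) x = J := fun x hx => by
        rw [← hJk]; exact atomAt_eq hx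
      have e2 : ∀ x ∈ J.carrier, F.atomAt k x = F.atomAt k x₀ := fun x hx =>
        atomAt_eq_atomAt hx hx₀ (by lia)
      refine (setLIntegral_congr_fun (g := fun x => ‖H x (y (F.atomAt k x₀) - y J)‖ₑ ^ 2 +
        (‖f x - H x (y J)‖ₑ ^ 2 + s * ∑ j ∈ Finset.Ico J.rk N, ‖T j x (y J)‖ₑ ^ 2))
        J.measurableSet fun x hx => by simp only [e1 x hx, e2 x hx, hJk]).trans_le
        (le_of_le_of_eq ?_
          (setLIntegral_congr_fun (f := fun x => ‖f x - H x (y (F.atomAt k x₀))‖ₑ ^ 2 +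
            s * ∑ j ∈ Finset.Ico J.rk N, ‖T j x (y (F.atomAt k x₀))‖ₑ ^ 2)
            J.measurableSet fun x hx => by simp only [e2 x hx, hJk]))
      have hHv := (hH.mono_measure (restrict_le_restrict hJ)).clm_apply_const
        (y (F.atomAt k x₀) - y J)
      rw [lintegral_add_left' (hHv.1.enorm.pow_const 2), hsplit J hJ, hsplit J hJ,
        hpyth J hJ (y (F.atomAt k x₀)),
        add_comm]
      exact add_le_add (le_refl _) le_self_add
    calc _ = s * (∫⁻ x in Q.carrier, ‖T k x (y (F.atomAt k x))‖ₑ ^ 2 ∂σ) +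
          ((∫⁻ x in Q.carrier, ‖H x (y (F.atomAt k x) - y (F.atomAt (k + 1) x))‖ₑ ^ 2 ∂σ) +
            ρ (k + 1)) := by ring
      _ ≤ _ := add_le_add (le_refl _) h1
      _ ≤ ∫⁻ x in Q.carrier, (s * ‖T k x (y (F.atomAt k x))‖ₑ ^ 2 +
          (‖f x - H x (y (F.atomAt k x))‖ₑ ^ 2 +
          s * ∑ j ∈ Finset.Ico (k + 1) N, ‖T j x (y (F.atomAt k x))‖ₑ ^ 2)) ∂σ := by
        rw [← lintegral_const_mul' _ _ (ENNReal.natCast_ne_top s)]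
        exact le_lintegral_add _ _
      _ = ρ k := by
        refine lintegral_congr fun x => ?_
        rw [← Finset.insert_Ico_add_one_left_eq_Ico hkN, Finset.sum_insert (by simp)]
        ring
  refine (le_self_add.trans (sum_Ico_add_le_of_step hN hstep)).trans ?_
  have hQ := hpyth Q Q.le_refl 0
  have e1 : ρ Q.rk = ∫⁻ x in Q.carrier, (‖f x - H x (y Q)‖ₑ ^ 2 +
      s * ∑ j ∈ Finset.Ico Q.rk N, ‖T j x (y Q)‖ₑ ^ 2) ∂σ :=
    setLIntegral_congr_fun Q.measurableSet fun x hx => by simp only [atomAt_eq hx]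
  rw [e1, hsplit Q Q.le_refl]
  simp only [map_zero, sub_zero, enorm_zero, ne_eq, OfNat.ofNat_ne_zero, not_false_eq_true,
    zero_pow, lintegral_const, zero_mul, Finset.sum_const_zero, mul_zero, add_zero] at hQ
  rw [hQ]
  exact le_self_add

/-- The matrix Carleson embedding theorem on an atom `Q`, over the generations below `N`. The
vectors `z J` are the weighted averages of `f`, that is, the least squares coefficients of `f` with
respect to the columns of `H` on `J`; the squares of their martingale differences are summable, and
if the forms of the `T j` satisfy the Carleson packing condition with respect to the form of `H`,
then the `T j` applied to these averages are square summable. -/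
theorem exists_weighted_average [FiniteDimensional 𝕜 E] {Q : F.Atom} {N : ℤ} (hN : Q.rk ≤ N)
    {H : X → E →L[𝕜] E}
    (hH : MemLp H 2 (σ.restrict Q.carrier)) {T : ℤ → X → E →L[𝕜] E}
    (hT : ∀ j ∈ Finset.Ico Q.rk N, MemLp (T j) 2 (σ.restrict Q.carrier))
    (hTH : ∀ J ≤ Q, ∀ v, ∑ j ∈ Finset.Ico J.rk N, ∫⁻ x in J.carrier, ‖T j x v‖ₑ ^ 2 ∂σ ≤
      ∫⁻ x in J.carrier, ‖H x v‖ₑ ^ 2 ∂σ) {f : X → E}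
    (hf : MemLp f 2 (σ.restrict Q.carrier)) :
    ∃ z : F.Atom → E, (∀ J ≤ Q, gramOperator (σ.restrict J.carrier) H (z J) =
        ∫ x in J.carrier, ContinuousLinearMap.adjoint (H x) (f x) ∂σ) ∧
      ∑ k ∈ Finset.Ico Q.rk N,
        (∫⁻ x in Q.carrier, ‖H x (z (F.atomAt k x) - z (F.atomAt (k + 1) x))‖ₑ ^ 2 ∂σ) ≤
        ∫⁻ x in Q.carrier, ‖f x‖ₑ ^ 2 ∂σ ∧
      ∑ k ∈ Finset.Ico Q.rk N, (∫⁻ x in Q.carrier, ‖T k x (z (F.atomAt k x))‖ₑ ^ 2 ∂σ) ≤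
        carlesonConst (Module.finrank 𝕜 E) * ∫⁻ x in Q.carrier, ‖f x‖ₑ ^ 2 ∂σ := by
  set d := Module.finrank 𝕜 E with hd
  have hsol : ∀ J : F.Atom, ∃ (y : ℕ → E) (a : ℕ → ℝ), J ≤ Q →
      (∀ s : ℕ, gramOperator (σ.restrict J.carrier) H (y s) +
      (s : 𝕜) • (∑ j ∈ Finset.Ico J.rk N, gramOperator (σ.restrict J.carrier) (T j)) (y s) =
      ∫ x in J.carrier, ContinuousLinearMap.adjoint (H x) (f x) ∂σ) ∧
      (∀ s ∈ Finset.range (d + 1), |a s| ≤ shiftConst d) ∧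
      y 0 = ∑ s ∈ Finset.range (d + 1), (a s : 𝕜) • y (s + 1) := by
    intro J
    by_cases hJ : J ≤ Q
    swap
    · exact ⟨0, 0, fun h => absurd h hJ⟩
    have hHJ := hH.mono_measure (restrict_le_restrict hJ)
    have hTJ : ∀ j ∈ Finset.Ico J.rk N, MemLp (T j) 2 (σ.restrict J.carrier) := fun j hj => by
      refine (hT j ?_).mono_measure (restrict_le_restrict hJ)
      have := hJ.2
      simp only [Finset.mem_Ico] at hj ⊢
      lia
    obtain ⟨z, hz⟩ := exists_gramOperator_apply_eq hHJ
      (hf.mono_measure (restrict_le_restrict hJ))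
    rw [← hz]
    have hle : ∀ v, RCLike.re (inner 𝕜 v
        ((∑ j ∈ Finset.Ico J.rk N, gramOperator (σ.restrict J.carrier) (T j)) v)) ≤
        RCLike.re (inner 𝕜 v (gramOperator (σ.restrict J.carrier) H v)) := fun v => by
      have h := hTH J hJ v
      rw [lintegral_enorm_apply_sq hHJ, Finset.sum_congr rfl fun j hj =>
        lintegral_enorm_apply_sq (hTJ j hj) v, ← ENNReal.ofReal_sum_of_nonneg fun j hj =>
        (gramOperator_isPositive (hTJ j hj)).re_inner_nonneg_right v, ENNReal.ofReal_le_ofReal_iff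
        ((gramOperator_isPositive hHJ).re_inner_nonneg_right v)] at h
      simpa [sum_apply, inner_sum] using h
    obtain ⟨y, a, h1, h2, h3⟩ := exists_shifted_solutions hd.symm (gramOperator_isPositive hHJ)
      (ContinuousLinearMap.isPositive_sum (Finset.Ico J.rk N) fun j hj =>
        gramOperator_isPositive (hTJ j hj)) hle z
    exact ⟨y, a, fun _ => ⟨h1, h2, h3⟩⟩
  choose y a hya using hsol
  have hs := fun s => sum_least_squares_le hN hH hT hf s (y := fun J => y J s)
    fun J hJ => (hya J hJ).1 s
  refine ⟨fun J => y J 0, fun J hJ => ?_, ?_, ?_⟩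
  · simpa using (hya J hJ).1 0
  · simpa using hs 0
  · have hle : ∀ s ∈ Finset.range (d + 1), ∑ k ∈ Finset.Ico Q.rk N,
        ∫⁻ x in Q.carrier, ‖T k x (y (F.atomAt k x) (s + 1))‖ₑ ^ 2 ∂σ ≤
        ∫⁻ x in Q.carrier, ‖f x‖ₑ ^ 2 ∂σ := fun s _ => by
      refine (Finset.sum_le_sum fun k _ => ?_).trans (hs (s + 1))
      refine le_trans ?_ le_add_self
      refine le_mul_of_one_le_left' ?_
      push_cast
      exact le_add_self
    have hpt : ∀ k ∈ Finset.Ico Q.rk N,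
        ∫⁻ x in Q.carrier, ‖T k x (y (F.atomAt k x) 0)‖ₑ ^ 2 ∂σ ≤
        ∑ s ∈ Finset.range (d + 1), ((d + 1) * (2 ^ (d + 1) * (d + 2) ^ d) ^ 2 : ℝ≥0) *
          ∫⁻ x in Q.carrier, ‖T k x (y (F.atomAt k x) (s + 1))‖ₑ ^ 2 ∂σ := by
      intro k hk
      have hm : ∀ s, AEMeasurable (fun x => ‖T k x (y (F.atomAt k x) (s + 1))‖ₑ ^ 2)
          (σ.restrict Q.carrier) := fun s =>
        (aestronglyMeasurable_apply_level (hT k hk).1 k fun J => y J (s + 1)).enorm.pow_const 2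
      simp_rw [← lintegral_const_mul'' _ (hm _)]
      rw [← lintegral_finsetSum' _ fun s _ => (hm s).const_mul _]
      refine setLIntegral_mono' Q.measurableSet fun x hx => ?_
      have hJ := hya (F.atomAt k x) (atomAt_le hx (by simpa using (Finset.mem_Ico.1 hk).1))
      rw [hJ.2.2, map_sum]
      simp_rw [map_smul]
      exact enorm_sum_smul_sq_le hJ.2.1 _
    calc _ ≤ _ := Finset.sum_le_sum hpt
      _ = ∑ s ∈ Finset.range (d + 1), ((d + 1) * (2 ^ (d + 1) * (d + 2) ^ d) ^ 2 : ℝ≥0) *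
          ∑ k ∈ Finset.Ico Q.rk N,
          ∫⁻ x in Q.carrier, ‖T k x (y (F.atomAt k x) (s + 1))‖ₑ ^ 2 ∂σ := by
        rw [Finset.sum_comm]
        simp_rw [Finset.mul_sum]
      _ ≤ ∑ s ∈ Finset.range (d + 1), ((d + 1) * (2 ^ (d + 1) * (d + 2) ^ d) ^ 2 : ℝ≥0) *
          ∫⁻ x in Q.carrier, ‖f x‖ₑ ^ 2 ∂σ :=
        Finset.sum_le_sum fun s hs => by gcongr; exact hle s hs
      _ = _ := by
        rw [Finset.sum_const, Finset.card_range, carlesonConst]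
        simp only [nsmul_eq_mul]
        push_cast
        ring

end AtomicFiltration

/-! ### Averages over the atoms of one generation -/

theorem le_sum_Ico_add_of_step {D ρ : ℤ → ℝ≥0∞} {n N : ℤ} (hnN : n ≤ N)
    (h : ∀ k, n ≤ k → k < N → ρ k ≤ D k + ρ (k + 1)) : ρ n ≤ ∑ k ∈ Finset.Ico n N, D k + ρ N := by
  induction N, hnN using Int.leInduction with
  | base => simp
  | succ N hN ih =>
    rw [← Finset.insert_Ico_right_eq_Ico_add_one hN, Finset.sum_insert (by simp)]
    calc ρ n ≤ ∑ k ∈ Finset.Ico n N, D k + ρ N := ih fun k hk hkN => h k hk (by lia)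
      _ ≤ ∑ k ∈ Finset.Ico n N, D k + (D N + ρ (N + 1)) := by gcongr; exact h N hN (by lia)
      _ = D N + ∑ k ∈ Finset.Ico n N, D k + ρ (N + 1) := by ring

theorem sum_lintegral_le_lintegral_sum {X ι : Type*} [MeasurableSpace X] {μ : Measure X}
    (S : Finset ι) (φ : ι → X → ℝ≥0∞) :
    ∑ i ∈ S, ∫⁻ x, φ i x ∂μ ≤ ∫⁻ x, ∑ i ∈ S, φ i x ∂μ := by
  classical
  induction S using Finset.induction_on with
  | empty => simp
  | insert i S hi ih =>
    simp_rw [Finset.sum_insert hi]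
    exact (add_le_add (le_refl _) ih).trans (le_lintegral_add _ _)

namespace AtomicFiltration

variable {X : Type*} [mX : MeasurableSpace X] {σ : Measure X} {F : AtomicFiltration σ}

theorem measurableSet_algebras_of_atomAt {k : ℤ} {s : Set X}
    (hs : ∀ x y, F.atomAt k x = F.atomAt k y → x ∈ s → y ∈ s) : MeasurableSet[F.algebras k] s := by
  have h := preimage_atoms_eq (F := F) (k := k) (φ := fun x => x ∈ s)
    (fun x y h => propext ⟨hs x y h, hs y x h.symm⟩) {True}
  have e : (fun x => x ∈ s) ⁻¹' {True} = s := by ext x; simp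
  rw [e] at h
  rw [h]
  exact MeasurableSet.biUnion ((F.countable_atoms k).mono fun A hA => hA.1) fun A hA =>
    F.measurableSet_of_mem k A hA.1

theorem atomAt_eq_of_le {k l : ℤ} (hl : l ≤ k) {x y : X} (h : F.atomAt k x = F.atomAt k y) :
    F.atomAt l x = F.atomAt l y :=
  atomAt_eq_atomAt (mem_atomAt k x) (h ▸ mem_atomAt k y) (by simpa using hl)

section NormedSpace

variable {E : Type*} [NormedAddCommGroup E] [NormedSpace ℝ E]

theorem levelAvg_eq_of_le {k l : ℤ} (hl : l ≤ k) (a : X → E) {x y : X}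
    (h : F.atomAt k x = F.atomAt k y) : F.levelAvg l a x = F.levelAvg l a y := by
  rw [levelAvg, atomAt_eq_of_le hl h, levelAvg]

theorem stronglyMeasurable_levelAvg (k : ℤ) (a : X → E) : StronglyMeasurable (F.levelAvg k a) :=
  stronglyMeasurable_of_atomAt (F := F) (k := k) fun _ _ h =>
    levelAvg_eq_of_le (_root_.le_refl _) a h

theorem enorm_avg_mul_le (J : F.Atom) (a : X → E) :
    ‖avg J a‖ₑ * σ J.carrier ≤ ∫⁻ x in J.carrier, ‖a x‖ₑ ∂σ := by
  have h : ‖avg J a‖ₑ * σ J.carrier = ‖∫ x in J.carrier, a x ∂σ‖ₑ := by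
    rw [← measure_real_smul_avg, enorm_smul, mul_comm, Real.enorm_of_nonneg (by positivity),
      ofReal_measureReal J.measure_ne_top]
  rw [h]
  exact enorm_integral_le_lintegral_enorm _

theorem setIntegral_levelAvg [CompleteSpace E] {g : Set X} {k : ℤ}
    (hg : MeasurableSet[F.algebras k] g) {a : X → E}
    (ha : IntegrableOn a g σ) (hA : IntegrableOn (F.levelAvg k a) g σ) :
    ∫ x in g, F.levelAvg k a x ∂σ = ∫ x in g, a x ∂σ := by
  have hU : g = ⋃ B : {B ∈ F.atoms k | B ⊆ g}, (B : Set X) := by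
    ext x
    simp only [Set.mem_iUnion]
    refine ⟨fun hx => ?_, fun ⟨B, hx⟩ => B.2.2 hx⟩
    obtain ⟨I, rfl, hxI, hIA⟩ := exists_atom_subset hg hx
    exact ⟨⟨I.carrier, I.mem_atoms, hIA⟩, hxI⟩
  have hcount : Countable {B ∈ F.atoms k | B ⊆ g} :=
    ((F.countable_atoms k).mono fun B hB => hB.1)
  have hm : ∀ B : {B ∈ F.atoms k | B ⊆ g}, MeasurableSet (B : Set X) := fun B =>
    F.algebras.le _ _ (F.measurableSet_of_mem k B B.2.1)
  have hd : Pairwise (Function.onFun Disjoint fun B : {B ∈ F.atoms k | B ⊆ g} => (B : Set X)) :=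
    fun B B' hne => F.disjoint_atoms k B.2.1 B'.2.1 fun h => hne (Subtype.ext h)
  rw [hU] at ha hA ⊢
  rw [integral_iUnion hm hd hA, integral_iUnion hm hd ha]
  refine tsum_congr fun B => ?_
  let J : F.Atom := ⟨k, B, B.2.1⟩
  rw [setIntegral_congr_fun (g := fun _ => avg J a) (hm B) fun x hx =>
    levelAvg_of_mem (J := J) a hx, setIntegral_const]
  exact measure_real_smul_avg J a

end NormedSpace

/-- The orthogonality of the martingale differences, one generation ahead, when the children with
averages larger than `K` are discarded. -/
theorem lintegral_levelAvg_sub_sq_le (𝕜 : Type*) [RCLike 𝕜]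
    {E : Type*} [NormedAddCommGroup E] [InnerProductSpace 𝕜 E] [NormedSpace ℝ E]
    [IsScalarTower ℝ 𝕜 E] [CompleteSpace E] (I : F.Atom) {a : X → E}
    (ha : IntegrableOn a I.carrier σ)
    {K : ℝ≥0} (hK : ‖avg I a‖ₑ ≤ K) {g : Set X} (hgI : g ⊆ I.carrier)
    (hg : MeasurableSet[F.algebras (I.rk + 1)] g)
    (hgK : ∀ x ∈ g, ‖F.levelAvg (I.rk + 1) a x‖ₑ ≤ K) :
    (∫⁻ x in g, ‖F.levelAvg (I.rk + 1) a x - avg I a‖ₑ ^ 2 ∂σ) + ‖avg I a‖ₑ ^ 2 * σ I.carrier ≤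
      (∫⁻ x in g, ‖F.levelAvg (I.rk + 1) a x‖ₑ ^ 2 ∂σ) +
        2 * K * ∫⁻ x in I.carrier \ g, ‖a x‖ₑ ∂σ := by
  set A := avg I a with hA
  set A' := F.levelAvg (I.rk + 1) a with hA'
  have hgm : MeasurableSet g := F.algebras.le _ _ hg
  have hgfin : IsFiniteMeasure (σ.restrict g) :=
    ⟨by simpa using (measure_mono hgI).trans_lt I.measure_ne_top.lt_top⟩
  have hK' : ‖A‖ ≤ K := by simpa [enorm_le_coe, ← NNReal.coe_le_coe] using hK
  have hgK' : ∀ x ∈ g, ‖A' x‖ ≤ K := fun x hx => by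
    simpa [enorm_le_coe, ← NNReal.coe_le_coe] using hgK x hx
  have hML : MemLp A' 2 (σ.restrict g) :=
    MemLp.of_bound (stronglyMeasurable_levelAvg _ a).aestronglyMeasurable K
      ((ae_restrict_iff' hgm).2 (Filter.Eventually.of_forall hgK'))
  have hAi : IntegrableOn A' g σ := hML.integrable one_le_two
  have hb : ENNReal.ofReal (∫ x in I.carrier \ g, ‖a x‖ ∂σ) = ∫⁻ x in I.carrier \ g, ‖a x‖ₑ ∂σ :=
    ofReal_integral_norm_eq_lintegral_enorm (ha.mono_set Set.sdiff_subset)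
  have hb0 : 0 ≤ ∫ x in I.carrier \ g, ‖a x‖ ∂σ := by positivity
  have hAσ : ‖A‖ₑ ^ 2 * σ I.carrier = ENNReal.ofReal (‖A‖ ^ 2 * σ.real I.carrier) := by
    rw [ENNReal.ofReal_mul (by positivity), ofReal_measureReal I.measure_ne_top,
      ENNReal.ofReal_pow (norm_nonneg _), ofReal_norm]
  have hMc : MemLp (fun x => A' x - A) 2 (σ.restrict g) := hML.sub (memLp_const A)
  rw [lintegral_enorm_sq_eq hMc, lintegral_enorm_sq_eq hML, ← hb, hAσ,
    ← ENNReal.ofReal_add (by positivity) (by positivity)]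
  have hKK : (2 * K : ℝ≥0∞) = ENNReal.ofReal (2 * K) := by
    rw [ENNReal.ofReal_mul (by positivity)]; simp
  rw [hKK, ← ENNReal.ofReal_mul (by positivity),
    ← ENNReal.ofReal_add (by positivity) (by positivity)]
  refine ENNReal.ofReal_le_ofReal ?_
  have h1 : ∫ x in g, A' x ∂σ = σ.real I.carrier • A - ∫ x in I.carrier \ g, a x ∂σ := by
    rw [setIntegral_levelAvg hg (ha.mono_set hgI) hAi, measure_real_smul_avg,
      setIntegral_sdiff hgm ha hgI]
    abel
  have h2 : ∫ x in g, ‖A' x - A‖ ^ 2 ∂σ = ∫ x in g, ‖A' x‖ ^ 2 ∂σ -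
      2 * RCLike.re (inner 𝕜 A (∫ x in g, A' x ∂σ)) + σ.real g * ‖A‖ ^ 2 := by
    have hin : Integrable (fun x => inner 𝕜 A (A' x)) (σ.restrict g) := hAi.const_inner A
    have hsub : Integrable (fun x => ‖A' x‖ ^ 2 - 2 * RCLike.re (inner 𝕜 A (A' x)))
      (σ.restrict g) := hML.integrable_sq_norm.sub (hin.re.const_mul 2)
    have hc : ∫ x in g, ‖A‖ ^ 2 ∂σ = σ.real g * ‖A‖ ^ 2 := by rw [setIntegral_const, smul_eq_mul]
    rw [← hc, ← integral_inner hAi, ← integral_re hin, ← integral_const_mul,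
      ← integral_sub hML.integrable_sq_norm (hin.re.const_mul 2),
      ← integral_add hsub (integrable_const _)]
    refine integral_congr_ae (Filter.Eventually.of_forall fun x => ?_)
    simp only
    rw [@norm_sub_sq 𝕜, inner_re_symm]
  have h3 : RCLike.re (inner 𝕜 A (σ.real I.carrier • A)) = σ.real I.carrier * ‖A‖ ^ 2 := by
    rw [← algebraMap_smul 𝕜 (σ.real I.carrier) A, inner_smul_right]
    simp [RCLike.algebraMap_eq_ofReal]
  have h4 : RCLike.re (inner 𝕜 A (∫ x in I.carrier \ g, a x ∂σ)) ≤
      K * ∫ x in I.carrier \ g, ‖a x‖ ∂σ :=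
    (re_inner_le_norm _ _).trans
      (mul_le_mul hK' (norm_integral_le_integral_norm _) (norm_nonneg _) K.2)
  have h5 : σ.real g ≤ σ.real I.carrier := measureReal_mono hgI I.measure_ne_top
  rw [h2, h1, inner_sub_right, map_sub, h3]
  nlinarith [sq_nonneg ‖A‖]

end AtomicFiltration

/-! ### A weak type estimate for the truncated square function -/

namespace AtomicFiltration

variable {X : Type*} [mX : MeasurableSpace X] {σ : Measure X} {F : AtomicFiltration σ}

section Stopping

variable {E : Type*} [NormedAddCommGroup E] [NormedSpace ℝ E]

/-- The points of `Q` at which the averages of `a` of the generations up to `k` are at most `K`. -/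
def boundedSet (Q : F.Atom) (a : X → E) (K : ℝ≥0) (k : ℤ) : Set X :=
  {x ∈ Q.carrier | ∀ j ∈ Finset.Icc Q.rk k, ‖F.levelAvg j a x‖ₑ ≤ K}

/-- The points of `Q` at which, up to generation `k`, the averages of `a` are at most `4 c` and the
sum of the squares of the martingale differences of `a`, started at `Q`, is at most `32 c²`. When
`‖a‖` has average at most `c` over `Q`, each of the two conditions fails on at most a quarter
of `Q`. -/
def goodSet (Q : F.Atom) (a : X → E) (c : ℝ≥0) (k : ℤ) : Set X :=
  {x ∈ boundedSet Q a (4 * c) k |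
    ∑ i ∈ Finset.Ico Q.rk k, ‖F.levelAvg (i + 1) a x - F.levelAvg i a x‖ₑ ^ 2 ≤ 32 * (c : ℝ≥0∞) ^ 2}

variable {Q : F.Atom} {a : X → E} {K c : ℝ≥0} {k : ℤ}

theorem boundedSet_subset : boundedSet Q a K k ⊆ Q.carrier := fun _ hx => hx.1

theorem goodSet_subset_boundedSet : goodSet Q a c k ⊆ boundedSet Q a (4 * c) k := fun _ hx => hx.1

theorem goodSet_subset : goodSet Q a c k ⊆ Q.carrier :=
  goodSet_subset_boundedSet.trans boundedSet_subset

theorem boundedSet_anti : Antitone (boundedSet Q a K) := fun _ _ hkl _ hx =>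
  ⟨hx.1, fun j hj => hx.2 j (Finset.Icc_subset_Icc_right hkl hj)⟩

theorem goodSet_anti : Antitone (goodSet Q a c) := fun _ _ hkl _ hx =>
  ⟨boundedSet_anti hkl hx.1,
    (Finset.sum_le_sum_of_subset (Finset.Ico_subset_Ico_right hkl)).trans hx.2⟩

theorem measurableSet_boundedSet (hk : Q.rk ≤ k) :
    MeasurableSet[F.algebras k] (boundedSet Q a K k) := by
  refine measurableSet_algebras_of_atomAt fun x y h hx => ⟨?_, fun j hj => ?_⟩
  · have := atomAt_eq_of_le hk h
    rw [atomAt_eq hx.1] at this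
    exact this ▸ mem_atomAt _ _
  · rw [← levelAvg_eq_of_le (Finset.mem_Icc.1 hj).2 a h]
    exact hx.2 j hj

theorem measurableSet_goodSet (hk : Q.rk ≤ k) :
    MeasurableSet[F.algebras k] (goodSet Q a c k) := by
  refine MeasurableSet.inter (measurableSet_boundedSet hk)
    (measurableSet_algebras_of_atomAt (F := F) (s := {x | ∑ i ∈ Finset.Ico Q.rk k,
      ‖F.levelAvg (i + 1) a x - F.levelAvg i a x‖ₑ ^ 2 ≤ 32 * (c : ℝ≥0∞) ^ 2})
      fun x y h hx => ?_)
  rw [Set.mem_ofPred_eq] at hx ⊢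
  refine le_of_eq_of_le (Finset.sum_congr rfl fun i hi => ?_) hx
  have hi' := Finset.mem_Ico.1 hi
  rw [levelAvg_eq_of_le (by lia : i + 1 ≤ k) a h, levelAvg_eq_of_le hi'.2.le a h]

theorem boundedSet_rk (hQ : ‖avg Q a‖ₑ ≤ K) : boundedSet Q a K Q.rk = Q.carrier := by
  refine boundedSet_subset.antisymm fun x hx => ⟨hx, fun j hj => ?_⟩
  obtain rfl : j = Q.rk := by simpa using hj
  rwa [levelAvg_of_mem a hx]

theorem goodSet_rk (hQ : ‖avg Q a‖ₑ ≤ (4 * c : ℝ≥0)) : goodSet Q a c Q.rk = Q.carrier := by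
  refine goodSet_subset.antisymm fun x hx => ⟨(boundedSet_rk hQ).ge hx, by simp⟩

/-- The average of `a` over the atom of generation `k + 1` at which a point leaves
`boundedSet Q a K` is larger than `K`. -/
theorem lt_enorm_avg_of_notMem {x : X} (hx : x ∈ boundedSet Q a K k)
    (hx' : x ∉ boundedSet Q a K (k + 1)) : K < ‖F.levelAvg (k + 1) a x‖ₑ := by
  by_contra! h
  refine hx' ⟨hx.1, fun j hj => ?_⟩
  obtain hj' | rfl := (Finset.mem_Icc.1 hj).2.lt_or_eq
  · exact hx.2 j (Finset.mem_Icc.2 ⟨(Finset.mem_Icc.1 hj).1, by lia⟩)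
  · exact h

theorem measurableSet_ambient {s : Set X} (hs : MeasurableSet[F.algebras k] s) : MeasurableSet s :=
  F.algebras.le _ _ hs

theorem measurableSet_boundedSet_diff (hk : Q.rk ≤ k) :
    MeasurableSet[F.algebras (k + 1)] (boundedSet Q a K k \ boundedSet Q a K (k + 1)) :=
  MeasurableSet.diff (F.algebras.mono (by lia) _ (measurableSet_boundedSet hk))
    (measurableSet_boundedSet (by lia))

theorem mul_measure_boundedSet_diff_le (hk : Q.rk ≤ k) :
    K * σ (boundedSet Q a K k \ boundedSet Q a K (k + 1)) ≤
      ∫⁻ x in boundedSet Q a K k \ boundedSet Q a K (k + 1), ‖a x‖ₑ ∂σ := by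
  rw [← setLIntegral_const]
  refine setLIntegral_le_of_atoms (measurableSet_boundedSet_diff hk) fun J hJ hJs _ => ?_
  obtain ⟨x, hx⟩ := F.nonempty_of_mem _ _ J.mem_atoms
  have h := lt_enorm_avg_of_notMem (hJs hx).1 (hJs hx).2
  rw [← hJ, levelAvg_of_mem a hx] at h
  rw [setLIntegral_const]
  exact (mul_le_mul_left h.le _).trans (enorm_avg_mul_le J a)

/-- The weak type bound for the maximal function. -/
theorem mul_measure_diff_boundedSet_le {N : ℤ} (hN : Q.rk ≤ N) (hQ : ‖avg Q a‖ₑ ≤ K) :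
    K * σ (Q.carrier \ boundedSet Q a K N) ≤
      ∫⁻ x in Q.carrier \ boundedSet Q a K N, ‖a x‖ₑ ∂σ := by
  induction N, hN using Int.leInduction with
  | base => simp [boundedSet_rk hQ]
  | succ N hN ih =>
    have hU : Q.carrier \ boundedSet Q a K (N + 1) = (Q.carrier \ boundedSet Q a K N) ∪
        (boundedSet Q a K N \ boundedSet Q a K (N + 1)) := by
      have h1 := boundedSet_anti (Q := Q) (a := a) (K := K) (by lia : N ≤ N + 1)
      have h2 := boundedSet_subset (Q := Q) (a := a) (K := K) (k := N)
      ext x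
      have h1 := @h1 x
      have h2 := @h2 x
      simp only [Set.mem_sdiff, Set.mem_union]
      tauto
    have hd : Disjoint (Q.carrier \ boundedSet Q a K N)
        (boundedSet Q a K N \ boundedSet Q a K (N + 1)) :=
      Set.disjoint_left.2 fun x hx hx' => hx.2 hx'.1
    have hm := measurableSet_ambient (measurableSet_boundedSet_diff (a := a) (K := K) hN)
    rw [hU, lintegral_union hm hd, measure_union hd hm, mul_add]
    exact add_le_add ih (mul_measure_boundedSet_diff_le hN)

theorem lintegral_boundedSet_levelAvg_sq_le (hk : Q.rk ≤ k) :
    ∫⁻ x in boundedSet Q a K k, ‖F.levelAvg k a x‖ₑ ^ 2 ∂σ ≤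
      K * ∫⁻ x in boundedSet Q a K k, ‖a x‖ₑ ∂σ := by
  rw [← lintegral_const_mul' _ _ ENNReal.coe_ne_top]
  refine setLIntegral_le_of_atoms (measurableSet_boundedSet hk) fun J hJ hJs _ => ?_
  obtain ⟨y, hy⟩ := F.nonempty_of_mem _ _ J.mem_atoms
  have h := (hJs hy).2 k (Finset.mem_Icc.2 ⟨hk, _root_.le_refl _⟩)
  rw [setLIntegral_congr_fun (g := fun _ => ‖avg J a‖ₑ ^ 2) J.measurableSet fun x hx => by
    simp only [← hJ, levelAvg_of_mem a hx], setLIntegral_const,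
    lintegral_const_mul' _ _ ENNReal.coe_ne_top]
  rw [← hJ, levelAvg_of_mem a hy] at h
  rw [sq, mul_assoc]
  exact mul_le_mul' h (enorm_avg_mul_le J a)

end Stopping

theorem lintegral_boundedSet_sub_sq_le (𝕜 : Type*) [RCLike 𝕜] {E : Type*} [NormedAddCommGroup E]
    [InnerProductSpace 𝕜 E] [NormedSpace ℝ E] [IsScalarTower ℝ 𝕜 E] [CompleteSpace E] {Q : F.Atom}
    {a : X → E} {K : ℝ≥0} {k : ℤ} (hk : Q.rk ≤ k) (ha : IntegrableOn a Q.carrier σ) :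
    (∫⁻ x in boundedSet Q a K (k + 1), ‖F.levelAvg (k + 1) a x - F.levelAvg k a x‖ₑ ^ 2 ∂σ) +
        ∫⁻ x in boundedSet Q a K k, ‖F.levelAvg k a x‖ₑ ^ 2 ∂σ ≤
      (∫⁻ x in boundedSet Q a K (k + 1), ‖F.levelAvg (k + 1) a x‖ₑ ^ 2 ∂σ) +
        2 * K * ∫⁻ x in boundedSet Q a K k \ boundedSet Q a K (k + 1), ‖a x‖ₑ ∂σ := by
  set s := boundedSet Q a K (k + 1) with hs
  set B := boundedSet Q a K k with hB
  have hsB : s ⊆ B := boundedSet_anti (by lia)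
  have hsm : MeasurableSet s := measurableSet_ambient (measurableSet_boundedSet (by lia))
  have hm1 : Measurable fun x => ‖F.levelAvg (k + 1) a x‖ₑ ^ 2 :=
    (stronglyMeasurable_levelAvg _ a).enorm.pow_const 2
  have hm2 : Measurable fun x => ‖F.levelAvg (k + 1) a x - F.levelAvg k a x‖ₑ ^ 2 :=
    ((stronglyMeasurable_levelAvg _ a).sub (stronglyMeasurable_levelAvg _ a)).enorm.pow_const 2
  have hKtop : (2 * K : ℝ≥0∞) ≠ ∞ := ENNReal.mul_ne_top (by simp) ENNReal.coe_ne_top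
  have hL : ∀ A : Set X, ∫⁻ x in A, (s.indicator (fun x => ‖F.levelAvg (k + 1) a x -
      F.levelAvg k a x‖ₑ ^ 2) x + ‖F.levelAvg k a x‖ₑ ^ 2) ∂σ =
      (∫⁻ x in s ∩ A, ‖F.levelAvg (k + 1) a x - F.levelAvg k a x‖ₑ ^ 2 ∂σ) +
        ∫⁻ x in A, ‖F.levelAvg k a x‖ₑ ^ 2 ∂σ := fun A => by
    rw [lintegral_add_left (hm2.indicator hsm), setLIntegral_indicator hsm]
  have hR : ∀ A : Set X, ∫⁻ x in A, (s.indicator (fun x => ‖F.levelAvg (k + 1) a x‖ₑ ^ 2) x +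
      2 * K * sᶜ.indicator (fun x => ‖a x‖ₑ) x) ∂σ =
      (∫⁻ x in s ∩ A, ‖F.levelAvg (k + 1) a x‖ₑ ^ 2 ∂σ) +
        2 * K * ∫⁻ x in A \ s, ‖a x‖ₑ ∂σ := fun A => by
    rw [lintegral_add_left (hm1.indicator hsm), setLIntegral_indicator hsm,
      lintegral_const_mul' _ _ hKtop, setLIntegral_indicator hsm.compl, Set.sdiff_eq,
      Set.inter_comm sᶜ]
  have hLB := hL B
  have hRB := hR B
  rw [Set.inter_eq_left.2 hsB] at hLB hRB
  rw [← hLB, ← hRB]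
  refine setLIntegral_le_of_atoms (measurableSet_boundedSet hk) fun J hJ hJB _ => ?_
  rw [hL, hR]
  subst hJ
  obtain ⟨y, hy⟩ := F.nonempty_of_mem _ _ J.mem_atoms
  have hyK := (hJB hy).2 J.rk (Finset.mem_Icc.2 ⟨hk, _root_.le_refl _⟩)
  rw [levelAvg_of_mem a hy] at hyK
  have h := lintegral_levelAvg_sub_sq_le 𝕜 J
    (ha.mono_set (hJB.trans boundedSet_subset)) hyK (g := s ∩ J.carrier) Set.inter_subset_right
    (MeasurableSet.inter (measurableSet_boundedSet (by lia))
      (F.algebras.mono (by lia) _ J.measurableSet_algebras))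
    fun x hx => hx.1.2 _ (Finset.mem_Icc.2 ⟨by lia, _root_.le_refl _⟩)
  have e : J.carrier \ (s ∩ J.carrier) = J.carrier \ s := by
    ext x
    simp only [Set.mem_sdiff, Set.mem_inter_iff]
    tauto
  rw [e] at h
  have hm3 : MeasurableSet (s ∩ J.carrier) := hsm.inter J.measurableSet
  rw [setLIntegral_congr_fun (g := fun x => ‖F.levelAvg (J.rk + 1) a x - avg J a‖ₑ ^ 2) hm3
    fun x hx => by simp only [levelAvg_of_mem a hx.2],
    setLIntegral_congr_fun (f := fun x => ‖F.levelAvg J.rk a x‖ₑ ^ 2)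
      (g := fun x => ‖avg J a‖ₑ ^ 2) J.measurableSet
    fun x hx => by simp only [levelAvg_of_mem a hx], setLIntegral_const]
  exact h

theorem sum_lintegral_boundedSet_sub_sq_le (𝕜 : Type*) [RCLike 𝕜] {E : Type*}
    [NormedAddCommGroup E] [InnerProductSpace 𝕜 E] [NormedSpace ℝ E] [IsScalarTower ℝ 𝕜 E]
    [CompleteSpace E] {Q : F.Atom} {a : X → E} {K : ℝ≥0} {N : ℤ} (hN : Q.rk ≤ N)
    (ha : IntegrableOn a Q.carrier σ) :
    ∑ k ∈ Finset.Ico Q.rk N, ∫⁻ x in boundedSet Q a K (k + 1),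
      ‖F.levelAvg (k + 1) a x - F.levelAvg k a x‖ₑ ^ 2 ∂σ ≤
      2 * K * ∫⁻ x in Q.carrier, ‖a x‖ₑ ∂σ := by
  have key : (∑ k ∈ Finset.Ico Q.rk N, ∫⁻ x in boundedSet Q a K (k + 1),
      ‖F.levelAvg (k + 1) a x - F.levelAvg k a x‖ₑ ^ 2 ∂σ) ≤
      (∫⁻ x in boundedSet Q a K N, ‖F.levelAvg N a x‖ₑ ^ 2 ∂σ) +
        2 * K * ∫⁻ x in Q.carrier \ boundedSet Q a K N, ‖a x‖ₑ ∂σ := by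
    induction N, hN using Int.leInduction with
    | base => simp
    | succ N hN ih =>
      have hU : Q.carrier \ boundedSet Q a K (N + 1) = (Q.carrier \ boundedSet Q a K N) ∪
          (boundedSet Q a K N \ boundedSet Q a K (N + 1)) := by
        ext x
        have h1 := @boundedSet_anti _ _ _ _ _ _ _ Q a K N (N + 1) (by lia) x
        have h2 := @boundedSet_subset _ _ _ _ _ _ _ Q a K N x
        simp only [Set.mem_sdiff, Set.mem_union]
        tauto
      have hd : Disjoint (Q.carrier \ boundedSet Q a K N)
          (boundedSet Q a K N \ boundedSet Q a K (N + 1)) :=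
        Set.disjoint_left.2 fun x hx hx' => hx.2 hx'.1
      have hm := measurableSet_ambient (measurableSet_boundedSet_diff (a := a) (K := K) hN)
      rw [← Finset.insert_Ico_right_eq_Ico_add_one hN, Finset.sum_insert (by simp), hU,
        lintegral_union hm hd]
      refine (add_le_add (le_refl _) ih).trans ?_
      rw [← add_assoc]
      refine (add_le_add (lintegral_boundedSet_sub_sq_le 𝕜 hN ha) (le_refl _)).trans (le_of_eq ?_)
      ring
  refine key.trans ?_
  have hm := measurableSet_ambient (measurableSet_boundedSet (a := a) (K := K) hN)
  have hsplit := lintegral_inter_add_sdiff (μ := σ) (fun x => ‖a x‖ₑ) Q.carrier hm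
  rw [Set.inter_eq_right.2 boundedSet_subset] at hsplit
  rw [← hsplit, mul_add]
  gcongr
  refine (lintegral_boundedSet_levelAvg_sq_le hN).trans ?_
  gcongr
  exact le_mul_of_one_le_left' one_le_two

/-- The weak type estimate: the averages of `a`, and its square function, stay below a fixed
multiple of the average of `‖a‖` on at least half of `Q`. -/
theorem two_mul_measure_diff_goodSet_le (𝕜 : Type*) [RCLike 𝕜] {E : Type*}
    [NormedAddCommGroup E] [InnerProductSpace 𝕜 E] [NormedSpace ℝ E] [IsScalarTower ℝ 𝕜 E]
    [CompleteSpace E] {Q : F.Atom} {a : X → E} {c : ℝ≥0} (hc : c ≠ 0) {N : ℤ} (hN : Q.rk ≤ N)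
    (ha : IntegrableOn a Q.carrier σ) (hQ : ‖avg Q a‖ₑ ≤ (4 * c : ℝ≥0))
    (hac : ∫⁻ x in Q.carrier, ‖a x‖ₑ ∂σ ≤ c * σ Q.carrier) :
    2 * σ (Q.carrier \ goodSet Q a c N) ≤ σ Q.carrier := by
  set B := boundedSet Q a (4 * c) N with hB
  set q : X → ℝ≥0∞ := fun x =>
    ∑ i ∈ Finset.Ico Q.rk N, ‖F.levelAvg (i + 1) a x - F.levelAvg i a x‖ₑ ^ 2 with hq
  have hc0 : (c : ℝ≥0∞) ≠ 0 := by simpa using hc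
  have hBm : MeasurableSet B := measurableSet_ambient (measurableSet_boundedSet hN)
  have hqm : Measurable q := Finset.measurable_fun_sum _ fun i _ =>
    ((stronglyMeasurable_levelAvg _ a).sub (stronglyMeasurable_levelAvg _ a)).enorm.pow_const 2
  have hsub : Q.carrier \ goodSet Q a c N ⊆
      (Q.carrier \ B) ∪ {x | 32 * (c : ℝ≥0∞) ^ 2 ≤ q x} ∩ B := fun x hx => by
    by_cases hxB : x ∈ B
    · refine Or.inr ⟨?_, hxB⟩
      by_contra h
      exact hx.2 ⟨hxB, (not_le.1 h).le⟩
    · exact Or.inl ⟨hx.1, hxB⟩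
  have h1 : 4 * σ (Q.carrier \ B) ≤ σ Q.carrier := by
    refine (ENNReal.mul_le_mul_iff_right hc0 ENNReal.coe_ne_top).1 ?_
    refine le_trans (le_of_eq ?_) ((mul_measure_diff_boundedSet_le hN hQ).trans
      ((lintegral_mono_set Set.sdiff_subset).trans hac))
    push_cast
    ring
  have h2 : 4 * σ ({x | 32 * (c : ℝ≥0∞) ^ 2 ≤ q x} ∩ B) ≤ σ Q.carrier := by
    refine (ENNReal.mul_le_mul_iff_right (a := 8 * (c : ℝ≥0∞) ^ 2) (by simp [hc])
      (ENNReal.mul_ne_top (by simp) (by simp))).1 ?_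
    calc _ = 32 * (c : ℝ≥0∞) ^ 2 * (σ.restrict B) {x | 32 * (c : ℝ≥0∞) ^ 2 ≤ q x} := by
          rw [Measure.restrict_apply' hBm]; ring
      _ ≤ ∫⁻ x in B, q x ∂σ := mul_meas_ge_le_lintegral hqm _
      _ = ∑ i ∈ Finset.Ico Q.rk N,
          ∫⁻ x in B, ‖F.levelAvg (i + 1) a x - F.levelAvg i a x‖ₑ ^ 2 ∂σ :=
        lintegral_finsetSum _ fun i _ => ((stronglyMeasurable_levelAvg _ a).sub
          (stronglyMeasurable_levelAvg _ a)).enorm.pow_const 2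
      _ ≤ _ := Finset.sum_le_sum fun i hi => lintegral_mono_set
          (boundedSet_anti (by have := Finset.mem_Ico.1 hi; lia : i + 1 ≤ N))
      _ ≤ _ := sum_lintegral_boundedSet_sub_sq_le 𝕜 hN ha
      _ ≤ 2 * (4 * c : ℝ≥0) * (c * σ Q.carrier) := by gcongr
      _ = _ := by push_cast; ring
  have h3 := (measure_mono (μ := σ) hsub).trans (measure_union_le _ _)
  refine (ENNReal.mul_le_mul_iff_right (a := 2) two_ne_zero (by simp)).1 ?_
  calc 2 * (2 * σ (Q.carrier \ goodSet Q a c N)) = 4 * σ (Q.carrier \ goodSet Q a c N) := by ring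
    _ ≤ 4 * (σ (Q.carrier \ B) + σ ({x | 32 * (c : ℝ≥0∞) ^ 2 ≤ q x} ∩ B)) := by gcongr
    _ = 4 * σ (Q.carrier \ B) + 4 * σ ({x | 32 * (c : ℝ≥0∞) ^ 2 ≤ q x} ∩ B) := mul_add _ _ _
    _ ≤ σ Q.carrier + σ Q.carrier := add_le_add h1 h2
    _ = 2 * σ Q.carrier := (two_mul _).symm

theorem sum_indicator_goodSet_le {E : Type*} [NormedAddCommGroup E] [NormedSpace ℝ E]
    {Q : F.Atom} {a : X → E} {c : ℝ≥0} {N : ℤ} (hN : Q.rk ≤ N) (x : X) :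
    ∑ i ∈ Finset.Ico Q.rk N, (goodSet Q a c (i + 1)).indicator
      (fun x => ‖F.levelAvg (i + 1) a x - F.levelAvg i a x‖ₑ ^ 2) x ≤ 32 * (c : ℝ≥0∞) ^ 2 := by
  induction N, hN using Int.leInduction with
  | base => simp
  | succ N hN ih =>
    by_cases hx : x ∈ goodSet Q a c (N + 1)
    · refine le_trans (Finset.sum_le_sum fun i _ => ?_) hx.2
      exact Set.indicator_le_self _ _ _
    · rw [← Finset.insert_Ico_right_eq_Ico_add_one hN, Finset.sum_insert (by simp),
        Set.indicator_of_notMem hx, zero_add]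
      exact ih

end AtomicFiltration

/-! ### Averages of operator weights -/

namespace AtomicFiltration

variable {X : Type*} [mX : MeasurableSpace X] {σ : Measure X} {F : AtomicFiltration σ}
  {𝕜 : Type*} [RCLike 𝕜] {E : Type*} [NormedAddCommGroup E] [InnerProductSpace 𝕜 E]

theorem localMaximal_mono {I J : F.Atom} (h : I ≤ J) (w : X → ℝ) (x : X) :
    localMaximal I w x ≤ localMaximal J w x :=
  iSup_mono fun _ => iSup_mono' fun hK => ⟨Atom.le_trans hK h, le_rfl⟩

theorem enorm_avg_le_localMaximal {I J : F.Atom} (h : I ≤ J) (w : X → ℝ) {x : X}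
    (hx : x ∈ I.carrier) : ‖avg I w‖ₑ ≤ localMaximal J w x :=
  le_iSup₂_of_le I h (le_iSup_of_le hx le_rfl)

theorem enorm_sq_eq_ofReal (v : E) : ‖v‖ₑ ^ 2 = ENNReal.ofReal (‖v‖ ^ 2) := by
  rw [← ofReal_norm, ENNReal.ofReal_pow (norm_nonneg _)]

/-- The operator norm is at most the Hilbert-Schmidt norm. -/
theorem norm_apply_sq_le_sum {ι : Type*} [Fintype ι] (b : OrthonormalBasis ι 𝕜 E)
    (T : E →L[𝕜] E) (v : E) : ‖T v‖ ^ 2 ≤ (∑ i, ‖T (b i)‖ ^ 2) * ‖v‖ ^ 2 :=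
  calc ‖T v‖ ^ 2 = ‖∑ i, inner 𝕜 (b i) v • T (b i)‖ ^ 2 := by
        conv_lhs => rw [← b.sum_repr' v, map_sum]
        simp_rw [map_smul]
    _ ≤ (∑ i, ‖T (b i)‖ * ‖inner 𝕜 (b i) v‖) ^ 2 := by
        gcongr
        refine (norm_sum_le _ _).trans (Finset.sum_le_sum fun i _ => ?_)
        rw [norm_smul, mul_comm]
    _ ≤ (∑ i, ‖T (b i)‖ ^ 2) * ∑ i, ‖inner 𝕜 (b i) v‖ ^ 2 := Finset.sum_mul_sq_le_sq_mul_sq _ _ _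
    _ = _ := by rw [b.sum_sq_norm_inner_right]

theorem enorm_apply_sq_le_sum {ι : Type*} [Fintype ι] (b : OrthonormalBasis ι 𝕜 E)
    (T : E →L[𝕜] E) (v : E) : ‖T v‖ₑ ^ 2 ≤ (∑ i, ‖T (b i)‖ₑ ^ 2) * ‖v‖ₑ ^ 2 := by
  simp_rw [enorm_sq_eq_ofReal]
  rw [← ENNReal.ofReal_sum_of_nonneg fun i _ => by positivity, ← ENNReal.ofReal_mul (by positivity)]
  exact ENNReal.ofReal_le_ofReal (norm_apply_sq_le_sum b T v)

theorem memLp_two_of_forall_apply [FiniteDimensional 𝕜 E] {μ : Measure X} {T : X → E →L[𝕜] E}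
    (hT : AEStronglyMeasurable T μ) (h : ∀ v, ∫⁻ x, ‖T x v‖ₑ ^ 2 ∂μ < ∞) : MemLp T 2 μ := by
  let b := stdOrthonormalBasis 𝕜 E
  have hm : ∀ i, AEMeasurable (fun x => ‖T x (b i)‖ₑ ^ 2) μ := fun i =>
    ((ContinuousLinearMap.apply 𝕜 E (b i)).continuous.comp_aestronglyMeasurable
      hT).enorm.pow_const 2
  refine ⟨hT, (eLpNorm_lt_top_iff_lintegral_rpow_enorm_lt_top (by simp) (by simp)).2 ?_⟩
  have hle : ∫⁻ x, ‖T x‖ₑ ^ 2 ∂μ ≤ ∫⁻ x, ∑ i, ‖T x (b i)‖ₑ ^ 2 ∂μ := by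
    refine lintegral_mono fun x => ?_
    simp_rw [enorm_sq_eq_ofReal]
    rw [← ENNReal.ofReal_sum_of_nonneg fun i _ => by positivity]
    refine ENNReal.ofReal_le_ofReal ?_
    have hS : 0 ≤ ∑ i, ‖T x (b i)‖ ^ 2 := Finset.sum_nonneg fun i _ => by positivity
    refine (Real.le_sqrt (norm_nonneg _) hS).1 ?_
    refine (T x).opNorm_le_bound (Real.sqrt_nonneg _) fun v => ?_
    refine (sq_le_sq₀ (norm_nonneg _) (by positivity)).1 ?_
    rw [mul_pow, Real.sq_sqrt hS]
    exact norm_apply_sq_le_sum b (T x) v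
  rw [lintegral_finsetSum' _ fun i _ => hm i] at hle
  refine lt_of_le_of_lt ?_ (hle.trans_lt (ENNReal.sum_lt_top.2 fun i _ => h (b i)))
  simp

variable [NormedSpace ℝ E] [IsScalarTower ℝ 𝕜 E]

theorem inner_real_smul_right (t : ℝ) (v w : E) :
    inner 𝕜 v (t • w) = (t : 𝕜) * inner 𝕜 v w := by
  rw [← algebraMap_smul 𝕜 t w, inner_smul_right, RCLike.algebraMap_eq_ofReal]

variable [CompleteSpace E]

/-- The average over `J` of the operator weight `H* H`. -/
noncomputable def weightAvg (J : F.Atom) (H : X → E →L[𝕜] E) : E →L[𝕜] E :=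
  avg J fun x => (ContinuousLinearMap.adjoint (H x)).comp (H x)

theorem measure_real_smul_weightAvg (J : F.Atom) (H : X → E →L[𝕜] E) :
    σ.real J.carrier • weightAvg J H = gramOperator (σ.restrict J.carrier) H :=
  measure_real_smul_avg J _

theorem weightAvg_eq (J : F.Atom) (H : X → E →L[𝕜] E) :
    weightAvg J H = (σ.real J.carrier)⁻¹ • gramOperator (σ.restrict J.carrier) H :=
  avg_eq J _

theorem weightAvg_isPositive {J : F.Atom} {H : X → E →L[𝕜] E}
    (hH : MemLp H 2 (σ.restrict J.carrier)) : (weightAvg J H).IsPositive := by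
  have hp := gramOperator_isPositive hH
  rw [weightAvg_eq]
  refine ContinuousLinearMap.isPositive_def.2 ⟨fun v w => ?_, fun v => ?_⟩
  · have h := hp.isSymmetric v w
    change inner 𝕜 ((σ.real J.carrier)⁻¹ • gramOperator (σ.restrict J.carrier) H v) w =
      inner 𝕜 v ((σ.real J.carrier)⁻¹ • gramOperator (σ.restrict J.carrier) H w)
    rw [← inner_conj_symm, inner_real_smul_right, inner_real_smul_right, map_mul, inner_conj_symm,
      RCLike.conj_ofReal]
    exact congrArg _ h
  · rw [ContinuousLinearMap.reApplyInnerSelf_apply, inner_re_symm, smul_apply,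
      inner_real_smul_right, RCLike.re_ofReal_mul]
    exact mul_nonneg (by positivity) (hp.re_inner_nonneg_right v)

theorem setLIntegral_enorm_sq_eq {J : F.Atom} {H : X → E →L[𝕜] E}
    (hH : MemLp H 2 (σ.restrict J.carrier)) (v : E) :
    ∫⁻ x in J.carrier, ‖H x v‖ₑ ^ 2 ∂σ =
      ENNReal.ofReal (RCLike.re (inner 𝕜 v (weightAvg J H v))) * σ J.carrier := by
  rw [lintegral_enorm_apply_sq hH, ← measure_real_smul_weightAvg, smul_apply,
    inner_real_smul_right, RCLike.re_ofReal_mul, ENNReal.ofReal_mul (by positivity),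
    ofReal_measureReal J.measure_ne_top, mul_comm]

theorem avg_norm_sq_eq {J : F.Atom} {H : X → E →L[𝕜] E}
    (hH : MemLp H 2 (σ.restrict J.carrier)) (v : E) :
    avg J (fun x => ‖H x v‖ ^ 2) = RCLike.re (inner 𝕜 v (weightAvg J H v)) := by
  rw [avg_eq, ← re_inner_gramOperator hH, weightAvg_eq, smul_apply,
    inner_real_smul_right, RCLike.re_ofReal_mul, smul_eq_mul]

theorem weightAvg_apply {J : F.Atom} {H : X → E →L[𝕜] E}
    (hH : MemLp H 2 (σ.restrict J.carrier)) (v : E) :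
    weightAvg J H v = avg J fun x => ContinuousLinearMap.adjoint (H x) (H x v) := by
  rw [weightAvg_eq, smul_apply, gramOperator,
    ContinuousLinearMap.integral_apply (integrable_adjoint_comp_self hH), avg_eq]
  rfl

theorem weightAvg_apply_eq_zero {J : F.Atom} {H : X → E →L[𝕜] E}
    (hH : MemLp H 2 (σ.restrict J.carrier)) {v : E}
    (hv : ∀ᵐ x ∂σ.restrict J.carrier, H x v = 0) : weightAvg J H v = 0 := by
  rw [weightAvg_apply hH, avg_eq, integral_eq_zero_of_ae, smul_zero]
  filter_upwards [hv] with x hx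
  simp [hx]

theorem ae_apply_eq_zero_of_weightAvg {J : F.Atom} {H : X → E →L[𝕜] E}
    (hH : MemLp H 2 (σ.restrict J.carrier)) {v : E} (hv : weightAvg J H v = 0) :
    ∀ᵐ x ∂σ.restrict J.carrier, H x v = 0 := by
  refine apply_ae_eq_zero_of_gramOperator hH ?_
  rw [← measure_real_smul_weightAvg, smul_apply, hv, smul_zero]

theorem weightAvg_apply_eq_zero_of_le {J Q : F.Atom} (hJ : J ≤ Q) {H : X → E →L[𝕜] E}
    (hH : MemLp H 2 (σ.restrict Q.carrier)) {v : E} (hv : weightAvg Q H v = 0) :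
    weightAvg J H v = 0 :=
  weightAvg_apply_eq_zero (hH.mono_measure (restrict_le_restrict hJ))
    (ae_mono (restrict_le_restrict hJ) (ae_apply_eq_zero_of_weightAvg hH hv))

/-- The operator whose value at `v` is the martingale difference, from generation `k` to generation
`k + 1`, of the vector function `H* H v`, weighted by `L`. -/
noncomputable def weightJump (F : AtomicFiltration σ) (H L : X → E →L[𝕜] E) (k : ℤ) (x : X) :
    E →L[𝕜] E :=
  (L x).comp (weightAvg (F.atomAt (k + 1) x) H - weightAvg (F.atomAt k x) H)

theorem weightJump_apply (H L : X → E →L[𝕜] E) (k : ℤ) (x : X) (v : E) :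
    F.weightJump H L k x v =
      L x (weightAvg (F.atomAt (k + 1) x) H v - weightAvg (F.atomAt k x) H v) := rfl

theorem aestronglyMeasurable_weightJump {μ : Measure X} {H L : X → E →L[𝕜] E}
    (hL : AEStronglyMeasurable L μ) (k : ℤ) : AEStronglyMeasurable (F.weightJump H L k) μ := by
  have h1 : StronglyMeasurable fun x => weightAvg (F.atomAt (k + 1) x) H :=
    stronglyMeasurable_of_atomAt (F := F) (k := k + 1) fun x y h => by rw [h]
  have h2 : StronglyMeasurable fun x => weightAvg (F.atomAt k x) H :=
    stronglyMeasurable_of_atomAt (F := F) (k := k) fun x y h => by rw [h]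
  exact (isBoundedBilinearMap_comp (𝕜 := 𝕜)).continuous.comp_aestronglyMeasurable
    (hL.prodMk (h1.sub h2).aestronglyMeasurable)

variable [FiniteDimensional 𝕜 E]

/-- A square root `r` of the average of the weight over `Q` is factored out of the averages of
`H* H v` over the atoms inside `Q`, which become `r` applied to those of `a`. The vector function
`a` has average norm at most `c`, and the weight `L* L`, seen through `r`, has average at most the
`A₂` constant, up to the dimension. -/
theorem exists_normalization {Q : F.Atom} {H L : X → E →L[𝕜] E}
    (hH : MemLp H 2 (σ.restrict Q.carrier)) (hL : MemLp L 2 (σ.restrict Q.carrier)) {A : ℝ≥0∞}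
    (hA : ∀ v, ∫⁻ x in Q.carrier, ‖L x (weightAvg Q H v)‖ₑ ^ 2 ∂σ ≤
      A * ∫⁻ x in Q.carrier, ‖H x v‖ₑ ^ 2 ∂σ) (v : E) {c : ℝ≥0} (hc : c ≠ 0)
    (hcv : (c : ℝ≥0∞) ^ 2 = Module.finrank 𝕜 E *
      ENNReal.ofReal (RCLike.re (inner 𝕜 v (weightAvg Q H v)))) :
    ∃ (r : E →L[𝕜] E) (a : X → E) (ν : X → ℝ≥0∞), IntegrableOn a Q.carrier σ ∧
      (∫⁻ x in Q.carrier, ‖a x‖ₑ ∂σ ≤ c * σ Q.carrier) ∧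
      (∀ J ≤ Q, r (avg J a) = weightAvg J H v) ∧
      (∀ x w, ‖L x (r w)‖ₑ ^ 2 ≤ ν x * ‖w‖ₑ ^ 2) ∧
      ∫⁻ x in Q.carrier, ν x ∂σ ≤ Module.finrank 𝕜 E * A * σ Q.carrier := by
  obtain ⟨r, r', hr, hr', hru, hrc, hrr, hle⟩ := (weightAvg_isPositive hH).exists_sqrt_pseudoinverse
  set d := Module.finrank 𝕜 E with hd
  set ω := RCLike.re (inner 𝕜 v (weightAvg Q H v)) with hω
  let b := stdOrthonormalBasis 𝕜 E
  let a : X → E := fun x => r' (ContinuousLinearMap.adjoint (H x) (H x v))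
  have hi : IntegrableOn (fun x => ContinuousLinearMap.adjoint (H x) (H x v)) Q.carrier σ :=
    (ContinuousLinearMap.apply 𝕜 E v).integrable_comp (integrable_adjoint_comp_self hH)
  have hHr : ∀ w, ∫⁻ x in Q.carrier, ‖H x (r' w)‖ₑ ^ 2 ∂σ ≤ ‖w‖ₑ ^ 2 * σ Q.carrier := fun w => by
    rw [setLIntegral_enorm_sq_eq hH, enorm_sq_eq_ofReal]
    gcongr
    rw [← hru, ← hr, inner_self_eq_norm_sq, hrc]
    exact pow_le_pow_left₀ (norm_nonneg _) (hle w) 2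
  refine ⟨r, a, fun x => ∑ i, ‖L x (r (b i))‖ₑ ^ 2, r'.integrable_comp hi, ?_, fun J hJ => ?_,
    fun x w => enorm_apply_sq_le_sum b ((L x).comp r) w, ?_⟩
  · -- by the Cauchy-Schwarz inequality, `2 c ‖a‖ ≤ ω ‖H r'‖² + d ‖H v‖²`
    have hpt : ∀ x, 2 * c * ‖a x‖ₑ ≤
        ENNReal.ofReal ω * (∑ i, ‖H x (r' (b i))‖ₑ ^ 2) + d * ‖H x v‖ₑ ^ 2 := by
      intro x
      have hsq : ‖a x‖ ^ 2 ≤ (∑ i, ‖H x (r' (b i))‖ ^ 2) * ‖H x v‖ ^ 2 := by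
        rw [← b.sum_sq_norm_inner_right, Finset.sum_mul]
        refine Finset.sum_le_sum fun i _ => ?_
        rw [← mul_pow]
        gcongr
        simp only [a]
        rw [← hr', ContinuousLinearMap.adjoint_inner_right]
        exact norm_inner_le_norm _ _
      have hω0 : 0 ≤ ω := (weightAvg_isPositive hH).re_inner_nonneg_right v
      have hcv' : (c : ℝ) ^ 2 = d * ω := by
        have h := congrArg ENNReal.toReal hcv
        simpa [hω0] using h
      have hreal : 2 * c * ‖a x‖ ≤ ω * (∑ i, ‖H x (r' (b i))‖ ^ 2) + d * ‖H x v‖ ^ 2 := by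
        set S := ∑ i, ‖H x (r' (b i))‖ ^ 2 with hS
        have hS0 : 0 ≤ S := Finset.sum_nonneg fun i _ => by positivity
        refine (sq_le_sq₀ (by positivity) (by positivity)).1 ?_
        calc (2 * c * ‖a x‖) ^ 2 = 4 * (d * ω) * ‖a x‖ ^ 2 := by rw [← hcv']; ring
          _ ≤ 4 * (d * ω) * (S * ‖H x v‖ ^ 2) := by gcongr
          _ ≤ (ω * S + d * ‖H x v‖ ^ 2) ^ 2 := by
            nlinarith [sq_nonneg (ω * S - d * ‖H x v‖ ^ 2)]
      have h := ENNReal.ofReal_le_ofReal hreal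
      rw [ENNReal.ofReal_mul (by positivity), ENNReal.ofReal_mul (by positivity), ofReal_norm,
        ENNReal.ofReal_add (by positivity) (by positivity), ENNReal.ofReal_mul hω0,
        ENNReal.ofReal_sum_of_nonneg (fun i _ => by positivity),
        ENNReal.ofReal_mul (by positivity), ENNReal.ofReal_ofNat, ENNReal.ofReal_natCast,
        ENNReal.ofReal_coe_nnreal] at h
      simp_rw [enorm_sq_eq_ofReal]
      exact h
    have hint : 2 * c * ∫⁻ x in Q.carrier, ‖a x‖ₑ ∂σ ≤ 2 * c * (c * σ Q.carrier) := by
      rw [← lintegral_const_mul' _ _ (ENNReal.mul_ne_top (by simp) (by simp))]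
      refine (lintegral_mono hpt).trans ?_
      have hm : ∀ i, AEMeasurable (fun x => ‖H x (r' (b i))‖ₑ ^ 2) (σ.restrict Q.carrier) :=
        fun i => (hH.clm_apply_const _).1.enorm.pow_const 2
      have hm' : AEMeasurable (fun x => ‖H x v‖ₑ ^ 2) (σ.restrict Q.carrier) :=
        (hH.clm_apply_const _).1.enorm.pow_const 2
      rw [lintegral_add_right' _ (hm'.const_mul _), lintegral_const_mul' _ _ ENNReal.ofReal_ne_top,
        lintegral_finsetSum' _ fun i _ => hm i, lintegral_const_mul' _ _ (by simp),
        setLIntegral_enorm_sq_eq hH v]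
      calc _ ≤ ENNReal.ofReal ω * (∑ _ : Fin d, σ Q.carrier) +
            d * (ENNReal.ofReal ω * σ Q.carrier) := by
            gcongr with i
            refine (hHr (b i)).trans ?_
            rw [enorm_sq_eq_ofReal]
            simp
        _ = 2 * (d * ENNReal.ofReal ω) * σ Q.carrier := by
            rw [Finset.sum_const, Finset.card_univ, Fintype.card_fin, nsmul_eq_mul]; ring
        _ = 2 * c * (c * σ Q.carrier) := by rw [← hcv]; ring
    exact (ENNReal.mul_le_mul_iff_right (by simp [hc])
      (ENNReal.mul_ne_top (by simp) (by simp))).1 hint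
  · have hJa : avg J a = r' (weightAvg J H v) := by
      rw [weightAvg_apply (hH.mono_measure (restrict_le_restrict hJ)), avg_eq, avg_eq,
        ContinuousLinearMap.map_smul_of_tower, ← r'.integral_comp_comm (hi.mono_set hJ.1)]
    have hpJ := weightAvg_isPositive (hH.mono_measure (restrict_le_restrict hJ))
    rw [hJa]
    refine ext_inner_left 𝕜 fun w => ?_
    rw [← hr, ← hr', ← hpJ.inner_left_eq_inner_right, ← hpJ.inner_left_eq_inner_right,
      ← sub_eq_zero, ← inner_sub_left, ← map_sub,
      weightAvg_apply_eq_zero_of_le hJ hH (by rw [map_sub, ← hru, hrr, hru, sub_self]),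
      inner_zero_left]
  · have hm : ∀ i, AEMeasurable (fun x => ‖L x (r (b i))‖ₑ ^ 2) (σ.restrict Q.carrier) :=
      fun i => (hL.clm_apply_const _).1.enorm.pow_const 2
    rw [lintegral_finsetSum' _ fun i _ => hm i]
    calc _ ≤ ∑ _ : Fin d, A * σ Q.carrier := Finset.sum_le_sum fun i _ => by
          have e : r (b i) = weightAvg Q H (r' (b i)) := by rw [← hru, hrc, hrr]
          rw [e]
          refine (hA _).trans ?_
          gcongr
          refine (hHr (b i)).trans ?_
          rw [enorm_sq_eq_ofReal]
          simp
      _ = _ := by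
          rw [Finset.sum_const, Finset.card_univ, Fintype.card_fin, nsmul_eq_mul, mul_assoc]

end AtomicFiltration

/-! ### The testing condition -/

namespace AtomicFiltration

variable {X : Type*} [mX : MeasurableSpace X] {σ : Measure X} {F : AtomicFiltration σ}

theorem enorm_add_sq_le {G : Type*} [NormedAddCommGroup G] (p q : G) :
    ‖p + q‖ₑ ^ 2 ≤ 2 * ‖p‖ₑ ^ 2 + 2 * ‖q‖ₑ ^ 2 := by
  simp_rw [enorm_sq_eq_ofReal]
  rw [← ENNReal.ofReal_ofNat, ← ENNReal.ofReal_mul (by positivity),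
    ← ENNReal.ofReal_mul (by positivity), ← ENNReal.ofReal_add (by positivity) (by positivity)]
  refine ENNReal.ofReal_le_ofReal ((pow_le_pow_left₀ (norm_nonneg _) (norm_add_le p q) 2).trans ?_)
  nlinarith [sq_nonneg (‖p‖ - ‖q‖)]

theorem enorm_sub_sq_le {G : Type*} [NormedAddCommGroup G] (p q : G) :
    ‖p - q‖ₑ ^ 2 ≤ 2 * ‖p‖ₑ ^ 2 + 2 * ‖q‖ₑ ^ 2 := by
  rw [sub_eq_add_neg, ← enorm_neg q]
  exact enorm_add_sq_le p (-q)

section Decomposition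

variable {E : Type*} [NormedAddCommGroup E] [NormedSpace ℝ E]
  {Q : F.Atom} {a : X → E} {c : ℝ≥0} {k : ℤ}

theorem measurableSet_goodSet_diff (hk : Q.rk ≤ k) :
    MeasurableSet[F.algebras (k + 1)] (goodSet Q a c k \ goodSet Q a c (k + 1)) :=
  MeasurableSet.diff (F.algebras.mono (by lia) _ (measurableSet_goodSet hk))
    (measurableSet_goodSet (by lia))

theorem lintegral_goodSet_succ_add (hk : Q.rk ≤ k) (φ : X → ℝ≥0∞) :
    (∫⁻ x in goodSet Q a c (k + 1), φ x ∂σ) +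
      ∫⁻ x in goodSet Q a c k \ goodSet Q a c (k + 1), φ x ∂σ =
      ∫⁻ x in goodSet Q a c k, φ x ∂σ := by
  have h := lintegral_inter_add_sdiff (μ := σ) φ (goodSet Q a c k)
    (measurableSet_ambient (measurableSet_goodSet (Q := Q) (a := a) (c := c) (by lia : _ ≤ k + 1)))
  rwa [Set.inter_eq_right.2 (goodSet_anti (by lia))] at h

theorem sum_lintegral_goodSet_diff_add {N : ℤ} (hN : Q.rk ≤ N) (hQ : ‖avg Q a‖ₑ ≤ (4 * c : ℝ≥0))
    (φ : X → ℝ≥0∞) :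
    ∑ j ∈ Finset.Ico Q.rk N, (∫⁻ x in goodSet Q a c j \ goodSet Q a c (j + 1), φ x ∂σ) +
      ∫⁻ x in goodSet Q a c N, φ x ∂σ ≤ ∫⁻ x in Q.carrier, φ x ∂σ := by
  rw [← goodSet_rk hQ]
  refine sum_Ico_add_le_of_step (D := fun j =>
    ∫⁻ x in goodSet Q a c j \ goodSet Q a c (j + 1), φ x ∂σ)
    (ρ := fun j => ∫⁻ x in goodSet Q a c j, φ x ∂σ) hN fun k hk _ => ?_
  rw [← lintegral_goodSet_succ_add hk φ, add_comm]

/-- A sum over the generations is split, at each point, according to whether the generation is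
before the exit time from the good sets, is the exit time, or comes after it. -/
theorem sum_lintegral_le_exit {N : ℤ} (hN : Q.rk ≤ N) (hQ : ‖avg Q a‖ₑ ≤ (4 * c : ℝ≥0))
    (φ : ℤ → X → ℝ≥0∞) :
    ∑ k ∈ Finset.Ico Q.rk N, ∫⁻ x in Q.carrier, φ k x ∂σ ≤
      (∑ j ∈ Finset.Ico Q.rk N, ∫⁻ x in goodSet Q a c (j + 1), φ j x ∂σ) +
      ∑ j ∈ Finset.Ico Q.rk N, ((∫⁻ x in goodSet Q a c j \ goodSet Q a c (j + 1), φ j x ∂σ) +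
        ∑ k ∈ Finset.Ico (j + 1) N,
          ∫⁻ x in goodSet Q a c j \ goodSet Q a c (j + 1), φ k x ∂σ) := by
  have h := le_sum_Ico_add_of_step (ρ := fun j => ∑ k ∈ Finset.Ico j N,
      ∫⁻ x in goodSet Q a c j, φ k x ∂σ)
    (D := fun j => (∫⁻ x in goodSet Q a c (j + 1), φ j x ∂σ) +
      ((∫⁻ x in goodSet Q a c j \ goodSet Q a c (j + 1), φ j x ∂σ) +
        ∑ k ∈ Finset.Ico (j + 1) N,
          ∫⁻ x in goodSet Q a c j \ goodSet Q a c (j + 1), φ k x ∂σ)) hN fun j hj hjN => by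
    rw [← Finset.insert_Ico_add_one_left_eq_Ico hjN, Finset.sum_insert (by simp)]
    simp_rw [← lintegral_goodSet_succ_add (a := a) (c := c) hj]
    rw [Finset.sum_add_distrib]
    exact le_of_eq (by ring)
  simpa [goodSet_rk hQ, Finset.sum_add_distrib] using h

end Decomposition

variable {𝕜 : Type*} [RCLike 𝕜] {E : Type*} [NormedAddCommGroup E] [InnerProductSpace 𝕜 E]
  [NormedSpace ℝ E] [IsScalarTower ℝ 𝕜 E] [CompleteSpace E]

theorem setLIntegral_enorm_sq_eq_avg {J : F.Atom} {H : X → E →L[𝕜] E}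
    (hH : MemLp H 2 (σ.restrict J.carrier)) (v : E) :
    ∫⁻ x in J.carrier, ‖H x v‖ₑ ^ 2 ∂σ = ‖avg J fun x => ‖H x v‖ ^ 2‖ₑ * σ J.carrier := by
  rw [setLIntegral_enorm_sq_eq hH, avg_norm_sq_eq hH, Real.enorm_of_nonneg
    ((weightAvg_isPositive hH).re_inner_nonneg_right v)]

theorem setLIntegral_enorm_sq_le_localMaximal {J : F.Atom} {H : X → E →L[𝕜] E}
    (hH : MemLp H 2 (σ.restrict J.carrier)) (v : E) :
    ∫⁻ x in J.carrier, ‖H x v‖ₑ ^ 2 ∂σ ≤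
      ∫⁻ x in J.carrier, localMaximal J (fun x => ‖H x v‖ ^ 2) x ∂σ := by
  rw [setLIntegral_enorm_sq_eq_avg hH, ← setLIntegral_const]
  exact setLIntegral_mono' J.measurableSet fun x hx => enorm_avg_le_localMaximal J.le_refl _ hx

/-- The constant of the testing condition in dimension `d`. It is twice `2 + 64 d²`, where `64 d²`
bounds the part of the sum up to the exit time, `2` accounts for the extra term that makes the
induction close, and the factor two is the share of the good set in the measure of the atom. -/
def testingConst (d : ℕ) : ℝ≥0 := 4 + 128 * d ^ 2

variable [FiniteDimensional 𝕜 E]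

/-- One step of the stopping time argument for `testing_bound`: below the generation `N`, the claim
for the atom `Q` follows from the claim for the smaller atoms. -/
theorem testing_step {H L : X → E →L[𝕜] E} {Q : F.Atom}
    (hH : MemLp H 2 (σ.restrict Q.carrier)) (hL : MemLp L 2 (σ.restrict Q.carrier)) {A : ℝ≥0∞}
    (hAtop : A ≠ ∞)
    (hA : ∀ J ≤ Q, ∀ v, ∫⁻ x in J.carrier, ‖L x (weightAvg J H v)‖ₑ ^ 2 ∂σ ≤
      A * ∫⁻ x in J.carrier, ‖H x v‖ₑ ^ 2 ∂σ) (v : E) {N : ℤ} (hN : Q.rk ≤ N)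
    (hv : weightAvg Q H v ≠ 0)
    (ih : ∀ J ≤ Q, Q.rk < J.rk → J.rk ≤ N → 2 * A * (∫⁻ x in J.carrier, ‖H x v‖ₑ ^ 2 ∂σ) +
      ∑ k ∈ Finset.Ico J.rk N, ∫⁻ x in J.carrier, ‖F.weightJump H L k x v‖ₑ ^ 2 ∂σ ≤
      testingConst (Module.finrank 𝕜 E) * A *
        ∫⁻ x in J.carrier, localMaximal J (fun x => ‖H x v‖ ^ 2) x ∂σ) :
    2 * A * (∫⁻ x in Q.carrier, ‖H x v‖ₑ ^ 2 ∂σ) +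
      ∑ k ∈ Finset.Ico Q.rk N, ∫⁻ x in Q.carrier, ‖F.weightJump H L k x v‖ₑ ^ 2 ∂σ ≤
      testingConst (Module.finrank 𝕜 E) * A *
        ∫⁻ x in Q.carrier, localMaximal Q (fun x => ‖H x v‖ ^ 2) x ∂σ := by
  set d := Module.finrank 𝕜 E with hd
  set M := localMaximal Q (fun x => ‖H x v‖ ^ 2) with hM
  have hpos := weightAvg_isPositive hH
  set ω := RCLike.re (inner 𝕜 v (weightAvg Q H v)) with hω
  have hω0 : 0 < ω := by
    refine lt_of_le_of_ne (hpos.re_inner_nonneg_right v) fun h0 => hv ?_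
    refine weightAvg_apply_eq_zero hH ?_
    have h := setLIntegral_enorm_sq_eq hH v
    rw [← hω, ← h0, ENNReal.ofReal_zero, zero_mul,
      lintegral_eq_zero_iff' ((hH.clm_apply_const v).1.enorm.pow_const 2)] at h
    filter_upwards [h] with x hx
    simpa using hx
  have hd0 : d ≠ 0 := by
    intro h0
    have : Subsingleton E := Module.finrank_zero_iff.1 h0
    exact hv (Subsingleton.elim _ _)
  have hσ : σ Q.carrier ≠ 0 := by
    intro h0
    refine hv (weightAvg_apply_eq_zero hH ?_)
    rw [Measure.restrict_eq_zero.2 h0]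
    simp
  have hwQ : ∫⁻ x in Q.carrier, ‖H x v‖ₑ ^ 2 ∂σ = ENNReal.ofReal ω * σ Q.carrier :=
    setLIntegral_enorm_sq_eq hH v
  -- the normalization: `c ^ 2 = d ω`
  obtain ⟨c, hc⟩ : ∃ c : ℝ≥0, c ^ 2 = d * ω.toNNReal := ⟨_, NNReal.sq_sqrt _⟩
  have hc0 : c ≠ 0 := by
    rintro rfl
    have : (d : ℝ≥0) * ω.toNNReal ≠ 0 :=
      mul_ne_zero (by exact_mod_cast hd0) (by simpa using hω0)
    exact this (by rw [← hc]; simp)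
  have hcv : (c : ℝ≥0∞) ^ 2 = d * ENNReal.ofReal ω := by
    rw [ENNReal.ofReal, ← ENNReal.coe_pow, hc]; simp
  obtain ⟨r, a, ν, hai, hac, hra, hν, hνint⟩ :=
    exists_normalization hH hL (hA Q Q.le_refl) v hc0 hcv
  have hQ : ‖avg Q a‖ₑ ≤ (4 * c : ℝ≥0) := by
    refine ((ENNReal.mul_le_mul_iff_left hσ Q.measure_ne_top).1
      ((enorm_avg_mul_le Q a).trans hac)).trans ?_
    push_cast
    exact le_mul_of_one_le_left' (by norm_num)
  let Γ := goodSet Q a c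
  have hΓm : ∀ k, Q.rk ≤ k → MeasurableSet (Γ k) := fun k hk =>
    measurableSet_ambient (measurableSet_goodSet hk)
  have hΓd : ∀ k, Q.rk ≤ k → MeasurableSet (Γ k \ Γ (k + 1)) := fun k hk =>
    measurableSet_ambient (measurableSet_goodSet_diff hk)
  have hjump : ∀ k, Q.rk ≤ k → ∀ x ∈ Q.carrier, F.weightJump H L k x v =
      L x (r (F.levelAvg (k + 1) a x - F.levelAvg k a x)) := fun k hk x hx => by
    rw [weightJump_apply, map_sub r, levelAvg, levelAvg, hra _ (atomAt_le hx (by lia)),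
      hra _ (atomAt_le hx hk)]
  have hctop : (32 * (c : ℝ≥0∞) ^ 2) ≠ ∞ := ENNReal.mul_ne_top (by simp) (by simp)
  -- generations before the exit time
  have hbefore : ∑ j ∈ Finset.Ico Q.rk N, ∫⁻ x in Γ (j + 1), ‖F.weightJump H L j x v‖ₑ ^ 2 ∂σ ≤
      32 * (c : ℝ≥0∞) ^ 2 * ∫⁻ x in Q.carrier, ν x ∂σ := by
    calc _ ≤ ∑ j ∈ Finset.Ico Q.rk N, ∫⁻ x in Q.carrier, ν x * (Γ (j + 1)).indicator
          (fun x => ‖F.levelAvg (j + 1) a x - F.levelAvg j a x‖ₑ ^ 2) x ∂σ := by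
          refine Finset.sum_le_sum fun j hj => ?_
          have hjQ := (Finset.mem_Ico.1 hj).1
          have hΓQ : Γ (j + 1) ∩ Q.carrier = Γ (j + 1) := Set.inter_eq_left.2 goodSet_subset
          rw [← hΓQ, ← setLIntegral_indicator (hΓm _ (by lia)), hΓQ]
          refine setLIntegral_mono' Q.measurableSet fun x hx => ?_
          by_cases hxΓ : x ∈ Γ (j + 1)
          · rw [Set.indicator_of_mem hxΓ, Set.indicator_of_mem hxΓ, hjump j hjQ x hx]
            exact hν x _
          · rw [Set.indicator_of_notMem hxΓ]
            exact zero_le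
      _ ≤ ∫⁻ x in Q.carrier, ∑ j ∈ Finset.Ico Q.rk N, ν x * (Γ (j + 1)).indicator
          (fun x => ‖F.levelAvg (j + 1) a x - F.levelAvg j a x‖ₑ ^ 2) x ∂σ :=
        sum_lintegral_le_lintegral_sum _ _
      _ ≤ ∫⁻ x in Q.carrier, 32 * (c : ℝ≥0∞) ^ 2 * ν x ∂σ := by
        refine lintegral_mono fun x => ?_
        rw [← Finset.mul_sum, mul_comm]
        gcongr
        exact sum_indicator_goodSet_le hN x
      _ = _ := lintegral_const_mul' _ _ hctop
  -- the exit time and later generations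
  have hafter : ∀ j ∈ Finset.Ico Q.rk N, (∫⁻ x in Γ j \ Γ (j + 1),
        ‖F.weightJump H L j x v‖ₑ ^ 2 ∂σ) + ∑ k ∈ Finset.Ico (j + 1) N,
          ∫⁻ x in Γ j \ Γ (j + 1), ‖F.weightJump H L k x v‖ₑ ^ 2 ∂σ ≤
      32 * (c : ℝ≥0∞) ^ 2 * (∫⁻ x in Γ j \ Γ (j + 1), ν x ∂σ) +
        testingConst d * A * ∫⁻ x in Γ j \ Γ (j + 1), M x ∂σ := by
    intro j hj
    obtain ⟨hjQ, hjN⟩ := Finset.mem_Ico.1 hj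
    have hexit : ∫⁻ x in Γ j \ Γ (j + 1), ‖F.weightJump H L j x v‖ₑ ^ 2 ∂σ ≤
        32 * (c : ℝ≥0∞) ^ 2 * (∫⁻ x in Γ j \ Γ (j + 1), ν x ∂σ) +
        ∫⁻ x in Γ j \ Γ (j + 1), 2 * ‖L x (weightAvg (F.atomAt (j + 1) x) H v)‖ₑ ^ 2 ∂σ := by
      have hm : AEMeasurable (fun x => 2 * ‖L x (weightAvg (F.atomAt (j + 1) x) H v)‖ₑ ^ 2)
          (σ.restrict (Γ j \ Γ (j + 1))) := by
        have h1 : AEStronglyMeasurable L (σ.restrict (Γ j \ Γ (j + 1))) :=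
          hL.1.mono_measure (Measure.restrict_mono_set _
            (Set.sdiff_subset.trans goodSet_subset))
        exact ((aestronglyMeasurable_apply_level h1 (j + 1)
          fun J => weightAvg J H v).enorm.pow_const 2).const_mul 2
      rw [← lintegral_const_mul' _ _ hctop, ← lintegral_add_right' _ hm]
      refine setLIntegral_mono' (hΓd j hjQ) fun x hx => ?_
      have hxQ : x ∈ Q.carrier := goodSet_subset hx.1
      have hxa : ‖F.levelAvg j a x‖ₑ ≤ 4 * c := by
        have := hx.1.1.2 j (Finset.mem_Icc.2 ⟨hjQ, le_refl _⟩)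
        exact_mod_cast this
      have h2 : ‖L x (weightAvg (F.atomAt j x) H v)‖ₑ ^ 2 ≤ ν x * (4 * c) ^ 2 := by
        rw [← hra _ (atomAt_le hxQ hjQ)]
        refine (hν x _).trans ?_
        gcongr
        exact hxa
      rw [weightJump_apply, map_sub]
      refine (enorm_sub_sq_le _ _).trans ((add_comm _ _).le.trans (add_le_add ?_ (le_refl _)))
      refine (mul_le_mul_right h2 2).trans (le_of_eq ?_)
      ring
    have hlater : (∫⁻ x in Γ j \ Γ (j + 1),
          2 * ‖L x (weightAvg (F.atomAt (j + 1) x) H v)‖ₑ ^ 2 ∂σ) +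
          ∑ k ∈ Finset.Ico (j + 1) N,
            ∫⁻ x in Γ j \ Γ (j + 1), ‖F.weightJump H L k x v‖ₑ ^ 2 ∂σ ≤
        testingConst d * A * ∫⁻ x in Γ j \ Γ (j + 1), M x ∂σ := by
      have htop : (testingConst d * A : ℝ≥0∞) ≠ ∞ := ENNReal.mul_ne_top (by simp) hAtop
      rw [← lintegral_const_mul' _ _ htop]
      refine (add_le_add (le_refl _) (sum_lintegral_le_lintegral_sum _ _)).trans
        ((le_lintegral_add _ _).trans ?_)
      refine setLIntegral_le_of_atoms (measurableSet_goodSet_diff hjQ) fun J hJ hJs _ => ?_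
      have hJQ : J ≤ Q := ⟨hJs.trans (Set.sdiff_subset.trans goodSet_subset), by lia⟩
      have hLJ := hL.mono_measure (restrict_le_restrict hJQ)
      have hm : ∀ k, AEMeasurable (fun x => ‖F.weightJump H L k x v‖ₑ ^ 2)
          (σ.restrict J.carrier) := fun k =>
        (((ContinuousLinearMap.apply 𝕜 E v).continuous.comp_aestronglyMeasurable
          (aestronglyMeasurable_weightJump hLJ.1 k)).enorm).pow_const 2
      rw [lintegral_add_right' _ (Finset.aemeasurable_fun_sum _ fun k _ => hm k),
        lintegral_finsetSum' _ fun k _ => hm k, lintegral_const_mul' _ _ (by simp),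
        setLIntegral_congr_fun (f := fun x => ‖L x (weightAvg (F.atomAt (j + 1) x) H v)‖ₑ ^ 2)
          (g := fun x => ‖L x (weightAvg J H v)‖ₑ ^ 2) J.measurableSet
          fun x hx => by simp only [← hJ, atomAt_eq hx]]
      refine (add_le_add (mul_le_mul_right (hA J hJQ v) 2) (le_refl _)).trans ?_
      have h := ih J hJQ (by lia) (by lia)
      rw [hJ] at h
      rw [← mul_assoc, lintegral_const_mul' _ _ htop]
      refine h.trans ?_
      gcongr
      exact localMaximal_mono hJQ _ _
    calc _ ≤ _ := add_le_add hexit (le_refl _)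
      _ ≤ _ := by rw [add_assoc]; exact add_le_add (le_refl _) hlater
  have hsum : ∑ k ∈ Finset.Ico Q.rk N, ∫⁻ x in Q.carrier, ‖F.weightJump H L k x v‖ₑ ^ 2 ∂σ ≤
      64 * (c : ℝ≥0∞) ^ 2 * (∫⁻ x in Q.carrier, ν x ∂σ) + testingConst d * A *
        ∑ j ∈ Finset.Ico Q.rk N, ∫⁻ x in Γ j \ Γ (j + 1), M x ∂σ := by
    refine (sum_lintegral_le_exit hN hQ _).trans
      ((add_le_add hbefore (Finset.sum_le_sum hafter)).trans ?_)
    rw [Finset.sum_add_distrib, ← Finset.mul_sum, ← Finset.mul_sum, ← add_assoc]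
    refine add_le_add ?_ (le_refl _)
    calc _ ≤ 32 * (c : ℝ≥0∞) ^ 2 * (∫⁻ x in Q.carrier, ν x ∂σ) +
          32 * (c : ℝ≥0∞) ^ 2 * (∫⁻ x in Q.carrier, ν x ∂σ) := by
          gcongr
          exact le_self_add.trans (sum_lintegral_goodSet_diff_add hN hQ ν)
      _ = _ := by ring
  have hνc : 64 * (c : ℝ≥0∞) ^ 2 * (∫⁻ x in Q.carrier, ν x ∂σ) ≤
      64 * d ^ 2 * A * ∫⁻ x in Q.carrier, ‖H x v‖ₑ ^ 2 ∂σ := by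
    refine (mul_le_mul_right hνint _).trans (le_of_eq ?_)
    rw [hcv, hwQ]
    ring
  -- the good set carries half of the measure, and `M` is at least `ω` there
  have hgood : ∫⁻ x in Q.carrier, ‖H x v‖ₑ ^ 2 ∂σ ≤ 2 * ∫⁻ x in Γ N, M x ∂σ := by
    have h1 := two_mul_measure_diff_goodSet_le 𝕜 hc0 hN hai hQ hac
    have h2 : σ Q.carrier ≤ 2 * σ (Γ N) := by
      have h3 := measure_inter_add_sdiff (μ := σ) Q.carrier (hΓm N hN)
      rw [Set.inter_eq_right.2 goodSet_subset] at h3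
      have hfin : σ Q.carrier ≠ ∞ := Q.measure_ne_top
      refine (ENNReal.add_le_add_iff_left hfin).1 ?_
      calc σ Q.carrier + σ Q.carrier
          = 2 * σ (Γ N) + 2 * σ (Q.carrier \ Γ N) := by rw [← two_mul, ← h3, mul_add]
        _ ≤ 2 * σ (Γ N) + σ Q.carrier := add_le_add (le_refl _) h1
        _ = σ Q.carrier + 2 * σ (Γ N) := add_comm _ _
    calc _ = ENNReal.ofReal ω * σ Q.carrier := hwQ
      _ ≤ ENNReal.ofReal ω * (2 * σ (Γ N)) := by gcongr
      _ = 2 * ∫⁻ _ in Γ N, ENNReal.ofReal ω ∂σ := by rw [setLIntegral_const]; ring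
      _ ≤ _ := by
        refine mul_le_mul_right (setLIntegral_mono' (hΓm N hN) fun x hx => ?_) 2
        refine le_of_eq_of_le ?_ (enorm_avg_le_localMaximal Q.le_refl _ (goodSet_subset hx))
        rw [avg_norm_sq_eq hH, Real.enorm_of_nonneg hω0.le]
  calc _ ≤ 2 * A * (∫⁻ x in Q.carrier, ‖H x v‖ₑ ^ 2 ∂σ) +
        (64 * d ^ 2 * A * (∫⁻ x in Q.carrier, ‖H x v‖ₑ ^ 2 ∂σ) + testingConst d * A *
        ∑ j ∈ Finset.Ico Q.rk N, ∫⁻ x in Γ j \ Γ (j + 1), M x ∂σ) :=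
        add_le_add (le_refl _) (hsum.trans (add_le_add hνc (le_refl _)))
    _ = (2 + 64 * d ^ 2) * A * (∫⁻ x in Q.carrier, ‖H x v‖ₑ ^ 2 ∂σ) + testingConst d * A *
        ∑ j ∈ Finset.Ico Q.rk N, ∫⁻ x in Γ j \ Γ (j + 1), M x ∂σ := by ring
    _ ≤ (2 + 64 * d ^ 2) * A * (2 * ∫⁻ x in Γ N, M x ∂σ) + testingConst d * A *
        ∑ j ∈ Finset.Ico Q.rk N, ∫⁻ x in Γ j \ Γ (j + 1), M x ∂σ := by gcongr
    _ = testingConst d * A * (∑ j ∈ Finset.Ico Q.rk N, (∫⁻ x in Γ j \ Γ (j + 1), M x ∂σ) +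
        ∫⁻ x in Γ N, M x ∂σ) := by
      rw [testingConst]
      push_cast
      ring
    _ ≤ _ := mul_le_mul_right (sum_lintegral_goodSet_diff_add hN hQ M) _

/-- The testing condition: the weighted square function of the vector function `H* H v`, localized
to an atom, is controlled by the localized maximal function of the scalar weight `‖H v‖²`. -/
theorem testing_bound {H L : X → E →L[𝕜] E} {A : ℝ≥0∞} (hAtop : A ≠ ∞) {R : F.Atom}
    (hH : MemLp H 2 (σ.restrict R.carrier)) (hL : MemLp L 2 (σ.restrict R.carrier))
    (hA : ∀ J ≤ R, ∀ v, ∫⁻ x in J.carrier, ‖L x (weightAvg J H v)‖ₑ ^ 2 ∂σ ≤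
      A * ∫⁻ x in J.carrier, ‖H x v‖ₑ ^ 2 ∂σ) (v : E) (N : ℤ) {Q : F.Atom} (hQR : Q ≤ R) :
    2 * A * (∫⁻ x in Q.carrier, ‖H x v‖ₑ ^ 2 ∂σ) +
      ∑ k ∈ Finset.Ico Q.rk N, ∫⁻ x in Q.carrier, ‖F.weightJump H L k x v‖ₑ ^ 2 ∂σ ≤
      testingConst (Module.finrank 𝕜 E) * A *
        ∫⁻ x in Q.carrier, localMaximal Q (fun x => ‖H x v‖ ^ 2) x ∂σ := by
  induction hn : (N - Q.rk).toNat using Nat.strong_induction_on generalizing Q with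
  | h n ih =>
    have hHQ := hH.mono_measure (restrict_le_restrict hQR)
    have htriv : ∑ k ∈ Finset.Ico Q.rk N,
        ∫⁻ x in Q.carrier, ‖F.weightJump H L k x v‖ₑ ^ 2 ∂σ = 0 →
        2 * A * (∫⁻ x in Q.carrier, ‖H x v‖ₑ ^ 2 ∂σ) +
        ∑ k ∈ Finset.Ico Q.rk N, ∫⁻ x in Q.carrier, ‖F.weightJump H L k x v‖ₑ ^ 2 ∂σ ≤
        testingConst (Module.finrank 𝕜 E) * A *
          ∫⁻ x in Q.carrier, localMaximal Q (fun x => ‖H x v‖ ^ 2) x ∂σ := fun h0 => by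
      rw [h0, add_zero]
      gcongr ?_ * _ * ?_
      · rw [testingConst]
        push_cast
        exact (by norm_num : (2 : ℝ≥0∞) ≤ 4).trans le_self_add
      · exact setLIntegral_enorm_sq_le_localMaximal hHQ v
    by_cases hN : Q.rk < N
    swap
    · exact htriv (by rw [Finset.Ico_eq_empty hN, Finset.sum_empty])
    by_cases hv : weightAvg Q H v = 0
    · refine htriv (Finset.sum_eq_zero fun k hk => ?_)
      refine (setLIntegral_congr_fun (g := fun _ => 0) Q.measurableSet
        fun x hx => ?_).trans (by simp)
      have hkQ := (Finset.mem_Ico.1 hk).1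
      simp only
      rw [weightJump_apply, weightAvg_apply_eq_zero_of_le (atomAt_le hx (by lia)) hHQ hv,
        weightAvg_apply_eq_zero_of_le (atomAt_le hx hkQ) hHQ hv]
      simp
    · refine testing_step hHQ (hL.mono_measure (restrict_le_restrict hQR)) hAtop
        (fun J hJ => hA J (Atom.le_trans hJ hQR)) v hN.le hv fun J hJ hJQ hJN => ?_
      exact ih _ (by lia) (Atom.le_trans hJ hQR) rfl

end AtomicFiltration

/-! ### The estimate for operator weights -/

namespace AtomicFiltration

variable {X : Type*} [mX : MeasurableSpace X] {σ : Measure X} {F : AtomicFiltration σ}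
  {𝕜 : Type*} [RCLike 𝕜] {E : Type*} [NormedAddCommGroup E] [InnerProductSpace 𝕜 E]
  [NormedSpace ℝ E] [IsScalarTower ℝ 𝕜 E] [CompleteSpace E] [FiniteDimensional 𝕜 E]

/-- `exists_weighted_average` with an arbitrary constant in the packing condition, by scaling the
`T j`; for the constant `0` the `T j` vanish on the vectors in question. -/
theorem exists_weighted_average_of_packing {Q : F.Atom} {N : ℤ} (hN : Q.rk ≤ N)
    {H : X → E →L[𝕜] E}
    (hH : MemLp H 2 (σ.restrict Q.carrier)) {T : ℤ → X → E →L[𝕜] E}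
    (hT : ∀ j ∈ Finset.Ico Q.rk N, MemLp (T j) 2 (σ.restrict Q.carrier)) {K : ℝ≥0}
    (hTH : ∀ J ≤ Q, ∀ v, ∑ j ∈ Finset.Ico J.rk N, ∫⁻ x in J.carrier, ‖T j x v‖ₑ ^ 2 ∂σ ≤
      K * ∫⁻ x in J.carrier, ‖H x v‖ₑ ^ 2 ∂σ) {f : X → E}
    (hf : MemLp f 2 (σ.restrict Q.carrier)) :
    ∃ z : F.Atom → E, (∀ J ≤ Q, gramOperator (σ.restrict J.carrier) H (z J) =
        ∫ x in J.carrier, ContinuousLinearMap.adjoint (H x) (f x) ∂σ) ∧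
      ∑ k ∈ Finset.Ico Q.rk N,
        (∫⁻ x in Q.carrier, ‖H x (z (F.atomAt k x) - z (F.atomAt (k + 1) x))‖ₑ ^ 2 ∂σ) ≤
        ∫⁻ x in Q.carrier, ‖f x‖ₑ ^ 2 ∂σ ∧
      ∑ k ∈ Finset.Ico Q.rk N, (∫⁻ x in Q.carrier, ‖T k x (z (F.atomAt k x))‖ₑ ^ 2 ∂σ) ≤
        K * (carlesonConst (Module.finrank 𝕜 E) * ∫⁻ x in Q.carrier, ‖f x‖ₑ ^ 2 ∂σ) := by
  by_cases hK : K = 0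
  · obtain ⟨z, h1, h2, -⟩ := exists_weighted_average (T := fun _ _ => 0) hN hH
      (fun _ _ => memLp_const 0) (by simp) hf
    refine ⟨z, h1, h2, ?_⟩
    rw [hK, ENNReal.coe_zero, zero_mul]
    refine (Finset.sum_eq_zero fun k hk => ?_).le
    obtain ⟨hk1, hk2⟩ := Finset.mem_Ico.1 hk
    have h : ∫⁻ x in Q.carrier, ‖T k x (z (F.atomAt k x))‖ₑ ^ 2 ∂σ ≤
        ∫⁻ _ in Q.carrier, 0 ∂σ := by
      refine Q.setLIntegral_le_of_atoms hk1 fun J hJ hJQ _ => ?_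
      rw [setLIntegral_congr_fun (g := fun x => ‖T k x (z J)‖ₑ ^ 2) J.measurableSet
        fun x hx => by simp only [← hJ, atomAt_eq hx], lintegral_zero]
      have h := hTH J hJQ (z J)
      rw [hK, ENNReal.coe_zero, zero_mul] at h
      refine le_trans ?_ h
      exact Finset.single_le_sum_of_canonicallyOrdered
        (f := fun j => ∫⁻ x in J.carrier, ‖T j x (z J)‖ₑ ^ 2 ∂σ) (Finset.mem_Ico.2 ⟨hJ.le, hk2⟩)
    simpa using h
  · have hs : ∀ j x v, ‖(((NNReal.sqrt K)⁻¹ : ℝ) : 𝕜) • T j x v‖ₑ ^ 2 =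
        (K : ℝ≥0∞)⁻¹ * ‖T j x v‖ₑ ^ 2 := fun j x v => by
      rw [enorm_smul, mul_pow]
      congr 1
      rw [enorm_sq_eq_ofReal, RCLike.norm_ofReal, sq_abs, inv_pow, ← NNReal.coe_pow,
        NNReal.sq_sqrt, ENNReal.ofReal_inv_of_pos (by positivity), ENNReal.ofReal_coe_nnreal]
    have hK0 : (K : ℝ≥0∞) ≠ 0 := by simpa using hK
    have hKt : (K : ℝ≥0∞) ≠ ∞ := ENNReal.coe_ne_top
    have hKi : (K : ℝ≥0∞)⁻¹ ≠ ∞ := ENNReal.inv_ne_top.2 hK0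
    obtain ⟨z, h1, h2, h3⟩ := exists_weighted_average
      (T := fun j x => (((NNReal.sqrt K)⁻¹ : ℝ) : 𝕜) • T j x) hN hH
      (fun j hj => (hT j hj).const_smul (((NNReal.sqrt K)⁻¹ : ℝ) : 𝕜)) (fun J hJ v => by
        simp_rw [smul_apply, hs, lintegral_const_mul' _ _ hKi]
        rw [← Finset.mul_sum]
        refine (mul_le_mul_right (hTH J hJ v) _).trans (le_of_eq ?_)
        rw [← mul_assoc, ENNReal.inv_mul_cancel hK0 hKt, one_mul]) hf
    refine ⟨z, h1, h2, ?_⟩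
    simp_rw [smul_apply, hs, lintegral_const_mul' _ _ hKi] at h3
    rw [← Finset.mul_sum] at h3
    refine le_trans (le_of_eq ?_) (mul_le_mul_right h3 (K : ℝ≥0∞))
    rw [← mul_assoc, ENNReal.mul_inv_cancel hK0 hKt, one_mul]

/-- The two-weight square function estimate on an atom, for the weights `H* H` and `L* L` over the
generations below `N`. -/
theorem sum_lintegral_levelAvg_sub_le {Q : F.Atom} {N : ℤ} (hN : Q.rk ≤ N) {H L : X → E →L[𝕜] E}
    (hH : MemLp H 2 (σ.restrict Q.carrier)) (hL : MemLp L 2 (σ.restrict Q.carrier)) {A B : ℝ≥0}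
    (hA : ∀ J ≤ Q, ∀ v, ∫⁻ x in J.carrier, ‖L x (weightAvg J H v)‖ₑ ^ 2 ∂σ ≤
      A * ∫⁻ x in J.carrier, ‖H x v‖ₑ ^ 2 ∂σ)
    (hB : ∀ J ≤ Q, ∀ v, ∫⁻ x in J.carrier, localMaximal J (fun x => ‖H x v‖ ^ 2) x ∂σ ≤
      B * ∫⁻ x in J.carrier, ‖H x v‖ₑ ^ 2 ∂σ) {f : X → E}
    (hf : MemLp f 2 (σ.restrict Q.carrier)) :
    ∑ k ∈ Finset.Ico Q.rk N, ∫⁻ x in Q.carrier,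
      ‖L x (F.levelAvg (k + 1) (fun x => ContinuousLinearMap.adjoint (H x) (f x)) x -
        F.levelAvg k (fun x => ContinuousLinearMap.adjoint (H x) (f x)) x)‖ₑ ^ 2 ∂σ ≤
      (2 + 2 * carlesonConst (Module.finrank 𝕜 E) * testingConst (Module.finrank 𝕜 E)) * A * B *
        ∫⁻ x in Q.carrier, ‖f x‖ₑ ^ 2 ∂σ := by
  set d := Module.finrank 𝕜 E with hd
  have hpack : ∀ J ≤ Q, ∀ v, ∑ k ∈ Finset.Ico J.rk N,
      ∫⁻ x in J.carrier, ‖F.weightJump H L k x v‖ₑ ^ 2 ∂σ ≤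
      (testingConst d * A * B : ℝ≥0) * ∫⁻ x in J.carrier, ‖H x v‖ₑ ^ 2 ∂σ := fun J hJ v => by
    refine (le_add_self.trans (testing_bound ENNReal.coe_ne_top hH hL hA v N hJ)).trans ?_
    refine (mul_le_mul_right (hB J hJ v) _).trans (le_of_eq ?_)
    push_cast
    ring
  have hmem : ∀ k ∈ Finset.Ico Q.rk N, MemLp (F.weightJump H L k) 2 (σ.restrict Q.carrier) := by
    intro k hk
    refine memLp_two_of_forall_apply (aestronglyMeasurable_weightJump hL.1 k) fun v => ?_
    refine ((Finset.single_le_sum_of_canonicallyOrdered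
      (f := fun k => ∫⁻ x in Q.carrier, ‖F.weightJump H L k x v‖ₑ ^ 2 ∂σ) hk).trans
      (hpack Q Q.le_refl v)).trans_lt (ENNReal.mul_lt_top ENNReal.coe_lt_top ?_)
    rw [lintegral_enorm_sq_eq (hH.clm_apply_const v)]
    exact ENNReal.ofReal_lt_top
  obtain ⟨z, hz, hdiff, hcarl⟩ := exists_weighted_average_of_packing hN hH hmem hpack hf
  have havg : ∀ J ≤ Q, avg J (fun x => ContinuousLinearMap.adjoint (H x) (f x)) =
      weightAvg J H (z J) := fun J hJ => by
    rw [weightAvg_eq, avg_eq, smul_apply, hz J hJ]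
  -- discrete product rule: the average of `H* f` over `J` is the average of `H* H` applied to `z J`
  have hstep : ∀ k ∈ Finset.Ico Q.rk N, ∫⁻ x in Q.carrier,
      ‖L x (F.levelAvg (k + 1) (fun x => ContinuousLinearMap.adjoint (H x) (f x)) x -
        F.levelAvg k (fun x => ContinuousLinearMap.adjoint (H x) (f x)) x)‖ₑ ^ 2 ∂σ ≤
      2 * A * B * (∫⁻ x in Q.carrier,
        ‖H x (z (F.atomAt k x) - z (F.atomAt (k + 1) x))‖ₑ ^ 2 ∂σ) +
      2 * ∫⁻ x in Q.carrier, ‖F.weightJump H L k x (z (F.atomAt k x))‖ₑ ^ 2 ∂σ := by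
    intro k hk
    have hkQ := (Finset.mem_Ico.1 hk).1
    have hmain : ∫⁻ x in Q.carrier, ‖L x (weightAvg (F.atomAt (k + 1) x) H
        (z (F.atomAt k x) - z (F.atomAt (k + 1) x)))‖ₑ ^ 2 ∂σ ≤ ∫⁻ x in Q.carrier,
        A * B * ‖H x (z (F.atomAt k x) - z (F.atomAt (k + 1) x))‖ₑ ^ 2 ∂σ := by
      refine Q.setLIntegral_le_of_atoms (k := k + 1) (by lia) fun J hJ hJQ _ => ?_
      obtain ⟨x₀, hx₀⟩ := F.nonempty_of_mem _ _ J.mem_atoms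
      have h1 : ∀ x ∈ J.carrier, F.atomAt (k + 1) x = J := fun x hx => by rw [← hJ, atomAt_eq hx]
      have h2 : ∀ x ∈ J.carrier, F.atomAt k x = F.atomAt k x₀ := fun x hx =>
        atomAt_eq_atomAt hx hx₀ (by lia)
      set v := z (F.atomAt k x₀) - z J with hv
      rw [lintegral_const_mul' _ _ (ENNReal.mul_ne_top (by simp) (by simp)),
        setLIntegral_congr_fun (g := fun x => ‖L x (weightAvg J H v)‖ₑ ^ 2) J.measurableSet
          fun x hx => by simp only [h1 x hx, h2 x hx, hv],
        setLIntegral_congr_fun (f := fun x =>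
          ‖H x (z (F.atomAt k x) - z (F.atomAt (k + 1) x))‖ₑ ^ 2)
          (g := fun x => ‖H x v‖ₑ ^ 2) J.measurableSet
          fun x hx => by simp only [h1 x hx, h2 x hx, hv]]
      refine (hA J hJQ v).trans ?_
      rw [mul_assoc]
      refine mul_le_mul_right ((setLIntegral_enorm_sq_le_localMaximal
        (hH.mono_measure (restrict_le_restrict hJQ)) v).trans (hB J hJQ v)) _
    rw [lintegral_const_mul' _ _ (ENNReal.mul_ne_top (by simp) (by simp))] at hmain
    have hm : AEMeasurable (fun x => ‖F.weightJump H L k x (z (F.atomAt k x))‖ₑ ^ 2)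
        (σ.restrict Q.carrier) :=
      (aestronglyMeasurable_apply_level (hmem k hk).1 k z).enorm.pow_const 2
    calc _ ≤ ∫⁻ x in Q.carrier, (2 * ‖L x (weightAvg (F.atomAt (k + 1) x) H
            (z (F.atomAt k x) - z (F.atomAt (k + 1) x)))‖ₑ ^ 2 +
          2 * ‖F.weightJump H L k x (z (F.atomAt k x))‖ₑ ^ 2) ∂σ := by
          refine setLIntegral_mono' Q.measurableSet fun x hx => ?_
          rw [levelAvg, levelAvg, havg _ (atomAt_le hx (by lia)), havg _ (atomAt_le hx hkQ),
            ← enorm_neg (L x (weightAvg (F.atomAt (k + 1) x) H _))]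
          refine le_of_eq_of_le ?_ (enorm_add_sq_le _ _)
          rw [weightJump_apply, ← map_neg, ← map_add, map_sub (weightAvg (F.atomAt (k + 1) x) H)]
          congr 3
          abel
      _ = 2 * (∫⁻ x in Q.carrier, ‖L x (weightAvg (F.atomAt (k + 1) x) H
            (z (F.atomAt k x) - z (F.atomAt (k + 1) x)))‖ₑ ^ 2 ∂σ) +
          2 * ∫⁻ x in Q.carrier, ‖F.weightJump H L k x (z (F.atomAt k x))‖ₑ ^ 2 ∂σ := by
        rw [lintegral_add_right' _ (hm.const_mul 2), lintegral_const_mul' _ _ (by simp),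
          lintegral_const_mul' _ _ (by simp)]
      _ ≤ _ := by
        rw [mul_assoc 2, mul_assoc 2]
        exact add_le_add (mul_le_mul_right hmain 2) (_root_.le_refl _)
  refine (Finset.sum_le_sum hstep).trans ?_
  rw [Finset.sum_add_distrib, ← Finset.mul_sum, ← Finset.mul_sum]
  refine (add_le_add (mul_le_mul_right hdiff _) (mul_le_mul_right hcarl _)).trans (le_of_eq ?_)
  push_cast
  ring

/-- The two-weight square function estimate for the weights `H* H` and `L* L`. -/
theorem lintegral_tsum_levelAvg_sub_le {H L : X → E →L[𝕜] E}
    (hH : ∀ Q : F.Atom, MemLp H 2 (σ.restrict Q.carrier))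
    (hL : ∀ Q : F.Atom, MemLp L 2 (σ.restrict Q.carrier)) {A B : ℝ≥0}
    (hA : ∀ (J : F.Atom) v, ∫⁻ x in J.carrier, ‖L x (weightAvg J H v)‖ₑ ^ 2 ∂σ ≤
      A * ∫⁻ x in J.carrier, ‖H x v‖ₑ ^ 2 ∂σ)
    (hB : ∀ (J : F.Atom) v, ∫⁻ x in J.carrier, localMaximal J (fun x => ‖H x v‖ ^ 2) x ∂σ ≤
      B * ∫⁻ x in J.carrier, ‖H x v‖ₑ ^ 2 ∂σ) {f : X → E} (hf : MemLp f 2 σ) :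
    ∫⁻ x, ∑' I : F.Atom, ‖L x (martingaleDiff I
        (fun x => ContinuousLinearMap.adjoint (H x) (f x)) x)‖ₑ ^ 2 ∂σ ≤
      (2 + 2 * carlesonConst (Module.finrank 𝕜 E) * testingConst (Module.finrank 𝕜 E)) * A * B *
        ∫⁻ x, ‖f x‖ₑ ^ 2 ∂σ := by
  set g := fun x => ContinuousLinearMap.adjoint (H x) (f x) with hg
  have hm : ∀ k : ℤ, AEMeasurable
      (fun x => ‖L x (F.levelAvg (k + 1) g x - F.levelAvg k g x)‖ₑ ^ 2) σ := fun k => by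
    have hL' : AEStronglyMeasurable L σ := aestronglyMeasurable_of_atoms fun J => (hL J).1
    exact (isBoundedBilinearMap_apply.continuous.comp_aestronglyMeasurable
      (hL'.prodMk ((stronglyMeasurable_levelAvg (k + 1) g).sub
        (stronglyMeasurable_levelAvg k g)).aestronglyMeasurable)).enorm.pow_const 2
  have e : ∀ x, ∑' I : F.Atom, ‖L x (martingaleDiff I g x)‖ₑ ^ 2 =
      ∑' k : ℤ, ‖L x (F.levelAvg (k + 1) g x - F.levelAvg k g x)‖ₑ ^ 2 := fun x =>
    tsum_martingaleDiff g (fun v => ‖L x v‖ₑ ^ 2) (by simp) x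
  simp_rw [e]
  rw [lintegral_tsum hm, ENNReal.tsum_eq_iSup_sum]
  refine iSup_le fun s => ?_
  obtain ⟨M, hM⟩ : ∃ M : ℕ, s ⊆ Finset.Ico (-(M : ℤ)) M := by
    refine ⟨s.sup Int.natAbs + 1, fun k hk => ?_⟩
    have := Finset.le_sup (f := Int.natAbs) hk
    simp only [Finset.mem_Ico]
    lia
  refine (Finset.sum_le_sum_of_subset hM).trans ?_
  have htop : (2 + 2 * carlesonConst (Module.finrank 𝕜 E) * testingConst (Module.finrank 𝕜 E)) *
      A * B ≠ (∞ : ℝ≥0∞) := by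
    refine ne_of_eq_of_ne (b := (((2 + 2 * carlesonConst (Module.finrank 𝕜 E) *
      testingConst (Module.finrank 𝕜 E)) * A * B : ℝ≥0) : ℝ≥0∞)) ?_ ENNReal.coe_ne_top
    push_cast
    rfl
  rw [← lintegral_finsetSum' _ fun k _ => hm k, ← lintegral_const_mul' _ _ htop]
  refine lintegral_le_of_atoms (F := F) (-(M : ℤ)) fun Q hQ => ?_
  rw [lintegral_finsetSum' _ fun k _ => (hm k).restrict, lintegral_const_mul' _ _ htop, ← hQ]
  exact sum_lintegral_levelAvg_sub_le (by lia) (hH Q) (hL Q) (fun J _ => hA J) (fun J _ => hB J)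
    (hf.restrict _)

end AtomicFiltration

/-! ### Matrix weights -/

section MatrixSqrt

theorem CFC.measurable_sqrt {A : Type*} [NormedRing A] [StarRing A] [NormedAlgebra ℝ A]
    [IsometricContinuousFunctionalCalculus ℝ A IsSelfAdjoint] [ContinuousStar A] [PartialOrder A]
    [StarOrderedRing A] [NonnegSpectrumClass ℝ A] [CompleteSpace A]
    [MeasurableSpace A] [BorelSpace A] (hA : IsClosed {a : A | 0 ≤ a}) :
    Measurable (CFC.sqrt : A → A) := by
  classical
  have e : (CFC.sqrt : A → A) = {a : A | 0 ≤ a}.piecewise CFC.sqrt fun _ => (0 : A) := by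
    ext1 a
    by_cases ha : 0 ≤ a
    · exact (Set.piecewise_eq_of_mem {a : A | 0 ≤ a} _ _ ha).symm
    · rw [CFC.sqrt_of_not_nonneg ha]
      exact (Set.piecewise_eq_of_notMem {a : A | 0 ≤ a} CFC.sqrt (fun _ => (0 : A)) ha).symm
  rw [e]
  exact CFC.continuousOn_sqrt.measurable_piecewise continuousOn_const hA.measurableSet

variable {𝕜 : Type*} [RCLike 𝕜] {d : ℕ}

theorem Matrix.isClosed_nonneg :
    IsClosed {P : Matrix (Fin d) (Fin d) 𝕜 | 0 ≤ P} := by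
  simp_rw [Matrix.nonneg_iff_posSemidef, Matrix.posSemidef_iff_dotProduct_mulVec, Set.ofPred_and,
    Set.ofPred_forall]
  refine (isClosed_eq (by fun_prop) continuous_id).inter (isClosed_iInter fun v => ?_)
  exact isClosed_le continuous_const (by fun_prop)

open scoped Matrix.Norms.L2Operator in
theorem Matrix.measurable_sqrt [MeasurableSpace (Matrix (Fin d) (Fin d) 𝕜)]
    [BorelSpace (Matrix (Fin d) (Fin d) 𝕜)] :
    Measurable (CFC.sqrt : Matrix (Fin d) (Fin d) 𝕜 → Matrix (Fin d) (Fin d) 𝕜) := by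
  -- Mathlib provides the isometric functional calculus over `ℝ`, but not the real normed algebra
  let : NormedAlgebra ℝ (Matrix (Fin d) (Fin d) 𝕜) :=
    { (inferInstance : Algebra ℝ (Matrix (Fin d) (Fin d) 𝕜)) with
      norm_smul_le := fun r P => by
        rw [← algebraMap_smul 𝕜 r P, norm_smul]; simp }
  have : CompleteSpace (Matrix (Fin d) (Fin d) 𝕜) := FiniteDimensional.complete 𝕜 _
  exact CFC.measurable_sqrt (A := Matrix (Fin d) (Fin d) 𝕜) Matrix.isClosed_nonneg

theorem toEuclideanCLM_eq_sum (P : Matrix (Fin d) (Fin d) 𝕜) :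
    Matrix.toEuclideanCLM (n := Fin d) (𝕜 := 𝕜) P = ∑ i, ∑ j, P i j •
      Matrix.toEuclideanCLM (n := Fin d) (𝕜 := 𝕜) (Matrix.single i j (1 : 𝕜)) := by
  conv_lhs => rw [Matrix.matrix_eq_sum_single P]
  simp_rw [map_sum, ← map_smul, Matrix.smul_single, smul_eq_mul, mul_one]

theorem aestronglyMeasurable_toEuclideanCLM_sqrt {X : Type*} [MeasurableSpace X]
    {μ : Measure X} {U : X → Matrix (Fin d) (Fin d) 𝕜}
    (h : ∀ i j, AEStronglyMeasurable (fun x => U x i j) μ) :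
    AEStronglyMeasurable
      (fun x => Matrix.toEuclideanCLM (n := Fin d) (𝕜 := 𝕜) (CFC.sqrt (U x))) μ := by
  let : MeasurableSpace (Matrix (Fin d) (Fin d) 𝕜) := borel _
  have : BorelSpace (Matrix (Fin d) (Fin d) 𝕜) := ⟨rfl⟩
  have : SecondCountableTopology (Matrix (Fin d) (Fin d) 𝕜) :=
    inferInstanceAs (SecondCountableTopology (Fin d → Fin d → 𝕜))
  have : TopologicalSpace.PseudoMetrizableSpace (Matrix (Fin d) (Fin d) 𝕜) :=
    inferInstanceAs (TopologicalSpace.PseudoMetrizableSpace (Fin d → Fin d → 𝕜))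
  have hU : AEStronglyMeasurable U μ := by
    have e : U = fun x => ∑ i, ∑ j, U x i j • Matrix.single i j (1 : 𝕜) := by
      ext1 x
      conv_lhs => rw [Matrix.matrix_eq_sum_single (U x)]
      simp [Matrix.smul_single]
    rw [e]
    exact Finset.aestronglyMeasurable_fun_sum _ fun i _ =>
      Finset.aestronglyMeasurable_fun_sum _ fun j _ => (h i j).smul_const _
  have hs : AEStronglyMeasurable (fun x => CFC.sqrt (U x)) μ :=
    (Matrix.measurable_sqrt.comp_aemeasurable hU.aemeasurable).aestronglyMeasurable
  simp_rw [toEuclideanCLM_eq_sum (CFC.sqrt (U _))]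
  refine Finset.aestronglyMeasurable_fun_sum _ fun i _ =>
    Finset.aestronglyMeasurable_fun_sum _ fun j _ => AEStronglyMeasurable.smul_const ?_ _
  exact (continuous_id.matrix_elem i j).comp_aestronglyMeasurable hs

theorem adjoint_toEuclideanCLM_sqrt (P : Matrix (Fin d) (Fin d) 𝕜) :
    ContinuousLinearMap.adjoint (Matrix.toEuclideanCLM (n := Fin d) (𝕜 := 𝕜) (CFC.sqrt P)) =
      Matrix.toEuclideanCLM (n := Fin d) (𝕜 := 𝕜) (CFC.sqrt P) := by
  rw [← ContinuousLinearMap.star_eq_adjoint, ← map_star]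
  exact congrArg _ (IsSelfAdjoint.of_nonneg (CFC.sqrt_nonneg P))

theorem toEuclideanCLM_sqrt_comp_self {P : Matrix (Fin d) (Fin d) 𝕜} (hP : 0 ≤ P) :
    (Matrix.toEuclideanCLM (n := Fin d) (𝕜 := 𝕜) (CFC.sqrt P)).comp
      (Matrix.toEuclideanCLM (n := Fin d) (𝕜 := 𝕜) (CFC.sqrt P)) =
      Matrix.toEuclideanCLM (n := Fin d) (𝕜 := 𝕜) P := by
  rw [← ContinuousLinearMap.mul_def, ← map_mul, CFC.sqrt_mul_sqrt_self P hP]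

theorem re_inner_toEuclideanCLM {P : Matrix (Fin d) (Fin d) 𝕜} (hP : 0 ≤ P)
    (e : EuclideanSpace 𝕜 (Fin d)) :
    RCLike.re (inner 𝕜 e (Matrix.toEuclideanCLM (n := Fin d) (𝕜 := 𝕜) P e)) =
      ‖Matrix.toEuclideanCLM (n := Fin d) (𝕜 := 𝕜) (CFC.sqrt P) e‖ ^ 2 := by
  rw [← toEuclideanCLM_sqrt_comp_self hP, ContinuousLinearMap.comp_apply,
    ← ContinuousLinearMap.adjoint_inner_left, adjoint_toEuclideanCLM_sqrt, inner_self_eq_norm_sq]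

end MatrixSqrt

namespace AtomicFiltration

variable {X : Type*} [mX : MeasurableSpace X] {σ : Measure X} {F : AtomicFiltration σ}
  {𝕜 : Type*} [RCLike 𝕜] {d : ℕ} {U V : X → Matrix (Fin d) (Fin d) 𝕜}

namespace IsMatrixWeight

theorem adjoint_comp_sqrt (hU : F.IsMatrixWeight U) (x : X) :
    (ContinuousLinearMap.adjoint
      (Matrix.toEuclideanCLM (n := Fin d) (𝕜 := 𝕜) (CFC.sqrt (U x)))).comp
      (Matrix.toEuclideanCLM (n := Fin d) (𝕜 := 𝕜) (CFC.sqrt (U x))) =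
      Matrix.toEuclideanCLM (n := Fin d) (𝕜 := 𝕜) (U x) := by
  rw [adjoint_toEuclideanCLM_sqrt, toEuclideanCLM_sqrt_comp_self (hU.posSemidef x).nonneg]

theorem integrable_sum_smul (hU : F.IsMatrixWeight U) (J : F.Atom) {G : Type*}
    [NormedAddCommGroup G] [NormedSpace 𝕜 G] (M : Fin d → Fin d → G) :
    Integrable (fun x => ∑ i, ∑ j, U x i j • M i j) (σ.restrict J.carrier) :=
  integrable_finsetSum _ fun i _ => integrable_finsetSum _ fun j _ =>
    (hU.integrableOn J i j).smul_const _

theorem integrableOn_toEuclideanCLM (hU : F.IsMatrixWeight U) (J : F.Atom) :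
    IntegrableOn (fun x => Matrix.toEuclideanCLM (n := Fin d) (𝕜 := 𝕜) (U x)) J.carrier σ := by
  simp_rw [toEuclideanCLM_eq_sum (U _)]
  exact hU.integrable_sum_smul J (G := EuclideanSpace 𝕜 (Fin d) →L[𝕜] EuclideanSpace 𝕜 (Fin d)) _

theorem memLp_sqrt (hU : F.IsMatrixWeight U) (J : F.Atom) :
    MemLp (fun x => Matrix.toEuclideanCLM (n := Fin d) (𝕜 := 𝕜) (CFC.sqrt (U x))) 2
      (σ.restrict J.carrier) := by
  refine (memLp_two_iff_integrable_sq_norm (aestronglyMeasurable_toEuclideanCLM_sqrt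
    fun i j => (hU.integrableOn J i j).1)).2 ?_
  refine (hU.integrableOn_toEuclideanCLM J).norm.congr (Filter.Eventually.of_forall fun x => ?_)
  simp only
  rw [← hU.adjoint_comp_sqrt, ContinuousLinearMap.norm_adjoint_comp_self, sq]

theorem weightAvg_sqrt (hU : F.IsMatrixWeight U) (J : F.Atom) :
    weightAvg J (fun x => Matrix.toEuclideanCLM (n := Fin d) (𝕜 := 𝕜) (CFC.sqrt (U x))) =
      Matrix.toEuclideanCLM (n := Fin d) (𝕜 := 𝕜) (matAvg J U) := by
  simp_rw [weightAvg, hU.adjoint_comp_sqrt, toEuclideanCLM_eq_sum (U _)]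
  rw [toEuclideanCLM_eq_sum (matAvg J U), avg_eq, integral_finsetSum _ fun i _ =>
    integrable_finsetSum _ fun j _ => (hU.integrableOn J i j).smul_const _, Finset.smul_sum]
  refine Finset.sum_congr rfl fun i _ => ?_
  rw [integral_finsetSum _ fun j _ => (hU.integrableOn J i j).smul_const _, Finset.smul_sum]
  refine Finset.sum_congr rfl fun j _ => ?_
  rw [integral_smul_const, matAvg, Matrix.of_apply, avg_eq, smul_assoc]

theorem matAvg_nonneg (hU : F.IsMatrixWeight U) (J : F.Atom) : 0 ≤ matAvg J U := by
  have h := weightAvg_isPositive (hU.memLp_sqrt J)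
  rw [hU.weightAvg_sqrt] at h
  exact (Matrix.isPositive_toEuclideanLin_iff.1 h.toLinearMap).nonneg

theorem setLIntegral_sqrt (hU : F.IsMatrixWeight U) (J : F.Atom) (e : EuclideanSpace 𝕜 (Fin d)) :
    ∫⁻ x in J.carrier, ‖Matrix.toEuclideanCLM (n := Fin d) (𝕜 := 𝕜) (CFC.sqrt (U x)) e‖ₑ ^ 2 ∂σ =
      ‖Matrix.toEuclideanCLM (n := Fin d) (𝕜 := 𝕜) (CFC.sqrt (matAvg J U)) e‖ₑ ^ 2 *
        σ J.carrier := by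
  rw [setLIntegral_enorm_sq_eq (hU.memLp_sqrt J), hU.weightAvg_sqrt,
    re_inner_toEuclideanCLM (hU.matAvg_nonneg J), enorm_sq_eq_ofReal]

/-- The joint `A₂` condition in integrated form. -/
theorem setLIntegral_sqrt_weightAvg_le (hU : F.IsMatrixWeight U) (hV : F.IsMatrixWeight V)
    (J : F.Atom) (e : EuclideanSpace 𝕜 (Fin d)) :
    ∫⁻ x in J.carrier, ‖Matrix.toEuclideanCLM (n := Fin d) (𝕜 := 𝕜) (CFC.sqrt (V x))
      (weightAvg J (fun x => Matrix.toEuclideanCLM (n := Fin d) (𝕜 := 𝕜) (CFC.sqrt (U x))) e)‖ₑ ^ 2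
        ∂σ ≤ F.jointA2 U V *
      ∫⁻ x in J.carrier, ‖Matrix.toEuclideanCLM (n := Fin d) (𝕜 := 𝕜) (CFC.sqrt (U x)) e‖ₑ ^ 2
        ∂σ := by
  rw [hV.setLIntegral_sqrt, hU.setLIntegral_sqrt, hU.weightAvg_sqrt, ← mul_assoc]
  refine mul_le_mul_left ?_ _
  rw [← toEuclideanCLM_sqrt_comp_self (hU.matAvg_nonneg J), ContinuousLinearMap.comp_apply]
  set R := Matrix.toEuclideanCLM (n := Fin d) (𝕜 := 𝕜) (CFC.sqrt (matAvg J U)) with hR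
  set S := Matrix.toEuclideanCLM (n := Fin d) (𝕜 := 𝕜) (CFC.sqrt (matAvg J V)) with hS
  have hnorm : ‖S * R‖ₑ = ‖R * S‖ₑ := by
    have h1 : star R = R := adjoint_toEuclideanCLM_sqrt _
    have h2 : star S = S := adjoint_toEuclideanCLM_sqrt _
    have h : ‖S * R‖ = ‖R * S‖ := by rw [← norm_star, star_mul, h1, h2]
    rw [← ofReal_norm, h, ofReal_norm]
  have hle : ‖R * S‖ₑ ^ 2 ≤ F.jointA2 U V := by
    rw [hR, hS, ← map_mul]
    exact le_iSup (fun I : F.Atom => ‖Matrix.toEuclideanCLM (n := Fin d) (𝕜 := 𝕜)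
      (CFC.sqrt (matAvg I U) * CFC.sqrt (matAvg I V))‖ₑ ^ 2) J
  refine le_trans ?_ (mul_le_mul_left hle _)
  rw [← hnorm, ← mul_pow]
  refine pow_le_pow_left' ?_ 2
  exact (S * R).le_opENorm (R e)

end IsMatrixWeight

theorem setLAverage_localMaximal_le {w : X → ℝ} (hw : F.scalarAinfty w < ∞) (J : F.Atom) :
    ⨍⁻ x in J.carrier, localMaximal J w x ∂σ ≤
      F.scalarAinfty w * ENNReal.ofReal (avg J w) := by
  obtain ⟨C, hC, -⟩ := sInf_lt_iff.1 hw
  by_cases h0 : ENNReal.ofReal (avg J w) = 0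
  · have h := hC J
    rwa [h0, mul_zero] at h ⊢
  · rw [← ENNReal.div_le_iff_le_mul (Or.inl h0) (Or.inl ENNReal.ofReal_ne_top)]
    exact le_sInf fun C hC => ENNReal.div_le_of_le_mul (hC J)

/-- The `A_∞` condition in integrated form. -/
theorem IsMatrixWeight.setLIntegral_localMaximal_le (hU : F.IsMatrixWeight U)
    (h : F.matrixAinfty U < ∞) (J : F.Atom) (e : EuclideanSpace 𝕜 (Fin d)) :
    ∫⁻ x in J.carrier, localMaximal J (fun x =>
      ‖Matrix.toEuclideanCLM (n := Fin d) (𝕜 := 𝕜) (CFC.sqrt (U x)) e‖ ^ 2) x ∂σ ≤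
      F.matrixAinfty U *
      ∫⁻ x in J.carrier, ‖Matrix.toEuclideanCLM (n := Fin d) (𝕜 := 𝕜) (CFC.sqrt (U x)) e‖ₑ ^ 2
        ∂σ := by
  have hw : (fun x => RCLike.re (inner 𝕜 e
      (Matrix.toEuclideanCLM (n := Fin d) (𝕜 := 𝕜) (U x) e))) = fun x =>
      ‖Matrix.toEuclideanCLM (n := Fin d) (𝕜 := 𝕜) (CFC.sqrt (U x)) e‖ ^ 2 :=
    funext fun x => re_inner_toEuclideanCLM (hU.posSemidef x).nonneg e
  have hle : F.scalarAinfty (fun x =>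
      ‖Matrix.toEuclideanCLM (n := Fin d) (𝕜 := 𝕜) (CFC.sqrt (U x)) e‖ ^ 2) ≤
      F.matrixAinfty U := by
    rw [← hw]
    exact le_iSup (fun e : EuclideanSpace 𝕜 (Fin d) => F.scalarAinfty fun x =>
      RCLike.re (inner 𝕜 e (Matrix.toEuclideanCLM (n := Fin d) (𝕜 := 𝕜) (U x) e))) e
  rw [setLIntegral_enorm_sq_eq_avg (hU.memLp_sqrt J), avg_norm_sq_eq (hU.memLp_sqrt J),
    Real.enorm_of_nonneg ((weightAvg_isPositive (hU.memLp_sqrt J)).re_inner_nonneg_right e),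
    ← avg_norm_sq_eq (hU.memLp_sqrt J), ← measure_mul_setLAverage _ J.measure_ne_top, mul_comm,
    ← mul_assoc]
  refine mul_le_mul_left ((setLAverage_localMaximal_le (hle.trans_lt h) J).trans ?_) _
  exact mul_le_mul_left hle _

theorem eLpNorm_squareFunction (f : X → EuclideanSpace 𝕜 (Fin d)) :
    eLpNorm (F.squareFunction V f) 2 σ = (∫⁻ x, ∑' I : F.Atom,
      ‖Matrix.toEuclideanCLM (n := Fin d) (𝕜 := 𝕜) (CFC.sqrt (V x)) (martingaleDiff I f x)‖ₑ ^ 2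
        ∂σ) ^ (1 / 2 : ℝ) := by
  rw [eLpNorm_eq_lintegral_rpow_enorm_toReal (by simp) (by simp)]
  simp only [ENNReal.toReal_ofNat, squareFunction, enorm_eq_self]
  congr 1
  refine lintegral_congr fun x => ?_
  rw [← ENNReal.rpow_mul]
  simp

end AtomicFiltration

theorem theorem1p1 (d : ℕ) :
    ∃ C : ℝ≥0, ∀ {𝕜 : Type*} [RCLike 𝕜] {X : Type*} [MeasurableSpace X] (σ : Measure X)
      [SigmaFinite σ] (F : AtomicFiltration σ) (U V : X → Matrix (Fin d) (Fin d) 𝕜),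
      F.IsMatrixWeight U → F.IsMatrixWeight V → F.jointA2 U V < ∞ → F.matrixAinfty U < ∞ →
      ∀ f : X → EuclideanSpace 𝕜 (Fin d), MemLp f 2 σ →
        eLpNorm (F.squareFunction V fun x =>
            Matrix.toEuclideanCLM (n := Fin d) (𝕜 := 𝕜) (CFC.sqrt (U x)) (f x)) 2 σ ≤
          C * F.jointA2 U V ^ (1 / 2 : ℝ) * F.matrixAinfty U ^ (1 / 2 : ℝ) * eLpNorm f 2 σ := by
  refine ⟨(2 + 2 * AtomicFiltration.carlesonConst d *
      AtomicFiltration.testingConst d) ^ (1 / 2 : ℝ), fun {𝕜} _ {X} _ σ _ F U V hU hV hA hB f hf => ?_⟩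
  have hA' := ENNReal.coe_toNNReal hA.ne
  have hB' := ENNReal.coe_toNNReal hB.ne
  have h := AtomicFiltration.lintegral_tsum_levelAvg_sub_le (A := (F.jointA2 U V).toNNReal)
    (B := (F.matrixAinfty U).toNNReal) hU.memLp_sqrt hV.memLp_sqrt
    (fun J v => by rw [hA']; exact hU.setLIntegral_sqrt_weightAvg_le hV J v)
    (fun J v => by rw [hB']; exact hU.setLIntegral_localMaximal_le hB J v) hf
  rw [hA', hB'] at h
  simp_rw [adjoint_toEuclideanCLM_sqrt, finrank_euclideanSpace_fin] at h
  rw [AtomicFiltration.eLpNorm_squareFunction,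
    eLpNorm_eq_lintegral_rpow_enorm_toReal (by simp) (by simp),
    ENNReal.coe_rpow_of_nonneg _ (by norm_num)]
  simp only [ENNReal.toReal_ofNat, ENNReal.rpow_ofNat]
  rw [← ENNReal.mul_rpow_of_nonneg _ _ (by norm_num),
    ← ENNReal.mul_rpow_of_nonneg _ _ (by norm_num), ← ENNReal.mul_rpow_of_nonneg _ _ (by norm_num)]
  refine ENNReal.rpow_le_rpow ?_ (by norm_num)
  push_cast
  exact h
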